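/- **Setting.** There are $K\ge 1$ arms. Pulling arm $k$ at round $t=1,2,\dots$ yields a reward $r_{k,t}\in[0,1]$ and consumes $c_{k,t}\in[0,1]$ units of a resource; $(r_{k,t},c_{k,t})$ has a fixed law $\nu_k$ and is independent of the past (outcomes may be correlated across arms). Let $\mu^r_k,\mu^c_k$ be the means. Fix $b\in(0,1)$. With horizon $T\in\mathbb N$ and budget $B=bT$, the game ends at $\tau^*$, the first round $t$ with $t>T$ or $\sum_{s\le t}c_{a_s,s}>B$, where $a_s$ is the action of round $s$; the payoff is $\mathbb E[\sum_{t=1}^{\tau^*-1}r_{a_t,t}]$. The actions are the arms $k=1,\dots,K$, skipping (reward and consumption $0$), and, for each $k$, pulling arm $k$ with one full unit of the resource charged (reward $r_{k,t}$, consumption $1$). The regret $R_{B,T}$ of an algorithm is the supremum of the payoffs of non-anticipating algorithms (which may know the $\nu_k$) minus its own payoff. **Assumptions.** There is $\sigma>0$ with $\mu^r_k\le\sigma\mu^c_k$ for all $k$; there is $\kappa>0$, known to the algorithm, with $|\mu^r_k-\mu^r_l|\le\kappa|\mu^c_k-\mu^c_l|$ for all $k,l$; and $|\mu^c_k-b|>0$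 for all $k$. Put $\epsilon=\min_k|\mu^c_k-b|$ and $\lambda=1+2\kappa$. **Bases.** For coefficients $\rho_k,\gamma_k$ consider the linear program: maximize $\sum_k\rho_k\xi_k$ subject to $\sum_k\gamma_k\xi_k\le b$, $\sum_k\xi_k\le1$, $\xi\ge0$. A basis $x$ is a non-empty set of arms $\mathcal K_x$ together with a set $\mathcal C_x$ of equally many of the two constraints such that the corresponding square block of the constraint matrix is invertible; its basic solution $\xi^x$ vanishes off $\mathcal K_x$ and satisfies the constraints in $\mathcal C_x$ with equality; $x$ is feasible if $\xi^x$ is, and optimal if moreover $\xi^x$ is an optimal solution. Let $\mathcal B$ be the set of feasible bases for $\rho=\mu^r,\gamma=\mu^c$, and for $x\in\mathcal B$ let $\Delta_x\ge0$ be the optimal value of this program minus $\sum_k\mu^r_k\xi^x_k$. **Algorithm** (UCB-Simplex with $\eta_1=1$, $\eta_2=0$ and the pacing load balancer). Pull each arm once in rounds $1,\dots,K$. At a round $t>K$, let $n_{k,t}$ be the number of earlier pulls of arm $k$ (with or without the full unit charged), $\bar r_{k,t},\bar c_{k,t}$ the empirical means of the rewards and actual consumptions observed in them, and $\epsilon_{k,t}=\sqrt{2\ln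 t/n_{k,t}}$. Select an optimal basis $x_t$ of the program with $\rho_k=\bar r_{k,t}+\lambda\epsilon_{k,t}$ and $\gamma_k=\bar c_{k,t}-\epsilon_{k,t}$, ties being broken by any non-anticipating rule. The selected basis $x=x_t$ determines two actions: its two arms; or, if $\mathcal K_x=\{k\}$ and $\mathcal C_x$ is the resource constraint, arm $k$ and skipping; or, if $\mathcal K_x=\{k\}$ and $\mathcal C_x$ is the time constraint, arm $k$ and arm $k$ with the full unit charged. Let $n_{x,t}$ be the number of earlier rounds $s>K$ with $x_s=x$ and $b_{x,t}$ the resource consumption charged in those rounds. If $b_{x,t}\le n_{x,t}b$, take the one of the two actions with the larger lower confidence bound on consumption, otherwise the other one; this bound is $\bar c_{k,t}-\epsilon_{k,t}$ for arm $k$, $0$ for skipping, and $1$ for a pull with the full unit charged. **Theorem.** There is a universal constant $C>0$ such that, for all $K$, $(\nu_k)$, $b$, $\kappa$, $\sigma$ as above, there is $T_0$ depending only on $K,(\nu_k),b,\kappa,\sigma$ such that, for every $T\ge T_0$, the algorithm satisfies $$R_{B,T}\le 2^9\,\frac{\lambda^2}{\epsilon^3}\Big(\sum_{x\in\mathcal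 B,\ \Delta_x>0}\frac1{\Delta_x}\Big)\ln T+C\,\frac{K^2\sigma}{\epsilon^3}\ln T .$$ Consequently, for every $\Delta>0$ with $\Delta\le\Delta_x$ for all $x\in\mathcal B$ with $\Delta_x>0$ (for instance the smallest positive gap), $$R_{B,T}\le C\,K^2\Big(\frac{\lambda^2}{\epsilon^3\Delta}+\frac{\sigma}{\epsilon^3}\Big)\ln T ,$$ which is $O(K^2\ln T)$ as $T\to\infty$. -/

import Mathlib

open MeasureTheory ProbabilityTheory

noncomputable section

namespace KnapsackBandit

/-! ### The linear program and its bases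

Resource `0` is the stochastic resource and resource `1` is time. -/

/-- Matrix of the mean (or estimated) consumptions: pulling arm `k` uses `c k` units of the
resource and one unit of time. -/
def consumption {K : ℕ} (c : Fin K → ℝ) : Matrix (Fin 2) (Fin K) ℝ := fun i k => ![c k, 1] i

/-- Right-hand side of the constraints, per round. -/
def rhs (b : ℝ) : Fin 2 → ℝ := ![b, 1]

/-- `ξ` is feasible: `A ξ ≤ β` and `ξ ≥ 0`. -/
def IsFeasible {K : ℕ} (A : Matrix (Fin 2) (Fin K) ℝ) (β : Fin 2 → ℝ) (ξ : Fin K → ℝ) : Prop :=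
  (∀ i, (A.mulVec ξ) i ≤ β i) ∧ ∀ k, 0 ≤ ξ k

/-- Pseudo-bases: a non-empty set of arms and a set of resources with equally many elements. -/
abbrev PseudoBasis (K : ℕ) : Type :=
  {x : Finset (Fin K) × Finset (Fin 2) // x.1.Nonempty ∧ x.1.card = x.2.card}

/-- The arms of a pseudo-basis. -/
abbrev arms {K : ℕ} (x : PseudoBasis K) : Finset (Fin K) := x.1.1

/-- The resources of a pseudo-basis. -/
abbrev resources {K : ℕ} (x : PseudoBasis K) : Finset (Fin 2) := x.1.2

/-- The square block `A_x` of the constraint matrix cut out by `x`. -/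
def block {K : ℕ} (A : Matrix (Fin 2) (Fin K) ℝ) (x : PseudoBasis K) :
    Matrix (resources x) (arms x) ℝ :=
  A.submatrix (fun i => (i : Fin 2)) (fun k => (k : Fin K))

/-- `x` is a basis: `A_x` is invertible (as a linear map). -/
def IsBasis {K : ℕ} (A : Matrix (Fin 2) (Fin K) ℝ) (x : PseudoBasis K) : Prop :=
  Function.Bijective (block A x).mulVec

/-- The basic solution of a basis `x`: it vanishes outside the arms of `x` and
solves `A_x ξ = β_x` on them. -/
def basicSol {K : ℕ} (A : Matrix (Fin 2) (Fin K) ℝ) (β : Fin 2 → ℝ) (x : PseudoBasis K) :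
    Fin K → ℝ := fun k =>
  if h : k ∈ arms x then
    Function.invFun (block A x).mulVec (fun i : resources x => β i) ⟨k, h⟩
  else 0

/-- `x` is a feasible basis. -/
def IsFeasibleBasis {K : ℕ} (A : Matrix (Fin 2) (Fin K) ℝ) (β : Fin 2 → ℝ)
    (x : PseudoBasis K) : Prop :=
  IsBasis A x ∧ IsFeasible A β (basicSol A β x)

/-- Objective value of the basic solution of `x` for the reward vector `r`. -/
def objective {K : ℕ} (r : Fin K → ℝ) (A : Matrix (Fin 2) (Fin K) ℝ) (β : Fin 2 → ℝ)
    (x : PseudoBasis K) : ℝ :=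
  ∑ k, r k * basicSol A β x k

/-- `x` is an optimal basis: a feasible basis whose basic solution is optimal. -/
def IsOptimalBasis {K : ℕ} (r : Fin K → ℝ) (A : Matrix (Fin 2) (Fin K) ℝ) (β : Fin 2 → ℝ)
    (x : PseudoBasis K) : Prop :=
  IsFeasibleBasis A β x ∧
    ∀ ξ : Fin K → ℝ, IsFeasible A β ξ → ∑ k, r k * ξ k ≤ objective r A β x

/-- Optimal value of the linear program. -/
def lpValue {K : ℕ} (r : Fin K → ℝ) (A : Matrix (Fin 2) (Fin K) ℝ) (β : Fin 2 → ℝ) : ℝ :=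
  sSup {v | ∃ ξ : Fin K → ℝ, IsFeasible A β ξ ∧ v = ∑ k, r k * ξ k}

/-! ### Arms and distributions -/

/-- Mean reward `μʳ_k`; `ν k` is the joint law of (reward, consumption) of arm `k`. -/
def meanReward {K : ℕ} (ν : Fin K → Measure (unitInterval × unitInterval)) (k : Fin K) : ℝ := ∫ p, (p.1 : ℝ) ∂(ν k)

/-- Mean consumption `μᶜ_k` of the resource. -/
def meanCost {K : ℕ} (ν : Fin K → Measure (unitInterval × unitInterval)) (k : Fin K) : ℝ := ∫ p, (p.2 : ℝ) ∂(ν k)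

/-- The non-degeneracy margin `ε = min_k |μᶜ_k - b|`. -/
def margin {K : ℕ} (ν : Fin K → Measure (unitInterval × unitInterval)) (b : ℝ) : ℝ := ⨅ k, |meanCost ν k - b|

/-- `x` is in the set `𝓑` of feasible bases of the linear program of the true means. -/
def FeasibleBasis {K : ℕ} (ν : Fin K → Measure (unitInterval × unitInterval)) (b : ℝ) (x : PseudoBasis K) : Prop :=
  IsFeasibleBasis (consumption (meanCost ν)) (rhs b) x

/-- The optimality gap `Δ_x`. -/
def gap {K : ℕ} (ν : Fin K → Measure (unitInterval × unitInterval)) (b : ℝ) (x : PseudoBasis K) : ℝ :=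
  lpValue (meanReward ν) (consumption (meanCost ν)) (rhs b)
    - objective (meanReward ν) (consumption (meanCost ν)) (rhs b) x

open Classical in
/-- `∑_{x ∈ 𝓑, Δ_x > 0} 1 / Δ_x`. -/
def sumInvGap {K : ℕ} (ν : Fin K → Measure (unitInterval × unitInterval)) (b : ℝ) : ℝ :=
  ∑ x : PseudoBasis K with FeasibleBasis ν b x ∧ 0 < gap ν b x, 1 / gap ν b x

/-- The actions of a round: skip it (reward `0`, consumption `0`), pull arm `k`, or pull
arm `k` and have one full unit of the resource charged whatever the arm consumed. -/
inductive Play (K : ℕ) : Type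
  | skip : Play K
  | pull (k : Fin K) : Play K
  | burn (k : Fin K) : Play K

/-- Whether the real arm `k` is pulled (so that its outcome is observed). -/
def Play.Pulls {K : ℕ} (k : Fin K) : Play K → Prop
  | .skip => False
  | .pull l => l = k
  | .burn l => l = k

/-! ### The game

`X t k ω` is the pair (reward, consumption) of arm `k` at round `t ≥ 1`. -/

/-- At every round and for every arm, the outcome has law `ν k` and is independent of the past.
Outcomes may be correlated across arms. -/
structure IsOutcomeProcess {K : ℕ} {Ω : Type*} [mΩ : MeasurableSpace Ω] (P : Measure Ω)
    (ℱ : Filtration ℕ mΩ) (ν : Fin K → Measure (unitInterval × unitInterval)) (X : ℕ → Fin K → Ω → unitInterval × unitInterval) : Prop where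
  measurable : ∀ t k, Measurable[ℱ (t + 1)] (X (t + 1) k)
  law : ∀ t k, P.map (X (t + 1) k) = ν k
  indep : ∀ t k, Indep (MeasurableSpace.comap (X (t + 1) k) inferInstance) (ℱ t) P

/-- Reward collected at round `t` by an action. -/
def reward {K : ℕ} {Ω : Type*} (X : ℕ → Fin K → Ω → unitInterval × unitInterval) (t : ℕ) (ω : Ω) : Play K → ℝ
  | .skip => 0
  | .pull k => ((X t k ω).1 : ℝ)
  | .burn k => ((X t k ω).1 : ℝ)

/-- Amount of the resource consumed at round `t` by an action. -/
def cost {K : ℕ} {Ω : Type*} (X : ℕ → Fin K → Ω → unitInterval × unitInterval) (t : ℕ) (ω : Ω) : Play K → ℝ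
  | .skip => 0
  | .pull k => ((X t k ω).2 : ℝ)
  | .burn _ => 1

/-- The end `τ*` of the game: the first round at which the budget `B` or the horizon `T`
is exceeded. -/
def stopTime {K : ℕ} {Ω : Type*} (X : ℕ → Fin K → Ω → unitInterval × unitInterval) (B : ℝ) (T : ℕ)
    (act : ℕ → Ω → Play K) (ω : Ω) : ℕ :=
  sInf {t : ℕ | B < ∑ s ∈ Finset.Icc 1 t, cost X s ω (act s ω) ∨ T < t}

/-- Expected total reward `E[∑_{t=1}^{τ*-1} r_{a_t,t}]`. -/
def payoff {K : ℕ} {Ω : Type*} [MeasurableSpace Ω] (P : Measure Ω)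
    (X : ℕ → Fin K → Ω → unitInterval × unitInterval) (B : ℝ) (T : ℕ) (act : ℕ → Ω → Play K) : ℝ :=
  ∫ ω, ∑ t ∈ Finset.Ico 1 (stopTime X B T act ω), reward X t ω (act t ω) ∂P

/-- Non-anticipating: the action of round `t + 1` is determined by the information available
at the end of round `t`. -/
def NonAnticipating {K : ℕ} {Ω : Type*} [mΩ : MeasurableSpace Ω] (ℱ : Filtration ℕ mΩ)
    (act : ℕ → Ω → Play K) : Prop :=
  ∀ t a, MeasurableSet[ℱ t] {ω | act (t + 1) ω = a}

/-- Largest expected total reward of a non-anticipating algorithm (which may know `ν`). -/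
def optPayoff {K : ℕ} {Ω : Type*} [mΩ : MeasurableSpace Ω] (P : Measure Ω)
    (ℱ : Filtration ℕ mΩ) (X : ℕ → Fin K → Ω → unitInterval × unitInterval) (B : ℝ) (T : ℕ) : ℝ :=
  sSup {v | ∃ act : ℕ → Ω → Play K, NonAnticipating ℱ act ∧ v = payoff P X B T act}

/-- The regret of the algorithm `act`. -/
def regret {K : ℕ} {Ω : Type*} [mΩ : MeasurableSpace Ω] (P : Measure Ω)
    (ℱ : Filtration ℕ mΩ) (X : ℕ → Fin K → Ω → unitInterval × unitInterval) (B : ℝ) (T : ℕ)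
    (act : ℕ → Ω → Play K) : ℝ :=
  optPayoff P ℱ X B T - payoff P X B T act

/-! ### The algorithm -/

section Statistics

variable {K : ℕ} {Ω : Type*} (X : ℕ → Fin K → Ω → unitInterval × unitInterval) (act : ℕ → Ω → Play K)

open Classical in
/-- Rounds before `t` at which arm `k` was pulled. -/
def pullTimes (k : Fin K) (t : ℕ) (ω : Ω) : Finset ℕ :=
  {s ∈ Finset.Ico 1 t | (act s ω).Pulls k}

/-- `n_{k,t}`. -/
def pullCount (k : Fin K) (t : ℕ) (ω : Ω) : ℕ := (pullTimes act k t ω).card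

/-- Empirical mean reward of arm `k` before round `t`. -/
def empReward (k : Fin K) (t : ℕ) (ω : Ω) : ℝ :=
  (∑ s ∈ pullTimes act k t ω, ((X s k ω).1 : ℝ)) / pullCount act k t ω

/-- Empirical mean consumption of arm `k` before round `t`. -/
def empCost (k : Fin K) (t : ℕ) (ω : Ω) : ℝ :=
  (∑ s ∈ pullTimes act k t ω, ((X s k ω).2 : ℝ)) / pullCount act k t ω

/-- Confidence radius `ε_{k,t} = √(2 ln t / n_{k,t})`. -/
def radius (k : Fin K) (t : ℕ) (ω : Ω) : ℝ :=
  Real.sqrt (2 * Real.log t / pullCount act k t ω)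

/-- Lower confidence bound on the consumption of an action; it is exact for the
two kinds of dummy actions, whose consumptions are known. -/
def lowerCost (t : ℕ) (ω : Ω) : Play K → ℝ
  | .skip => 0
  | .pull k => empCost X act k t ω - radius act k t ω
  | .burn _ => 1

variable (sel : ℕ → Ω → PseudoBasis K)

open Classical in
/-- Rounds before `t`, after the initialization rounds `1, …, K`, at which basis `x`
was selected. -/
def selTimes (x : PseudoBasis K) (t : ℕ) (ω : Ω) : Finset ℕ :=
  {s ∈ Finset.Ico (K + 1) t | sel s ω = x}

/-- `n_{x,t}`. -/
def selCount (x : PseudoBasis K) (t : ℕ) (ω : Ω) : ℕ := (selTimes sel x t ω).card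

/-- `b_{x,t}`: amount of the resource consumed when `x` was selected before round `t`. -/
def selCost (x : PseudoBasis K) (t : ℕ) (ω : Ω) : ℝ :=
  ∑ s ∈ selTimes sel x t ω, cost X s ω (act s ω)

end Statistics

/-- The two actions between which the load is balanced when `x` is selected: the two arms of
`x`; or the arm of `x` and skipping, if the resource is its only binding constraint;
or the arm of `x` with and without burning, if time is its only binding constraint. -/
def playsOf {K : ℕ} (x : PseudoBasis K) : Set (Play K) :=
  {a | ∃ k ∈ arms x, a = .pull k} ∪
    if resources x = {0} then {Play.skip}
    else if resources x = {1} then {a | ∃ k ∈ arms x, a = .burn k}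
    else ∅

/-- `act` is produced by UCB-Simplex with exploration factor `lam`, `η₁ = 1`, `η₂ = 0`, each arm
pulled once as initialization, and the pacing load balancer; `sel t` is the basis selected at
round `t`, and ties between optimal bases are broken by an arbitrary non-anticipating rule. -/
structure IsUCBSimplex {K : ℕ} {Ω : Type*} [mΩ : MeasurableSpace Ω] (ℱ : Filtration ℕ mΩ)
    (X : ℕ → Fin K → Ω → unitInterval × unitInterval) (lam b : ℝ)
    (sel : ℕ → Ω → PseudoBasis K) (act : ℕ → Ω → Play K) : Prop where
  init : ∀ (k : Fin K) (ω : Ω), act (k + 1) ω = .pull k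
  sel_nonAnticipating : ∀ t, K ≤ t → ∀ x, MeasurableSet[ℱ t] {ω | sel (t + 1) ω = x}
  stepSimplex : ∀ t, K < t → ∀ ω,
    IsOptimalBasis (fun k => empReward X act k t ω + lam * radius act k t ω)
      (consumption (fun k => empCost X act k t ω - radius act k t ω)) (rhs b) (sel t ω)
  stepLoadBalance : ∀ t, K < t → ∀ ω, ∃ k l : Play K,
    playsOf (sel t ω) = {k, l} ∧ lowerCost X act t ω l ≤ lowerCost X act t ω k ∧
    (selCost X act sel (sel t ω) t ω ≤ selCount sel (sel t ω) t ω * b → act t ω = k) ∧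
    (selCount sel (sel t ω) t ω * b < selCost X act sel (sel t ω) t ω → act t ω = l)

end KnapsackBandit

end

open MeasureTheory KnapsackBandit

noncomputable section

namespace KnapsackBandit

/-! ### Bases of the linear program -/

section LinearProgram

variable {K : ℕ}

/-! Let V be the optimal value of the linear program of the true means. For any non-anticipating
algorithm, the expected numbers of pulls made while the budget is not yet exceeded, divided by T +
1/b, form a feasible point. So no payoff exceeds (T + 1/b) V (`payoff_le`), and V ≤ σ b makes the
excess over T V at most σ. It remains to compare the algorithm with T V.

Call a basis straddling if one of its actions consumes less than b on average and another one more.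
Such a basis is feasible for the true program, and the mean rewards of its actions are affine in
their mean consumptions: the value of the basis plus a slope w, |w| ≤ σ/ε, times the excess of the
consumption over b (`Straddles.exists_slope`). Hence n selections of it earn n times its value up to
w times (imbalance minus noise), where the imbalance is the actual consumption minus n b. The noise,
stopped at the end of the game, has mean zero; it is cancelled before taking expectations
(`compensatedReward`), since a pathwise bound would be too large. A game that ends early has
overspent, so the rounds lost at the end are paid for by imbalances too. The result is a loss per
basis (`IsUCBSimplex.mul_lpValue_sub_le`): gap times count plus a multiple of |imbalance| if it
straddles, 2σ times the count otherwise.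

Three estimates bound these losses, up to the number of rounds with wrong confidence intervals. (1)
The load balancer pushes the imbalance back by at least ε per plain pull, while the noise over any
range of rounds is at most ε/2 per plain pull plus O(ln T / ε); so the imbalance is O(ln T / ε)
(`IsUCBSimplex.abs_imbalance_le`). (2) At a non-straddling basis both actions overspend, so it is
selected only while an arm whose lower bound lies on the wrong side of b is poorly explored, or a
few times more before the balancer turns to that arm (`IsUCBSimplex.selCount_le`). (3) By optimism,
the gap of a selected straddling basis is controlled by λ and the confidence radii of its arms, and
the balance of the load forces these arms to be pulled often; so gap times count is O(λ² ln T / (ε³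
gap)) up to terms without the gap (`Straddles.gap_mul_card_le`, `IsUCBSimplex.gap_mul_selCount_le`).

Both deviation bounds come from one exponential supermartingale for outcomes of a predictably chosen
arm (`integral_exp_sum_gain_le`). The expected number of rounds with wrong intervals is bounded, and
the noise is too large with probability O(1/T) only, so both failures cost a constant, which ln T
absorbs for T large. -/

theorem isFeasible_iff {c : Fin K → ℝ} {b : ℝ} {ξ : Fin K → ℝ} :
    IsFeasible (consumption c) (rhs b) ξ ↔
      ∑ k, c k * ξ k ≤ b ∧ ∑ k, ξ k ≤ 1 ∧ ∀ k, 0 ≤ ξ k := by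
  simp [IsFeasible, Fin.forall_fin_two, consumption, rhs, Matrix.mulVec, dotProduct, and_assoc]

theorem basicSol_of_notMem {A : Matrix (Fin 2) (Fin K) ℝ} {β : Fin 2 → ℝ} {x : PseudoBasis K}
    {k : Fin K} (h : k ∉ arms x) : basicSol A β x k = 0 := by
  simp [basicSol, h]

theorem block_mulVec {A : Matrix (Fin 2) (Fin K) ℝ} {x : PseudoBasis K} {ξ : Fin K → ℝ}
    (h : ∀ k, k ∉ arms x → ξ k = 0) (i : resources x) :
    (block A x).mulVec (fun k => ξ k) i = A.mulVec ξ i := by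
  simp only [Matrix.mulVec, dotProduct, block, Matrix.submatrix_apply]
  rw [Finset.sum_coe_sort (arms x) (fun k => A i k * ξ k)]
  exact Finset.sum_subset (Finset.subset_univ _) fun k _ hk => by rw [h k hk, mul_zero]

theorem IsBasis.mulVec_basicSol {A : Matrix (Fin 2) (Fin K) ℝ} {β : Fin 2 → ℝ}
    {x : PseudoBasis K} (h : IsBasis A x) {i : Fin 2} (hi : i ∈ resources x) :
    A.mulVec (basicSol A β x) i = β i := by
  rw [← block_mulVec (fun k => basicSol_of_notMem) ⟨i, hi⟩]
  have := congrFun (Function.rightInverse_invFun h.2 (fun i : resources x => β i)) ⟨i, hi⟩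
  convert this using 2
  ext k
  simp [basicSol]

theorem IsBasis.eq_zero {A : Matrix (Fin 2) (Fin K) ℝ} {x : PseudoBasis K} (h : IsBasis A x)
    {ξ : Fin K → ℝ} (h0 : ∀ k, k ∉ arms x → ξ k = 0)
    (h1 : ∀ i ∈ resources x, A.mulVec ξ i = 0) : ξ = 0 := by
  have : (fun k : arms x => ξ k) = 0 := by
    apply h.1
    ext i
    rw [block_mulVec h0, h1 i i.2, Matrix.mulVec_zero, Pi.zero_apply]
  ext k
  by_cases hk : k ∈ arms x
  · exact congrFun this ⟨k, hk⟩
  · exact h0 k hk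

/-- The block is square, so a trivial kernel suffices; a kernel vector is extended by zero to all
arms. -/
theorem isBasis_of_forall {A : Matrix (Fin 2) (Fin K) ℝ} {x : PseudoBasis K}
    (h : ∀ ξ : Fin K → ℝ, (∀ k, k ∉ arms x → ξ k = 0) →
      (∀ i ∈ resources x, A.mulVec ξ i = 0) → ∀ k ∈ arms x, ξ k = 0) : IsBasis A x := by
  have hinj : Function.Injective (block A x).mulVecLin := by
    rw [← LinearMap.ker_eq_bot, LinearMap.ker_eq_bot']
    intro v hv
    set ξ : Fin K → ℝ := fun k => if hk : k ∈ arms x then v ⟨k, hk⟩ else 0 with hξ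
    have hv' : (fun k : arms x => ξ k) = v := by ext k; simp [hξ]
    have h0 : ∀ k, k ∉ arms x → ξ k = 0 := fun k hk => by simp [hξ, hk]
    have := h ξ h0 (fun i hi => by
      rw [← block_mulVec h0 ⟨i, hi⟩, hv']
      exact congrFun hv ⟨i, hi⟩)
    ext k
    rw [← hv']
    exact this k k.2
  refine ⟨hinj, ?_⟩
  refine (LinearMap.injective_iff_surjective_of_finrank_eq_finrank ?_).1 hinj
  simpa using x.2.2

theorem PseudoBasis.cases (x : PseudoBasis K) :
    (∃ k, arms x = {k} ∧ resources x = {0}) ∨ (∃ k, arms x = {k} ∧ resources x = {1}) ∨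
      ∃ k l, k ≠ l ∧ arms x = {k, l} ∧ resources x = Finset.univ := by
  obtain ⟨⟨s, R⟩, hs, hc⟩ := x
  have hle : R.card ≤ 2 := by simpa using Finset.card_le_univ R
  have hpos : 0 < s.card := hs.card_pos
  dsimp only at hc
  rcases (by omega : R.card = 1 ∨ R.card = 2) with h | h
  · obtain ⟨k, rfl⟩ := Finset.card_eq_one.1 (hc.trans h)
    obtain ⟨i, rfl⟩ := Finset.card_eq_one.1 h
    fin_cases i
    · exact Or.inl ⟨k, rfl, rfl⟩
    · exact Or.inr (Or.inl ⟨k, rfl, rfl⟩)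
  · obtain ⟨k, l, hkl, rfl⟩ := Finset.card_eq_two.1 (hc.trans h)
    exact Or.inr (Or.inr ⟨k, l, hkl, rfl, (Finset.card_eq_iff_eq_univ R).1 (by simpa using h)⟩)

/-- A pseudo-basis is coded by an arm and a constraint, or by two arms: at most 2K + K² ≤ 3K². -/
theorem card_pseudoBasis_le (hK : 0 < K) : (Fintype.card (PseudoBasis K) : ℝ) ≤ 3 * (K : ℝ) ^ 2 := by
  have h : Fintype.card (PseudoBasis K) ≤ Fintype.card ((Fin K × Fin 2) ⊕ (Fin K × Fin K)) := by
    let f : (Fin K × Fin 2) ⊕ (Fin K × Fin K) → Finset (Fin K) × Finset (Fin 2) :=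
      Sum.elim (fun p => ({p.1}, {p.2})) (fun p => ({p.1, p.2}, Finset.univ))
    have : ∀ x : PseudoBasis K, ∃ p, f p = x.1 := by
      intro x
      rcases x.cases with ⟨k, h1, h2⟩ | ⟨k, h1, h2⟩ | ⟨k, l, -, h1, h2⟩
      · exact ⟨Sum.inl (k, 0), Prod.ext h1.symm h2.symm⟩
      · exact ⟨Sum.inl (k, 1), Prod.ext h1.symm h2.symm⟩
      · exact ⟨Sum.inr (k, l), Prod.ext h1.symm h2.symm⟩
    choose g hg using this
    refine Fintype.card_le_of_injective g fun x y hxy => Subtype.ext ?_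
    rw [← hg x, ← hg y, hxy]
  simp only [Fintype.card_sum, Fintype.card_prod, Fintype.card_fin] at h
  have h' : (Fintype.card (PseudoBasis K) : ℝ) ≤ K * 2 + K * K := by exact_mod_cast h
  have : (1 : ℝ) ≤ K := by exact_mod_cast hK
  nlinarith

theorem sum_eq_single_arm {f ξ : Fin K → ℝ} {x : PseudoBasis K} {k : Fin K} (h : arms x = {k})
    (h0 : ∀ j, j ∉ arms x → ξ j = 0) : ∑ j, f j * ξ j = f k * ξ k :=
  Finset.sum_eq_single k (fun j _ hj => by rw [h0 j (by simp [h, hj]), mul_zero]) (by simp)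

theorem sum_eq_pair_arms {f ξ : Fin K → ℝ} {x : PseudoBasis K} {k l : Fin K} (hkl : k ≠ l)
    (h : arms x = {k, l}) (h0 : ∀ j, j ∉ arms x → ξ j = 0) :
    ∑ j, f j * ξ j = f k * ξ k + f l * ξ l := by
  rw [← Finset.sum_pair (f := fun j => f j * ξ j) hkl]
  refine (Finset.sum_subset (Finset.subset_univ _) fun j _ hj => ?_).symm
  rw [h0 j (by rwa [h]), mul_zero]

variable {r c : Fin K → ℝ} {b : ℝ} {x : PseudoBasis K} {k l : Fin K}

theorem consumption_mulVec_zero (ξ : Fin K → ℝ) :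
    (consumption c).mulVec ξ 0 = ∑ j, c j * ξ j := by
  simp [consumption, Matrix.mulVec, dotProduct]

theorem consumption_mulVec_one (ξ : Fin K → ℝ) :
    (consumption c).mulVec ξ 1 = ∑ j, 1 * ξ j := by
  simp [consumption, Matrix.mulVec, dotProduct]

/-- The basic solution of a feasible basis made of two arms. -/
theorem IsFeasibleBasis.pair (hkl : k ≠ l) (ha : arms x = {k, l})
    (hr : resources x = Finset.univ) (h : IsFeasibleBasis (consumption c) (rhs b) x) :
    ∃ p q : ℝ, 0 ≤ p ∧ 0 ≤ q ∧ p + q = 1 ∧ c k * p + c l * q = b ∧ c k ≠ c l ∧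
      ∀ r : Fin K → ℝ, objective r (consumption c) (rhs b) x = r k * p + r l * q := by
  set ξ := basicSol (consumption c) (rhs b) x with hξ
  have h0 : ∀ j, j ∉ arms x → ξ j = 0 := fun j => basicSol_of_notMem
  have e0 := h.1.mulVec_basicSol (β := rhs b) (i := 0) (by simp [hr])
  have e1 := h.1.mulVec_basicSol (β := rhs b) (i := 1) (by simp [hr])
  rw [consumption_mulVec_zero, ← hξ, sum_eq_pair_arms hkl ha h0] at e0
  rw [consumption_mulVec_one, ← hξ, sum_eq_pair_arms hkl ha h0] at e1
  refine ⟨ξ k, ξ l, h.2.2 k, h.2.2 l, by simpa [rhs] using e1, by simpa [rhs] using e0, ?_,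
    fun r => sum_eq_pair_arms hkl ha h0⟩
  intro hc
  -- With equal consumptions the difference of the two unit vectors would lie in the kernel of the
  -- block.
  have hz := h.1.eq_zero (ξ := Pi.single k 1 - Pi.single l 1) (fun j hj => by
    simp only [ha, Finset.mem_insert, Finset.mem_singleton, not_or] at hj
    simp [hj.1, hj.2]) (fun i _ => by
    rw [Matrix.mulVec_sub]
    fin_cases i <;> simp [consumption, hc])
  simpa [hkl] using congrFun hz k

/-- The basic solution of a feasible basis where the resource is the only binding constraint. -/
theorem IsFeasibleBasis.single_resource (ha : arms x = {k})
    (hr : resources x = {0}) (h : IsFeasibleBasis (consumption c) (rhs b) x) :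
    ∃ p : ℝ, 0 ≤ p ∧ p ≤ 1 ∧ c k * p = b ∧
      ∀ r : Fin K → ℝ, objective r (consumption c) (rhs b) x = r k * p := by
  set ξ := basicSol (consumption c) (rhs b) x with hξ
  have h0 : ∀ j, j ∉ arms x → ξ j = 0 := fun j => basicSol_of_notMem
  have e0 := h.1.mulVec_basicSol (β := rhs b) (i := 0) (by simp [hr])
  rw [consumption_mulVec_zero, ← hξ, sum_eq_single_arm ha h0] at e0
  have e1 := h.2.1 1
  rw [consumption_mulVec_one, ← hξ, sum_eq_single_arm ha h0] at e1
  exact ⟨ξ k, h.2.2 k, by simpa [rhs] using e1, by simpa [rhs] using e0,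
    fun r => sum_eq_single_arm ha h0⟩

/-- The basic solution of a feasible basis where time is the only binding constraint. -/
theorem IsFeasibleBasis.single_time (ha : arms x = {k})
    (hr : resources x = {1}) (h : IsFeasibleBasis (consumption c) (rhs b) x) :
    c k ≤ b ∧ ∀ r : Fin K → ℝ, objective r (consumption c) (rhs b) x = r k := by
  set ξ := basicSol (consumption c) (rhs b) x with hξ
  have h0 : ∀ j, j ∉ arms x → ξ j = 0 := fun j => basicSol_of_notMem
  have e1 := h.1.mulVec_basicSol (β := rhs b) (i := 1) (by simp [hr])
  rw [consumption_mulVec_one, ← hξ, sum_eq_single_arm ha h0] at e1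
  have e0 := h.2.1 0
  rw [consumption_mulVec_zero, ← hξ, sum_eq_single_arm ha h0] at e0
  have hk : ξ k = 1 := by simpa [rhs] using e1
  refine ⟨by simpa [rhs, hk] using e0, fun r => ?_⟩
  rw [objective, ← hξ, sum_eq_single_arm ha h0, hk, mul_one]

theorem isFeasibleBasis_pair (hkl : k ≠ l) (ha : arms x = {k, l})
    (hr : resources x = Finset.univ) (hk : b < c k) (hl : c l < b) :
    IsFeasibleBasis (consumption c) (rhs b) x := by
  have hb : IsBasis (consumption c) x := by
    refine isBasis_of_forall fun ξ h0 h1 => ?_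
    have e0 := h1 0 (by simp [hr])
    have e1 := h1 1 (by simp [hr])
    rw [consumption_mulVec_zero, sum_eq_pair_arms hkl ha h0] at e0
    rw [consumption_mulVec_one, sum_eq_pair_arms hkl ha h0] at e1
    have hk0 : ξ k = 0 := by
      have : (c k - c l) * ξ k = 0 := by linear_combination e0 - c l * e1
      exact (mul_eq_zero.1 this).resolve_left (by linarith)
    intro j hj
    simp only [ha, Finset.mem_insert, Finset.mem_singleton] at hj
    rcases hj with rfl | rfl
    · exact hk0
    · linarith
  refine ⟨hb, ?_⟩
  set ξ := basicSol (consumption c) (rhs b) x with hξ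
  have h0 : ∀ j, j ∉ arms x → ξ j = 0 := fun j => basicSol_of_notMem
  have e0 := hb.mulVec_basicSol (β := rhs b) (i := 0) (by simp [hr])
  have e1 := hb.mulVec_basicSol (β := rhs b) (i := 1) (by simp [hr])
  refine ⟨fun i => ?_, fun j => ?_⟩
  · fin_cases i
    · exact e0.le
    · exact e1.le
  rw [consumption_mulVec_zero, ← hξ, sum_eq_pair_arms hkl ha h0] at e0
  rw [consumption_mulVec_one, ← hξ, sum_eq_pair_arms hkl ha h0] at e1
  simp only [rhs, Matrix.cons_val_zero, Matrix.cons_val_one, one_mul] at e0 e1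
  by_cases hj : j ∈ arms x
  · simp only [ha, Finset.mem_insert, Finset.mem_singleton] at hj
    rcases hj with rfl | rfl
    · have : (c j - c l) * ξ j = b - c l := by linear_combination e0 - c l * e1
      by_contra! hneg
      nlinarith
    · have : (c k - c j) * ξ j = c k - b := by linear_combination c k * e1 - e0
      by_contra! hneg
      nlinarith
  · exact (h0 j hj).ge

theorem isFeasibleBasis_single_resource (ha : arms x = {k})
    (hr : resources x = {0}) (hb : 0 < b) (hk : b < c k) :
    IsFeasibleBasis (consumption c) (rhs b) x := by
  have hB : IsBasis (consumption c) x := by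
    refine isBasis_of_forall fun ξ h0 h1 => ?_
    have e0 := h1 0 (by simp [hr])
    rw [consumption_mulVec_zero, sum_eq_single_arm ha h0] at e0
    intro j hj
    simp only [ha, Finset.mem_singleton] at hj
    subst hj
    exact (mul_eq_zero.1 e0).resolve_left (by linarith)
  refine ⟨hB, ?_⟩
  set ξ := basicSol (consumption c) (rhs b) x with hξ
  have h0 : ∀ j, j ∉ arms x → ξ j = 0 := fun j => basicSol_of_notMem
  have e0 := hB.mulVec_basicSol (β := rhs b) (i := 0) (by simp [hr])
  have e0' := e0
  rw [consumption_mulVec_zero, ← hξ, sum_eq_single_arm ha h0] at e0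
  simp only [rhs, Matrix.cons_val_zero] at e0
  refine ⟨fun i => ?_, fun j => ?_⟩
  · fin_cases i
    · exact e0'.le
    · change (consumption c).mulVec ξ 1 ≤ 1
      rw [consumption_mulVec_one, sum_eq_single_arm ha h0]
      by_contra! hneg
      nlinarith
  by_cases hj : j ∈ arms x
  · simp only [ha, Finset.mem_singleton] at hj
    subst hj
    by_contra! hneg
    nlinarith
  · exact (h0 j hj).ge

theorem isFeasibleBasis_single_time (ha : arms x = {k})
    (hr : resources x = {1}) (hk : c k < b) :
    IsFeasibleBasis (consumption c) (rhs b) x := by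
  have hB : IsBasis (consumption c) x := by
    refine isBasis_of_forall fun ξ h0 h1 => ?_
    have e0 := h1 1 (by simp [hr])
    rw [consumption_mulVec_one, sum_eq_single_arm ha h0] at e0
    intro j hj
    simp only [ha, Finset.mem_singleton] at hj
    subst hj
    linarith
  refine ⟨hB, ?_⟩
  set ξ := basicSol (consumption c) (rhs b) x with hξ
  have h0 : ∀ j, j ∉ arms x → ξ j = 0 := fun j => basicSol_of_notMem
  have e0 := hB.mulVec_basicSol (β := rhs b) (i := 1) (by simp [hr])
  have e0' := e0
  rw [consumption_mulVec_one, ← hξ, sum_eq_single_arm ha h0] at e0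
  simp only [rhs, Matrix.cons_val_one, one_mul] at e0
  refine ⟨fun i => ?_, fun j => ?_⟩
  · fin_cases i
    · change (consumption c).mulVec ξ 0 ≤ b
      rw [consumption_mulVec_zero, sum_eq_single_arm ha h0, e0]
      simpa using hk.le
    · exact e0'.le
  by_cases hj : j ∈ arms x
  · simp only [ha, Finset.mem_singleton] at hj
    subst hj
    rw [e0]
    simp
  · exact (h0 j hj).ge

/-! ### The optimal value -/

theorem bddAbove_lpValues (hr : ∀ k, r k ≤ 1) :
    BddAbove {v | ∃ ξ : Fin K → ℝ, IsFeasible (consumption c) (rhs b) ξ ∧ v = ∑ k, r k * ξ k} := by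
  refine ⟨1, ?_⟩
  rintro v ⟨ξ, hξ, rfl⟩
  rw [isFeasible_iff] at hξ
  refine le_trans (Finset.sum_le_sum fun k _ => ?_) hξ.2.1
  have := mul_le_mul_of_nonneg_right (hr k) (hξ.2.2 k)
  linarith

theorem le_lpValue (hr : ∀ k, r k ≤ 1) {ξ : Fin K → ℝ}
    (hξ : IsFeasible (consumption c) (rhs b) ξ) :
    ∑ k, r k * ξ k ≤ lpValue r (consumption c) (rhs b) :=
  le_csSup (bddAbove_lpValues hr) ⟨ξ, hξ, rfl⟩

theorem isFeasible_zero (hb : 0 ≤ b) : IsFeasible (consumption c) (rhs b) 0 := by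
  simp [isFeasible_iff, hb]

theorem lpValue_nonneg (hr : ∀ k, r k ≤ 1) (hb : 0 ≤ b) :
    0 ≤ lpValue r (consumption c) (rhs b) := by
  simpa using le_lpValue hr (isFeasible_zero (c := c) hb)

theorem lpValue_le (hb : 0 ≤ b) {v : ℝ}
    (h : ∀ ξ, IsFeasible (consumption c) (rhs b) ξ → ∑ k, r k * ξ k ≤ v) :
    lpValue r (consumption c) (rhs b) ≤ v := by
  refine csSup_le ⟨_, 0, isFeasible_zero hb, rfl⟩ ?_
  rintro _ ⟨ξ, hξ, rfl⟩
  exact h ξ hξ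

/-- Weak duality with price `σ` on the resource and price 0 on time. The factor `b` is kept because
it later cancels every 1/b. -/
theorem lpValue_le_mul {σ : ℝ} (hb : 0 ≤ b) (hσ : 0 ≤ σ) (h : ∀ k, r k ≤ σ * c k) :
    lpValue r (consumption c) (rhs b) ≤ σ * b := by
  refine lpValue_le hb fun ξ hξ => ?_
  rw [isFeasible_iff] at hξ
  calc ∑ k, r k * ξ k ≤ ∑ k, σ * (c k * ξ k) := Finset.sum_le_sum fun k _ => by
        rw [← mul_assoc]; exact mul_le_mul_of_nonneg_right (h k) (hξ.2.2 k)
    _ = σ * ∑ k, c k * ξ k := by rw [Finset.mul_sum]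
    _ ≤ σ * b := mul_le_mul_of_nonneg_left hξ.1 hσ

/-- Optimism: with larger rewards and smaller consumptions, an optimal basis is at least as good
as the optimal value. -/
theorem IsOptimalBasis.lpValue_le {r' c' : Fin K → ℝ} (hb : 0 ≤ b) (hr : ∀ k, r k ≤ r' k)
    (hc : ∀ k, c' k ≤ c k) (h : IsOptimalBasis r' (consumption c') (rhs b) x) :
    lpValue r (consumption c) (rhs b) ≤ objective r' (consumption c') (rhs b) x := by
  refine KnapsackBandit.lpValue_le hb fun ξ hξ => ?_
  rw [isFeasible_iff] at hξ
  refine le_trans (Finset.sum_le_sum fun k _ =>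
    mul_le_mul_of_nonneg_right (hr k) (hξ.2.2 k)) (h.2 ξ (isFeasible_iff.2 ⟨?_, hξ.2⟩))
  exact (Finset.sum_le_sum fun k _ => mul_le_mul_of_nonneg_right (hc k) (hξ.2.2 k)).trans hξ.1

/-! ### The two actions of a basis -/

/-- Consumption of an action when arm `k` consumes `c k`. -/
def playCost (c : Fin K → ℝ) : Play K → ℝ
  | .skip => 0
  | .pull k => c k
  | .burn _ => 1

/-- Reward of an action when arm `k` yields `r k`. -/
def playReward (r : Fin K → ℝ) : Play K → ℝ
  | .skip => 0
  | .pull k => r k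
  | .burn k => r k

@[simp] theorem playCost_skip : playCost c .skip = 0 := rfl

@[simp] theorem playCost_pull : playCost c (.pull k) = c k := rfl

@[simp] theorem playCost_burn : playCost c (.burn k) = 1 := rfl

theorem playsOf_resource (ha : arms x = {k}) (hr : resources x = {0}) :
    playsOf x = {.pull k, .skip} := by
  ext a; simp [playsOf, ha, hr, or_comm]

theorem playsOf_time (ha : arms x = {k}) (hr : resources x = {1}) :
    playsOf x = {.pull k, .burn k} := by
  ext a; simp [playsOf, ha, hr, or_comm]

theorem playsOf_pair (ha : arms x = {k, l}) (hr : resources x = Finset.univ) :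
    playsOf x = {.pull k, .pull l} := by
  have h0 : (Finset.univ : Finset (Fin 2)) ≠ {0} := by decide
  have h1 : (Finset.univ : Finset (Fin 2)) ≠ {1} := by decide
  ext a; simp [playsOf, ha, hr, h0, h1]

/-- The consumptions of the two actions of a feasible basis surround the budget rate. -/
theorem IsFeasibleBasis.playCost_bounds (hb : 0 < b) (hb1 : b < 1)
    (h : IsFeasibleBasis (consumption c) (rhs b) x) {p q : Play K} (hpq : playsOf x = {p, q})
    (hle : playCost c q ≤ playCost c p) :
    playCost c q ≤ b ∧ b ≤ playCost c p ∧ playCost c q < playCost c p := by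
  rcases x.cases with ⟨k, ha, hr⟩ | ⟨k, ha, hr⟩ | ⟨k, l, hkl, ha, hr⟩
  · obtain ⟨ξ, h0, h1, h2, -⟩ := h.single_resource ha hr
    have hbk : b ≤ c k := by
      by_contra! hlt
      rcases le_or_gt 0 (c k) with hc | hc <;> nlinarith
    rw [playsOf_resource ha hr, Set.pair_eq_pair_iff] at hpq
    rcases hpq with ⟨rfl, rfl⟩ | ⟨rfl, rfl⟩ <;> simp only [playCost] at *
    · exact ⟨hb.le, hbk, by linarith⟩
    · linarith
  · obtain ⟨h0, -⟩ := h.single_time ha hr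
    rw [playsOf_time ha hr, Set.pair_eq_pair_iff] at hpq
    rcases hpq with ⟨rfl, rfl⟩ | ⟨rfl, rfl⟩ <;> simp only [playCost] at *
    · linarith
    · exact ⟨h0, hb1.le, by linarith⟩
  · obtain ⟨u, v, hu, hv, huv, hc, hne, -⟩ := h.pair hkl ha hr
    have key : ∀ {s t p q : ℝ}, 0 ≤ p → 0 ≤ q → p + q = 1 → s * p + t * q = b → t ≤ s →
        t ≤ b ∧ b ≤ s := by
      intro s t p q hp hq hpq hst hle
      obtain rfl : q = 1 - p := by linarith
      constructor <;> nlinarith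
    rw [playsOf_pair ha hr, Set.pair_eq_pair_iff] at hpq
    rcases hpq with ⟨rfl, rfl⟩ | ⟨rfl, rfl⟩ <;> simp only [playCost] at *
    · obtain ⟨h1, h2⟩ := key hu hv huv hc hle
      exact ⟨h1, h2, lt_of_le_of_ne hle hne.symm⟩
    · obtain ⟨h1, h2⟩ := key hv hu (by linarith) (by linarith) hle
      exact ⟨h1, h2, lt_of_le_of_ne hle hne⟩

end LinearProgram

/-! ### Bases whose actions surround the budget rate -/

section Straddle

variable {K : ℕ} {r c : Fin K → ℝ} {b : ℝ} {x : PseudoBasis K}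

/-- The assumptions on the mean rewards `r` and the mean consumptions `c` of the arms, with
non-degeneracy margin at least `ε`. -/
structure IsNondegenerate (r c : Fin K → ℝ) (b κ σ ε : ℝ) : Prop where
  b_pos : 0 < b
  b_lt_one : b < 1
  κ_pos : 0 < κ
  σ_pos : 0 < σ
  ε_pos : 0 < ε
  ε_le_one : ε ≤ 1
  reward_nonneg : ∀ k, 0 ≤ r k
  reward_le_one : ∀ k, r k ≤ 1
  cost_nonneg : ∀ k, 0 ≤ c k
  cost_le_one : ∀ k, c k ≤ 1
  reward_le_cost : ∀ k, r k ≤ σ * c k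
  margin_le : ∀ k, ε ≤ |c k - b|
  lipschitz : ∀ k l, |r k - r l| ≤ κ * |c k - c l|

/-- One action of `x` consumes less than the budget rate and another one more. -/
def Straddles (c : Fin K → ℝ) (b : ℝ) (x : PseudoBasis K) : Prop :=
  (∃ a ∈ playsOf x, playCost c a < b) ∧ ∃ a ∈ playsOf x, b < playCost c a

theorem Straddles.resource (h : Straddles c b x) {k : Fin K} (ha : arms x = {k})
    (hr : resources x = {0}) (hb : 0 < b) : b < c k := by
  obtain ⟨-, a, h1, h2⟩ := h
  rw [playsOf_resource ha hr] at h1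
  rcases h1 with rfl | rfl <;> simp only [playCost] at h2
  · exact h2
  · linarith

theorem Straddles.time (h : Straddles c b x) {k : Fin K} (ha : arms x = {k})
    (hr : resources x = {1}) (hb : b < 1) : c k < b := by
  obtain ⟨⟨a, h1, h2⟩, -⟩ := h
  rw [playsOf_time ha hr] at h1
  rcases h1 with rfl | rfl <;> simp only [playCost] at h2
  · exact h2
  · linarith

theorem Straddles.pair (h : Straddles c b x) (hx : ∀ k, arms x ≠ {k}) :
    ∃ k l, k ≠ l ∧ arms x = {k, l} ∧ resources x = Finset.univ ∧ b < c k ∧ c l < b := by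
  rcases x.cases with ⟨k, ha, -⟩ | ⟨k, ha, -⟩ | ⟨k, l, hkl, ha, hr⟩
  · exact absurd ha (hx k)
  · exact absurd ha (hx k)
  obtain ⟨⟨a, h1, h2⟩, a', h3, h4⟩ := h
  rw [playsOf_pair ha hr] at h1 h3
  rcases h1 with rfl | rfl <;> rcases h3 with rfl | rfl <;> simp only [playCost] at h2 h4
  · linarith
  · exact ⟨l, k, hkl.symm, by rw [ha, Finset.pair_comm], hr, h4, h2⟩
  · exact ⟨k, l, hkl, ha, hr, h4, h2⟩
  · linarith

theorem Straddles.cases (h : Straddles c b x) (hb : 0 < b) (hb1 : b < 1) :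
    (∃ k, arms x = {k} ∧ resources x = {0} ∧ b < c k) ∨
      (∃ k, arms x = {k} ∧ resources x = {1} ∧ c k < b) ∨
      ∃ k l, k ≠ l ∧ arms x = {k, l} ∧ resources x = Finset.univ ∧ b < c k ∧ c l < b := by
  rcases x.cases with ⟨k, ha, hr⟩ | ⟨k, ha, hr⟩ | ⟨k, l, hkl, ha, hr⟩
  · exact Or.inl ⟨k, ha, hr, h.resource ha hr hb⟩
  · exact Or.inr (Or.inl ⟨k, ha, hr, h.time ha hr hb1⟩)
  · refine Or.inr (Or.inr (h.pair fun j hj => hkl ?_))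
    have h1 : k ∈ ({j} : Finset (Fin K)) := by rw [← hj, ha]; simp
    have h2 : l ∈ ({j} : Finset (Fin K)) := by rw [← hj, ha]; simp
    rw [Finset.mem_singleton.1 h1, Finset.mem_singleton.1 h2]

theorem Straddles.isFeasibleBasis (h : Straddles c b x) (hb : 0 < b) (hb1 : b < 1) :
    IsFeasibleBasis (consumption c) (rhs b) x := by
  rcases h.cases hb hb1 with ⟨k, ha, hr, hk⟩ | ⟨k, ha, hr, hk⟩ | ⟨k, l, hkl, ha, hr, hk, hl⟩
  · exact isFeasibleBasis_single_resource ha hr hb hk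
  · exact isFeasibleBasis_single_time ha hr hk
  · exact isFeasibleBasis_pair hkl ha hr hk hl

/-- The rewards of the two actions of a basis are affine in their consumptions, with the value of
the basis at the budget rate. -/
theorem Straddles.exists_slope (h : Straddles c b x) {σ ε κ : ℝ}
    (hI : IsNondegenerate r c b κ σ ε) :
    ∃ w, |w| ≤ σ / ε ∧ ∀ a ∈ playsOf x,
      playReward r a = objective r (consumption c) (rhs b) x + w * (playCost c a - b) := by
  obtain ⟨hb, hb1, hκ, hσ, hε, hε1, hr0, hr1, hc0, hc1, hrσ, hm, hrc⟩ := hI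
  have hσε : σ ≤ σ / ε := by rw [le_div_iff₀ hε]; nlinarith
  have hf := h.isFeasibleBasis hb hb1
  rcases h.cases hb hb1 with ⟨k, ha, hr, hk⟩ | ⟨k, ha, hr, hk⟩ | ⟨k, l, hkl, ha, hr, hk, hl⟩
  · have hck : 0 < c k := hb.trans hk
    obtain ⟨p, -, -, hp, hobj⟩ := hf.single_resource ha hr
    refine ⟨r k / c k, ?_, fun a h1 => ?_⟩
    · rw [abs_of_nonneg (div_nonneg (hr0 k) hck.le)]
      exact ((div_le_iff₀ hck).2 (hrσ k)).trans hσε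
    · rw [hobj, ← hp]
      rw [playsOf_resource ha hr] at h1
      rcases h1 with rfl | rfl <;> simp only [playCost, playReward] <;> field_simp <;> ring
  · obtain ⟨-, hobj⟩ := hf.single_time ha hr
    refine ⟨0, by simpa using (div_pos hσ hε).le, fun a h1 => ?_⟩
    rw [hobj]
    rw [playsOf_time ha hr] at h1
    rcases h1 with rfl | rfl <;> simp [playReward]
  · obtain ⟨p, q, -, -, hpq, hc, -, hobj⟩ := hf.pair hkl ha hr
    have hd : 0 < c k - c l := by linarith
    have hd' : ε ≤ c k - c l := by
      have := hm k
      rw [abs_of_pos (by linarith)] at this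
      linarith
    have hrk := hrσ k
    have hrl := hrσ l
    -- Both rewards lie in [0, σ] and the consumptions differ by at least `ε`, which bounds the
    -- slope by `σ / ε`.
    have h1 : σ * c k ≤ σ := by nlinarith [hc1 k]
    have h2 : σ * c l ≤ σ := by nlinarith [hc1 l]
    refine ⟨(r k - r l) / (c k - c l), ?_, fun a h1 => ?_⟩
    · rw [abs_div, abs_of_pos hd]
      refine div_le_div₀ hσ.le (abs_le.2 ⟨?_, ?_⟩) hε hd' <;> linarith [hr0 k, hr0 l]
    · rw [hobj]
      obtain rfl : q = 1 - p := by linarith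
      rw [playsOf_pair ha hr] at h1
      rcases h1 with rfl | rfl <;> simp only [playCost, playReward] <;> rw [← hc] <;>
        field_simp <;> ring

theorem sum_comp_of_mem_pair {ι α : Type*} [DecidableEq α] {S : Finset ι} {act : ι → α} {p q : α}
    (hpq : p ≠ q) (h : ∀ s ∈ S, act s ∈ ({p, q} : Set α)) (f : α → ℝ) :
    ∑ s ∈ S, f (act s) = f p * (S.filter (act · = p)).card + f q * (S.filter (act · = q)).card := by
  rw [← Finset.sum_filter_add_sum_filter_not S (act · = p)]
  have : S.filter (¬ act · = p) = S.filter (act · = q) := Finset.filter_congr fun s hs => by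
    rcases h s hs with h | h
    · simp [h, hpq]
    · have h' : act s = q := h
      simp [h', hpq.symm]
  rw [this, Finset.sum_congr rfl (fun s hs => by rw [(Finset.mem_filter.1 hs).2] :
    ∀ s ∈ S.filter (act · = p), f (act s) = f p), Finset.sum_congr rfl
    (fun s hs => by rw [(Finset.mem_filter.1 hs).2] :
    ∀ s ∈ S.filter (act · = q), f (act s) = f q)]
  simp [mul_comm]

/-- The consumption `ck * N + cl * M + F` is close to its target, while `ck` and `cl` are at
distance at least `ε` from `b` on opposite sides. Hence neither arm can be neglected: each gets a
share of at least `ε / 2`, the other half of the margin being spent on the noise `F`. -/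
theorem mul_card_le_of_pair {ε b ck cl N M F V W : ℝ} (hk : b + ε ≤ ck) (hl : cl + ε ≤ b)
    (hck : ck ≤ 1) (hcl : 0 ≤ cl) (hN : 0 ≤ N) (hM : 0 ≤ M)
    (hD : |ck * N + cl * M + F - (N + M) * b| ≤ V) (hF : |F| ≤ ε / 2 * (N + M) + W) :
    ε / 2 * (N + M) ≤ N + (V + W) ∧ ε / 2 * (N + M) ≤ M + (V + W) := by
  rw [abs_le] at hD hF
  constructor
  · have h1 : (N + M) * (cl + ε) ≤ (N + M) * b := mul_le_mul_of_nonneg_left hl (by linarith)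
    have h2 : (ck - cl) * N ≤ 1 * N := mul_le_mul_of_nonneg_right (by linarith) hN
    linarith
  · have h1 : (N + M) * (b + ε) ≤ (N + M) * ck := mul_le_mul_of_nonneg_left hk (by linarith)
    have h2 : (ck - cl) * M ≤ 1 * M := mul_le_mul_of_nonneg_right (by linarith) hM
    linarith

/-- Here `nx` counts selections, `N` plain pulls within them, and `γ` is the lower bound on the
consumption `c`. The arm is pulled in a proportion of order b/c, which may be small; but the gap is
at most `σ * b`, and the weight `p = b / γ` of the arm is also of order b/c. These factors cancel,
so no 1/b survives. -/
theorem gap_mul_count_le_of_resource {σ ε b c L lam Δ nx N V W e n p γ : ℝ} (hσ : 0 < σ) (hε : 0 < ε)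
    (hε1 : ε ≤ 1) (hb : 0 < b) (hk : b < c) (hc1 : c ≤ 1) (hL : 0 ≤ L) (hlam : 0 < lam)
    (hΔ0 : 0 < Δ) (hΔb : Δ ≤ σ * b) (hVW0 : 0 ≤ V + W) (he : 0 ≤ e) (hen : e ^ 2 * n ≤ 2 * L)
    (hN0 : 0 ≤ N) (hNn : N ≤ n) (hcard : b * nx ≤ 2 * c * N + (V + W))
    (hgap : ε * Δ ≤ 4 * lam * (p * e)) (hγp : γ * p = b) (hγ' : c - 2 * e ≤ γ) (hεc : ε ≤ c)
    (hp0 : 0 ≤ p) (hnx : 0 ≤ nx) :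
    Δ * nx ≤ 2 ^ 9 * lam ^ 2 * L / (ε ^ 3 * Δ) + σ * (64 * L / ε ^ 2 + 2 / ε * (V + W)) := by
  have hck : 0 < c := hb.trans hk
  have hε32 : ε ^ 3 ≤ ε ^ 2 := pow_le_pow_of_le_one hε.le hε1 (by norm_num)
  have hVW : V + W ≤ 2 / ε * (V + W) := by
    have : (1 : ℝ) ≤ 2 / ε := by rw [le_div_iff₀ hε]; linarith
    nlinarith
  -- If the arm is poorly explored, `Δ ≤ σ * b` and the small number of pulls suffice. Otherwise the
  -- threshold forces `e ≤ ε / 4`, hence `γ ≥ c / 2`.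
  rcases le_or_gt n (32 * L / ε ^ 2) with hcase | hcase
  · have h1 : 2 * c * N ≤ 2 * (32 * L / ε ^ 2) := by nlinarith
    have h2 : Δ * nx ≤ σ * (b * nx) := by
      rw [← mul_assoc]; exact mul_le_mul_of_nonneg_right hΔb hnx
    have h3 : σ * (b * nx) ≤ σ * (64 * L / ε ^ 2 + 2 / ε * (V + W)) := by
      refine mul_le_mul_of_nonneg_left ?_ hσ.le
      calc b * nx ≤ 2 * c * N + (V + W) := hcard
        _ ≤ 2 * (32 * L / ε ^ 2) + 2 / ε * (V + W) := by linarith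
        _ = _ := by ring
    have h4 : 0 ≤ 2 ^ 9 * lam ^ 2 * L / (ε ^ 3 * Δ) := by positivity
    linarith
  · have hn0 : 0 < n := lt_of_le_of_lt (by positivity) hcase
    have heε : e ≤ ε / 4 := by
      by_contra! hlt
      have h1 : (ε / 4) ^ 2 * n < e ^ 2 * n :=
        mul_lt_mul_of_pos_right (pow_lt_pow_left₀ hlt (by positivity) two_ne_zero) hn0
      rw [div_lt_iff₀ (by positivity)] at hcase
      linarith
    have hcp2 : c * p ≤ 2 * b := by
      have h1 : c * p ≤ 2 * γ * p := mul_le_mul_of_nonneg_right (by linarith) hp0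
      linarith
    have h1 : ε * Δ * c ≤ 8 * lam * b * e := by
      have h2 := mul_le_mul_of_nonneg_right hgap hck.le
      have h3 : 4 * lam * e * (c * p) ≤ 4 * lam * e * (2 * b) :=
        mul_le_mul_of_nonneg_left hcp2 (by positivity)
      linarith
    have h2 : (ε * Δ * c) ^ 2 * N ≤ 128 * lam ^ 2 * b ^ 2 * L := by
      calc (ε * Δ * c) ^ 2 * N ≤ (8 * lam * b * e) ^ 2 * n := by
            refine mul_le_mul (pow_le_pow_left₀ (by positivity) h1 2) hNn hN0 (by positivity)
        _ = 64 * lam ^ 2 * b ^ 2 * (e ^ 2 * n) := by ring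
        _ ≤ 64 * lam ^ 2 * b ^ 2 * (2 * L) := mul_le_mul_of_nonneg_left hen (by positivity)
        _ = _ := by ring
    have h3 : ε ^ 2 * Δ ^ 2 * c * N ≤ 128 * lam ^ 2 * b * L := by
      refine le_of_mul_le_mul_left ?_ hck
      calc c * (ε ^ 2 * Δ ^ 2 * c * N) = (ε * Δ * c) ^ 2 * N := by ring
        _ ≤ b * (128 * lam ^ 2 * b * L) := h2.trans (by ring_nf; rfl)
        _ ≤ c * (128 * lam ^ 2 * b * L) := by gcongr
    have h4 : Δ * (2 * c * N) ≤ b * (256 * lam ^ 2 * L / (ε ^ 2 * Δ)) := by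
      rw [← mul_div_assoc, le_div_iff₀ (by positivity)]
      nlinarith
    have h5 : b * (Δ * nx) ≤ b * (256 * lam ^ 2 * L / (ε ^ 2 * Δ) + σ * (V + W)) := by
      have := mul_le_mul_of_nonneg_left hcard hΔ0.le
      have h7 : Δ * (V + W) ≤ σ * b * (V + W) := mul_le_mul_of_nonneg_right hΔb (by linarith)
      nlinarith
    have h6 := le_of_mul_le_mul_left h5 hb
    have h7 : 256 * lam ^ 2 * L / (ε ^ 2 * Δ) ≤ 2 ^ 9 * lam ^ 2 * L / (ε ^ 3 * Δ) := by
      have h0 : 0 ≤ lam ^ 2 * L := by positivity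
      refine div_le_div₀ (by positivity) (by nlinarith) (by positivity) ?_
      exact mul_le_mul_of_nonneg_right hε32 hΔ0.le
    have h8 : σ * (V + W) ≤ σ * (64 * L / ε ^ 2 + 2 / ε * (V + W)) := by
      refine mul_le_mul_of_nonneg_left ?_ hσ.le
      have : 0 ≤ 64 * L / ε ^ 2 := by positivity
      linarith
    linarith

/-- An arm whose radius dominates the gap satisfies Δ² N ≤ 8 lam² L by the definition of the radius,
and it receives a share `ε / 2` of the selections. -/
theorem gap_mul_count_le_of_pair {σ ε L lam Δ nx N V W e n : ℝ} (hσ : 0 < σ) (hε : 0 < ε)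
    (hε1 : ε ≤ 1) (hL : 0 ≤ L) (hlam : 0 < lam) (hΔ0 : 0 < Δ) (hΔσ : Δ ≤ σ) (hVW0 : 0 ≤ V + W)
    (hen : e ^ 2 * n ≤ 2 * L) (hN0 : 0 ≤ N) (hNn : N ≤ n)
    (hcj : ε / 2 * nx ≤ N + (V + W)) (hgapj : Δ ≤ 2 * lam * e) :
    Δ * nx ≤ 2 ^ 9 * lam ^ 2 * L / (ε ^ 3 * Δ) + σ * (64 * L / ε ^ 2 + 2 / ε * (V + W)) := by
  have hε3 : ε ^ 3 ≤ ε := by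
    calc ε ^ 3 ≤ ε ^ 1 := pow_le_pow_of_le_one hε.le hε1 (by norm_num)
      _ = ε := pow_one ε
  have h1 : Δ ^ 2 * N ≤ 8 * lam ^ 2 * L := by
    calc Δ ^ 2 * N ≤ (2 * lam * e) ^ 2 * n :=
          mul_le_mul (pow_le_pow_left₀ hΔ0.le hgapj 2) hNn hN0 (by positivity)
      _ = 4 * lam ^ 2 * (e ^ 2 * n) := by ring
      _ ≤ 4 * lam ^ 2 * (2 * L) := mul_le_mul_of_nonneg_left hen (by positivity)
      _ = _ := by ring
  have h2 : Δ * nx ≤ 2 / ε * (Δ * N) + 2 / ε * (Δ * (V + W)) := by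
    have h3 := mul_le_mul_of_nonneg_left hcj (by positivity : 0 ≤ 2 / ε * Δ)
    have h4 : 2 / ε * Δ * (ε / 2 * nx) = Δ * nx := by field_simp
    rw [h4] at h3
    linarith
  have h3 : 2 / ε * (Δ * N) ≤ 2 ^ 9 * lam ^ 2 * L / (ε ^ 3 * Δ) := by
    have h0 : 0 ≤ lam ^ 2 * L := by positivity
    have h5 : 2 / ε * (Δ * N) ≤ 16 * (lam ^ 2 * L) / (ε * Δ) := by
      rw [le_div_iff₀ (by positivity)]
      have : 2 / ε * (Δ * N) * (ε * Δ) = 2 * (Δ ^ 2 * N) := by field_simp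
      rw [this]
      linarith
    refine h5.trans (div_le_div₀ (by positivity) (by nlinarith) (by positivity) ?_)
    exact mul_le_mul_of_nonneg_right hε3 hΔ0.le
  have h4 : 2 / ε * (Δ * (V + W)) ≤ σ * (64 * L / ε ^ 2 + 2 / ε * (V + W)) := by
    have h5 : Δ * (V + W) ≤ σ * (V + W) := mul_le_mul_of_nonneg_right hΔσ (by linarith)
    have h6 := mul_le_mul_of_nonneg_left h5 (by positivity : 0 ≤ 2 / ε)
    have h7 : 0 ≤ σ * (64 * L / ε ^ 2) := by positivity
    linarith
  linarith


set_option maxHeartbeats 1000000 in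
open Classical in
/-- Bound on the number of selections of a suboptimal basis at a round where the confidence bounds
hold and the load is balanced. -/
theorem Straddles.gap_mul_card_le (h : Straddles c b x) {σ ε κ : ℝ}
    (hI : IsNondegenerate r c b κ σ ε) {ρ γ e n : Fin K → ℝ} {L : ℝ} (hL : 0 ≤ L)
    (hopt : IsOptimalBasis ρ (consumption γ) (rhs b) x)
    (hρ : ∀ k, r k ≤ ρ k) (hρ' : ∀ k, ρ k ≤ r k + (1 + (1 + 2 * κ)) * e k)
    (hγ : ∀ k, γ k ≤ c k) (hγ' : ∀ k, c k - 2 * e k ≤ γ k)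
    (he : ∀ k, 0 ≤ e k) (hen : ∀ k, e k ^ 2 * n k ≤ 2 * L)
    {S : Finset ℕ} {act : ℕ → Play K} (hact : ∀ s ∈ S, act s ∈ playsOf x)
    (hn : ∀ k, ((S.filter fun s => (act s).Pulls k).card : ℝ) ≤ n k) {F V W : ℝ}
    (hW : 0 ≤ W) (hD : |∑ s ∈ S, playCost c (act s) + F - S.card * b| ≤ V)
    (hF : |F| ≤ ε / 2 * (S.filter fun s => ∃ k, act s = .pull k).card + W) {Δ : ℝ}
    (hΔ : Δ = lpValue r (consumption c) (rhs b) - objective r (consumption c) (rhs b) x)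
    (hΔ0 : 0 < Δ) :
    Δ * S.card ≤ 2 ^ 9 * (1 + 2 * κ) ^ 2 * L / (ε ^ 3 * Δ)
      + σ * (64 * L / ε ^ 2 + 2 / ε * (V + W)) := by
  obtain ⟨hb, hb1, hκ, hσ, hε, hε1, hr0, hr1, hc0, hc1, hrσ, hm, hrc⟩ := hI
  have hf := h.isFeasibleBasis hb hb1
  have hval := hopt.lpValue_le hb.le hρ hγ
  have hV : 0 ≤ V := (abs_nonneg _).trans hD
  have hobj0 : 0 ≤ objective r (consumption c) (rhs b) x :=
    Finset.sum_nonneg fun k _ => mul_nonneg (hr0 k) (hf.2.2 k)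
  have hΔb : Δ ≤ σ * b := by
    have := lpValue_le_mul (r := r) hb.le hσ.le hrσ
    linarith
  have hΔσ : Δ ≤ σ := hΔb.trans (mul_le_of_le_one_right hσ.le hb1.le)
  set lam := 1 + 2 * κ with hlamdef
  have hε3' : ε ^ 3 ≤ 1 := pow_le_one₀ hε.le hε1
  rcases h.cases hb hb1 with ⟨k, ha, hr, hk⟩ | ⟨k, ha, hr, hk⟩ | ⟨k, l, hkl, ha, hr, hk, hl⟩
  · have hck : 0 < c k := hb.trans hk
    have hcε : b + ε ≤ c k := by
      have := hm k
      rw [abs_of_pos (by linarith)] at this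
      linarith
    have hplays := playsOf_resource ha hr
    have hne : (Play.pull k : Play K) ≠ Play.skip := by simp
    have hact' : ∀ s ∈ S, act s ∈ ({.pull k, .skip} : Set (Play K)) := fun s hs =>
      hplays ▸ hact s hs
    have hsum := sum_comp_of_mem_pair hne hact' (playCost c)
    simp only [playCost_pull, playCost_skip, zero_mul, add_zero] at hsum
    have hfil : (S.filter fun s => ∃ j, act s = .pull j) = S.filter (act · = .pull k) := by
      refine Finset.filter_congr fun s hs => ?_
      rcases hact' s hs with h | h
      · simp [h]
      · have h' : act s = .skip := h
        simp [h']
    have hfil' : S.filter (act · = .pull k) ⊆ S.filter fun s => (act s).Pulls k := fun s hs => by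
      rw [Finset.mem_filter] at hs ⊢
      exact ⟨hs.1, by simp [hs.2, Play.Pulls]⟩
    set N : ℝ := ((S.filter (act · = .pull k)).card : ℝ) with hNdef
    have hN0 : 0 ≤ N := Nat.cast_nonneg _
    have hNn : N ≤ n k := le_trans (Nat.cast_le.2 (Finset.card_le_card hfil')) (hn k)
    rw [hsum] at hD
    rw [hfil] at hF
    -- Skips cost nothing, so the consumption comes from the `N` pulls; the noise is at most another
    -- `c k * N`, up to `W`.
    have hcard : b * S.card ≤ 2 * c k * N + (V + W) := by
      have h1 := (abs_le.1 hD).1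
      have h2 := (abs_le.1 hF).2
      have h3 : ε / 2 * N ≤ c k * N := mul_le_mul_of_nonneg_right (by linarith) hN0
      linarith
    obtain ⟨p, hp0, -, hγp, hobjρ⟩ := hopt.1.single_resource ha hr
    obtain ⟨p', -, -, hcp, hobj⟩ := hf.single_resource ha hr
    rw [hobj] at hΔ
    rw [hobjρ] at hval
    -- `w` is the mean reward per unit of resource. It is at most 1/ε, because `r k ≤ 1` and `ε ≤ c
    -- k`.
    obtain ⟨w, hw⟩ : ∃ w, r k = w * c k := ⟨r k / c k, by field_simp⟩
    have hw0 : 0 ≤ w := nonneg_of_mul_nonneg_left (hw ▸ hr0 k) hck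
    have hwε : w * ε ≤ 1 :=
      (mul_le_mul_of_nonneg_left (by linarith) hw0).trans (hw ▸ hr1 k)
    have hgap : ε * Δ ≤ 4 * lam * (p * e k) := by
      have h1 : r k * p' = w * (γ k * p) := by rw [hw, hγp, ← hcp]; ring
      have h2 : Δ ≤ p * ((2 * w + (1 + lam)) * e k) := by
        have h3 : ρ k * p ≤ (r k + (1 + lam) * e k) * p := mul_le_mul_of_nonneg_right (hρ' k) hp0
        have h4 : w * p * (c k - 2 * e k) ≤ w * p * γ k :=
          mul_le_mul_of_nonneg_left (hγ' k) (mul_nonneg hw0 hp0)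
        rw [hw] at h3
        linarith
      have h5 : ε * (2 * w + (1 + lam)) ≤ 4 * lam := by
        linarith [mul_le_mul_of_nonneg_right hε1 (by linarith : 0 ≤ 1 + lam)]
      have h6 : ε * (2 * w + (1 + lam)) * (p * e k) ≤ 4 * lam * (p * e k) :=
        mul_le_mul_of_nonneg_right h5 (mul_nonneg hp0 (he k))
      linarith [mul_le_mul_of_nonneg_left h2 hε.le]
    exact gap_mul_count_le_of_resource hσ hε hε1 hb hk (hc1 k) hL (by linarith) hΔ0 hΔb (by linarith)
      (he k) (hen k) hN0 hNn hcard hgap hγp (hγ' k) (by linarith) hp0 (Nat.cast_nonneg _)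
  · have hplays := playsOf_time ha hr
    -- Both actions of a time basis pull arm `k`: every selection is an observation and no balance
    -- is needed.
    have hfil : S.filter (fun s => (act s).Pulls k) = S := by
      refine Finset.filter_true_of_mem fun s hs => ?_
      have h0 := hact s hs
      rw [hplays] at h0
      rcases h0 with h | h
      · simp [h, Play.Pulls]
      · have h' : act s = .burn k := h
        simp [h', Play.Pulls]
    have hNn := hn k
    rw [hfil] at hNn
    obtain ⟨-, hobjρ⟩ := hopt.1.single_time ha hr
    obtain ⟨-, hobj⟩ := hf.single_time ha hr
    rw [hobj] at hΔ
    rw [hobjρ] at hval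
    have hgap : Δ ≤ 2 * lam * e k := by
      have h1 := hρ' k
      have h2 : (1 + lam) * e k ≤ 2 * lam * e k :=
        mul_le_mul_of_nonneg_right (by linarith) (he k)
      linarith
    have h1 : Δ ^ 2 * S.card ≤ 8 * lam ^ 2 * L := by
      calc Δ ^ 2 * S.card ≤ (2 * lam * e k) ^ 2 * n k :=
            mul_le_mul (pow_le_pow_left₀ hΔ0.le hgap 2) hNn (Nat.cast_nonneg _) (by positivity)
        _ = 4 * lam ^ 2 * (e k ^ 2 * n k) := by ring
        _ ≤ 4 * lam ^ 2 * (2 * L) := mul_le_mul_of_nonneg_left (hen k) (by positivity)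
        _ = _ := by ring
    have h2 : Δ * S.card ≤ 2 ^ 9 * lam ^ 2 * L / (ε ^ 3 * Δ) := by
      have h0 : 0 ≤ lam ^ 2 * L := by positivity
      rw [le_div_iff₀ (by positivity)]
      have h3 : ε ^ 3 * (Δ ^ 2 * S.card) ≤ 1 * (Δ ^ 2 * S.card) :=
        mul_le_mul_of_nonneg_right hε3' (by positivity)
      nlinarith
    have h3 : 0 ≤ σ * (64 * L / ε ^ 2 + 2 / ε * (V + W)) := by positivity
    linarith
  · have hkε : b + ε ≤ c k := by
      have := hm k
      rw [abs_of_pos (by linarith)] at this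
      linarith
    have hlε : c l + ε ≤ b := by
      have := hm l
      rw [abs_of_neg (by linarith)] at this
      linarith
    have hplays := playsOf_pair ha hr
    have hne : (Play.pull k : Play K) ≠ Play.pull l := by simpa using hkl
    have hact' : ∀ s ∈ S, act s ∈ ({.pull k, .pull l} : Set (Play K)) := fun s hs =>
      hplays ▸ hact s hs
    have hsum := sum_comp_of_mem_pair hne hact' (playCost c)
    have hcard := sum_comp_of_mem_pair hne hact' (fun _ => 1)
    simp only [playCost_pull, Finset.sum_const, nsmul_eq_mul, mul_one, one_mul] at hsum hcard
    have hfil : (S.filter fun s => ∃ j, act s = .pull j) = S := by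
      refine Finset.filter_true_of_mem fun s hs => ?_
      rcases hact' s hs with h | h
      exacts [⟨k, h⟩, ⟨l, h⟩]
    have hfil' : ∀ j, S.filter (act · = .pull j) ⊆ S.filter fun s => (act s).Pulls j := by
      intro j s hs
      rw [Finset.mem_filter] at hs ⊢
      exact ⟨hs.1, by simp [hs.2, Play.Pulls]⟩
    have hNn : ∀ j, ((S.filter (act · = .pull j)).card : ℝ) ≤ n j := fun j =>
      le_trans (by exact_mod_cast Finset.card_le_card (hfil' j)) (hn j)
    rw [hsum, hcard] at hD
    rw [hfil, hcard] at hF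
    obtain ⟨hNk, hNl⟩ := mul_card_le_of_pair hkε hlε (hc1 k) (hc0 l) (Nat.cast_nonneg _)
      (Nat.cast_nonneg _) hD hF
    obtain ⟨p, q, hp, hq, hpq, hγp, -, hobjρ⟩ := hopt.1.pair hkl ha hr
    obtain ⟨p', q', -, -, hpq', hcp, -, hobj⟩ := hf.pair hkl ha hr
    rw [hobj] at hΔ
    rw [hobjρ] at hval
    have hd : 0 < c k - c l := by linarith
    obtain ⟨w, hw⟩ : ∃ w, r k - r l = w * (c k - c l) :=
      ⟨(r k - r l) / (c k - c l), by field_simp⟩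
    have hwκ : w ≤ κ := by
      have h1 := (abs_le.1 (hrc k l)).2
      rw [abs_of_pos hd, hw] at h1
      exact le_of_mul_le_mul_right h1 hd
    have hgap : Δ ≤ 2 * lam * (e k * p + e l * q) := by
      -- The mixture `(p, q)` consumes `b` according to the lower bounds and `b + u` in truth. On
      -- the line through the two arms its true reward exceeds the value of the basis by `w * u ≤ κ
      -- * u`. With the bonuses of the rewards this gives the factor 1 + lam + 2κ = 2 lam.
      set u := (c k - γ k) * p + (c l - γ l) * q with hu
      have hu0 : 0 ≤ u := add_nonneg (mul_nonneg (sub_nonneg.2 (hγ k)) hp)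
        (mul_nonneg (sub_nonneg.2 (hγ l)) hq)
      have hu1 : u ≤ 2 * (e k * p + e l * q) := by
        have h1 := mul_le_mul_of_nonneg_right (hγ' k) hp
        have h2 := mul_le_mul_of_nonneg_right (hγ' l) hq
        linarith
      have h1 : r k * p' + r l * q' = r l + w * (b - c l) := by
        obtain rfl : q' = 1 - p' := by linarith
        rw [← hcp]
        linear_combination p' * hw
      have h2 : r k * p + r l * q = r l + w * (b - c l) + w * u := by
        obtain rfl : q = 1 - p := by linarith
        rw [← hγp, hu]
        linear_combination p * hw
      have h3 := mul_le_mul_of_nonneg_right (hρ' k) hp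
      have h4 := mul_le_mul_of_nonneg_right (hρ' l) hq
      have h5 : w * u ≤ κ * u := mul_le_mul_of_nonneg_right hwκ hu0
      have h6 : κ * u ≤ κ * (2 * (e k * p + e l * q)) := mul_le_mul_of_nonneg_left hu1 hκ.le
      rw [hlamdef] at *
      linarith
    -- A convex combination of the two radii is at most the larger one.
    have hex : ∃ j, (j = k ∨ j = l) ∧ Δ ≤ 2 * lam * e j := by
      rcases le_total (e k) (e l) with hle | hle
      · refine ⟨l, Or.inr rfl, hgap.trans (mul_le_mul_of_nonneg_left ?_ (by linarith))⟩
        obtain rfl : q = 1 - p := by linarith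
        linarith [mul_le_mul_of_nonneg_right hle hp]
      · refine ⟨k, Or.inl rfl, hgap.trans (mul_le_mul_of_nonneg_left ?_ (by linarith))⟩
        obtain rfl : q = 1 - p := by linarith
        linarith [mul_le_mul_of_nonneg_right hle hq]
    obtain ⟨j, hj, hgapj⟩ := hex
    have hcj : ε / 2 * S.card ≤ (S.filter (act · = .pull j)).card + (V + W) := by
      rw [hcard]
      rcases hj with rfl | rfl
      exacts [hNk, hNl]
    exact gap_mul_count_le_of_pair hσ hε hε1 hL (by linarith) hΔ0 hΔσ (by linarith)
      (hen j) (Nat.cast_nonneg _) (hNn j) hcj hgapj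

end Straddle

/-! ### Elementary counting -/

/-- The largest selected element has all the other selected ones among its at most `Q` predecessors.
This turns a bound on the count at each selection into a bound on the final count. -/
theorem card_filter_card_lt_le (S : Finset ℕ) {Q : ℝ} (hQ : 0 ≤ Q) :
    ((S.filter fun s => ((S.filter (· < s)).card : ℝ) ≤ Q).card : ℝ) ≤ Q + 1 := by
  set R := S.filter fun s => ((S.filter (· < s)).card : ℝ) ≤ Q with hR
  rcases R.eq_empty_or_nonempty with h | h
  · rw [h]; simp; linarith
  have hmax := R.max'_mem h
  set m := R.max' h with hm
  have hsub : R.erase m ⊆ S.filter (· < m) := fun s hs => by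
    rw [Finset.mem_erase] at hs
    rw [Finset.mem_filter]
    exact ⟨(Finset.mem_filter.1 hs.2).1, lt_of_le_of_ne (R.le_max' s hs.2) hs.1⟩
  have h1 := Finset.card_le_card hsub
  rw [Finset.card_erase_of_mem hmax] at h1
  have h2 : R.card ≤ (S.filter (· < m)).card + 1 := by omega
  have h3 : (R.card : ℝ) ≤ (S.filter (· < m)).card + 1 := by exact_mod_cast h2
  exact h3.trans (by linarith [(Finset.mem_filter.1 hmax).2])

/-- A sequence that grows at most as fast as `Φ` while positive stays below an increment of `Φ`. -/
theorem exists_le_add_sub {D Φ : ℕ → ℝ} (h0 : D 0 ≤ 1)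
    (hpos : ∀ t, 0 < D t → D (t + 1) - D t ≤ Φ (t + 1) - Φ t)
    (hneg : ∀ t, D t ≤ 0 → D (t + 1) ≤ 1) (t : ℕ) : ∃ u ≤ t, D t ≤ 1 + Φ t - Φ u := by
  induction t with
  | zero => exact ⟨0, le_rfl, by simpa using h0⟩
  | succ t ih =>
    -- The start `u` is reset after each time at which `D` is nonpositive, when `D` jumps to at most
    -- 1; while `D` is positive the increments telescope.
    rcases le_or_gt (D t) 0 with h | h
    · exact ⟨t + 1, le_rfl, by simpa using hneg t h⟩
    · obtain ⟨u, hu, hD⟩ := ih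
      exact ⟨u, by omega, by linarith [hpos t h]⟩

/-! ### The trajectory of the algorithm -/

section Trajectory

variable {K : ℕ} {Ω : Type*} {X : ℕ → Fin K → Ω → unitInterval × unitInterval}
  {act : ℕ → Ω → Play K} {sel : ℕ → Ω → PseudoBasis K} {ω : Ω} {x : PseudoBasis K}
  {r c : Fin K → ℝ} {b κ σ ε lam : ℝ} {t : ℕ}

theorem cost_nonneg (s : ℕ) (ω : Ω) (a : Play K) : 0 ≤ cost X s ω a := by
  cases a <;> simp [cost, unitInterval.nonneg]

theorem cost_le_one (s : ℕ) (ω : Ω) (a : Play K) : cost X s ω a ≤ 1 := by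
  cases a <;> simp [cost, unitInterval.le_one]

theorem reward_nonneg (s : ℕ) (ω : Ω) (a : Play K) : 0 ≤ reward X s ω a := by
  cases a <;> simp [reward, unitInterval.nonneg]

theorem reward_le_one (s : ℕ) (ω : Ω) (a : Play K) : reward X s ω a ≤ 1 := by
  cases a <;> simp [reward, unitInterval.le_one]

theorem playCost_nonneg (h : ∀ k, 0 ≤ c k) (a : Play K) : 0 ≤ playCost c a := by
  cases a <;> simp [h]

theorem playCost_le_one (h : ∀ k, c k ≤ 1) (a : Play K) : playCost c a ≤ 1 := by
  cases a <;> simp [h]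

theorem playReward_nonneg (h : ∀ k, 0 ≤ r k) (a : Play K) : 0 ≤ playReward r a := by
  cases a <;> simp [h, playReward]

theorem playReward_le_one (h : ∀ k, r k ≤ 1) (a : Play K) : playReward r a ≤ 1 := by
  cases a <;> simp [h, playReward]

theorem lowerCost_eq (a : Play K) : lowerCost X act t ω a =
    playCost (fun k => empCost X act k t ω - radius act k t ω) a := by
  cases a <;> rfl

theorem radius_nonneg (k : Fin K) : 0 ≤ radius act k t ω := Real.sqrt_nonneg _

theorem radius_sq_mul_le (k : Fin K) {L : ℝ} (hL : Real.log t ≤ L) :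
    radius act k t ω ^ 2 * pullCount act k t ω ≤ 2 * L := by
  have h0 : 0 ≤ Real.log t := Real.log_natCast_nonneg t
  rw [radius, Real.sq_sqrt (by positivity)]
  rcases Nat.eq_zero_or_pos (pullCount act k t ω) with h | h
  · simp [h]; linarith
  · rw [div_mul_cancel₀ _ (by positivity)]; linarith

/-- The confidence intervals of round `t` contain the means. -/
def Concentrated (X : ℕ → Fin K → Ω → unitInterval × unitInterval) (act : ℕ → Ω → Play K)
    (r c : Fin K → ℝ) (t : ℕ) (ω : Ω) : Prop :=
  ∀ k, |empReward X act k t ω - r k| ≤ radius act k t ω ∧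
    |empCost X act k t ω - c k| ≤ radius act k t ω

open Classical in
/-- Number of rounds before `t`, after the initialization, whose confidence intervals miss a
mean. -/
def badCount (X : ℕ → Fin K → Ω → unitInterval × unitInterval) (act : ℕ → Ω → Play K)
    (r c : Fin K → ℝ) (t : ℕ) (ω : Ω) : ℕ :=
  ((Finset.Ico (K + 1) t).filter fun s => ¬ Concentrated X act r c s ω).card

/-- Deviation of the consumption from its mean when `x` was selected before round `t`. -/
def noise (X : ℕ → Fin K → Ω → unitInterval × unitInterval) (act : ℕ → Ω → Play K)
    (sel : ℕ → Ω → PseudoBasis K) (c : Fin K → ℝ) (x : PseudoBasis K) (t : ℕ) (ω : Ω) : ℝ :=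
  ∑ s ∈ selTimes sel x t ω, (cost X s ω (act s ω) - playCost c (act s ω))

open Classical in
/-- Number of pulls without burning when `x` was selected before round `t`. -/
def pureCount (act : ℕ → Ω → Play K) (sel : ℕ → Ω → PseudoBasis K) (x : PseudoBasis K) (t : ℕ)
    (ω : Ω) : ℕ :=
  ((selTimes sel x t ω).filter fun s => ∃ k, act s ω = .pull k).card

/-- Consumption in excess of the budget rate when `x` was selected before round `t`. -/
def imbalance (X : ℕ → Fin K → Ω → unitInterval × unitInterval) (act : ℕ → Ω → Play K)
    (sel : ℕ → Ω → PseudoBasis K) (b : ℝ) (x : PseudoBasis K) (t : ℕ) (ω : Ω) : ℝ :=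
  selCost X act sel x t ω - selCount sel x t ω * b

/-- The consumptions deviate little from their means over every range of rounds up to `T`. -/
def SmallNoise (X : ℕ → Fin K → Ω → unitInterval × unitInterval) (act : ℕ → Ω → Play K)
    (sel : ℕ → Ω → PseudoBasis K) (c : Fin K → ℝ) (ε W : ℝ) (T : ℕ) (ω : Ω) : Prop :=
  ∀ x u t, u ≤ t → t ≤ T + 1 → |noise X act sel c x t ω - noise X act sel c x u ω| ≤
    ε / 2 * (pureCount act sel x t ω - pureCount act sel x u ω) + W

theorem selTimes_of_le (h : t ≤ K + 1) : selTimes sel x t ω = ∅ := by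
  simp [selTimes, Finset.Ico_eq_empty_of_le h]

theorem mem_selTimes {s : ℕ} : s ∈ selTimes sel x t ω ↔ (K + 1 ≤ s ∧ s < t) ∧ sel s ω = x := by
  simp [selTimes]

theorem sum_selTimes_succ (f : ℕ → ℝ) [Decidable (K < t ∧ sel t ω = x)] :
    ∑ s ∈ selTimes sel x (t + 1) ω, f s =
      ∑ s ∈ selTimes sel x t ω, f s + if K < t ∧ sel t ω = x then f t else 0 := by
  classical
  rcases le_or_gt (K + 1) t with h | h
  · rw [selTimes, selTimes, Finset.sum_filter, Finset.sum_filter, Finset.sum_Ico_succ_top h]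
    simp [Nat.lt_of_succ_le h]
  · rw [selTimes_of_le (by omega), selTimes_of_le (by omega), if_neg (by omega)]
    simp

open Classical in
theorem pureCount_eq_sum : (pureCount act sel x t ω : ℝ) =
    ∑ s ∈ selTimes sel x t ω, if ∃ k, act s ω = .pull k then (1 : ℝ) else 0 := by
  simp [pureCount]

theorem selCount_eq_sum : (selCount sel x t ω : ℝ) = ∑ _s ∈ selTimes sel x t ω, 1 := by
  simp [selCount]

theorem selTimes_mono {s : ℕ} (h : s ≤ t) : selTimes sel x s ω ⊆ selTimes sel x t ω := fun u hu => by
  rw [mem_selTimes] at hu ⊢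
  exact ⟨⟨hu.1.1, by omega⟩, hu.2⟩

theorem pureCount_mono {s : ℕ} (h : s ≤ t) : pureCount act sel x s ω ≤ pureCount act sel x t ω := by
  classical
  exact Finset.card_le_card (Finset.filter_subset_filter _ (selTimes_mono h))

theorem badCount_mono {s : ℕ} (h : s ≤ t) : badCount X act r c s ω ≤ badCount X act r c t ω := by
  classical
  exact Finset.card_le_card (Finset.filter_subset_filter _ (Finset.Ico_subset_Ico le_rfl h))

open Classical in
theorem badCount_succ (h : K < t) : (badCount X act r c (t + 1) ω : ℝ) =
    badCount X act r c t ω + if Concentrated X act r c t ω then 0 else 1 := by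
  simp only [badCount, Finset.card_filter]
  rw [Finset.sum_Ico_succ_top (by omega)]
  push_cast
  simp [ite_not]

/-- The two actions at a round after the initialization, in the order of their lower confidence
bounds. -/
theorem IsUCBSimplex.exists_order {mΩ : MeasurableSpace Ω} {ℱ : Filtration ℕ mΩ}
    (hA : IsUCBSimplex ℱ X lam b sel act) (hb : 0 < b) (hb1 : b < 1) (ht : K < t) (ω : Ω) :
    ∃ p q : Play K, playsOf (sel t ω) = {p, q} ∧ lowerCost X act t ω q ≤ b ∧
      b ≤ lowerCost X act t ω p ∧ lowerCost X act t ω q < lowerCost X act t ω p ∧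
      (imbalance X act sel b (sel t ω) t ω ≤ 0 → act t ω = p) ∧
      (0 < imbalance X act sel b (sel t ω) t ω → act t ω = q) := by
  obtain ⟨p, q, hpq, hle, hp, hq⟩ := hA.stepLoadBalance t ht ω
  have h1 := (hA.stepSimplex t ht ω).1.playCost_bounds hb hb1 hpq
    (by rw [← lowerCost_eq, ← lowerCost_eq]; exact hle)
  rw [← lowerCost_eq, ← lowerCost_eq] at h1
  refine ⟨p, q, hpq, h1.1, h1.2.1, h1.2.2, fun h => hp ?_, fun h => hq ?_⟩ <;>
    unfold imbalance at h <;> linarith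

theorem IsUCBSimplex.act_mem {mΩ : MeasurableSpace Ω} {ℱ : Filtration ℕ mΩ}
    (hA : IsUCBSimplex ℱ X lam b sel act) (hb : 0 < b) (hb1 : b < 1) (ht : K < t) (ω : Ω) :
    act t ω ∈ playsOf (sel t ω) := by
  obtain ⟨p, q, hpq, -, -, -, hp, hq⟩ := hA.exists_order hb hb1 ht ω
  rw [hpq]
  rcases le_or_gt (imbalance X act sel b (sel t ω) t ω) 0 with h | h
  · exact Or.inl (hp h)
  · exact Or.inr (hq h)

theorem Concentrated.lowerCost_le (h : Concentrated X act r c t ω) (a : Play K) :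
    lowerCost X act t ω a ≤ playCost c a := by
  cases a with
  | pull k => have := (abs_le.1 (h k).2).2; simp [lowerCost]; linarith
  | _ => simp [lowerCost]

/-- Non-degeneracy makes strict the weak inequalities that feasibility of the selected basis
provides. -/
theorem playCost_ne (hI : IsNondegenerate r c b κ σ ε) (a : Play K) : playCost c a ≠ b := by
  cases a with
  | skip => simpa using hI.b_pos.ne
  | burn k => simpa using hI.b_lt_one.ne'
  | pull k =>
    intro h
    have := hI.margin_le k
    rw [playCost_pull] at h
    rw [h, sub_self, abs_zero] at this
    linarith [hI.ε_pos]

-- Drift of the imbalance. Only plain pulls are credited with `ε`: skips and burns have exact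
-- consumptions, so they create no noise to be compensated.
open Classical in
theorem IsNondegenerate.playCost_sub_le (hI : IsNondegenerate r c b κ σ ε) {a : Play K}
    (h : playCost c a < b) : playCost c a - b ≤ -(ε * if ∃ k, a = .pull k then 1 else 0) := by
  split_ifs with ha
  · obtain ⟨k, rfl⟩ := ha
    have := hI.margin_le k
    rw [playCost_pull] at h ⊢
    rw [abs_of_neg (by linarith)] at this
    linarith
  · linarith

open Classical in
theorem IsNondegenerate.le_playCost_sub (hI : IsNondegenerate r c b κ σ ε) {a : Play K}
    (h : b < playCost c a) : (ε * if ∃ k, a = .pull k then 1 else 0) ≤ playCost c a - b := by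
  split_ifs with ha
  · obtain ⟨k, rfl⟩ := ha
    have := hI.margin_le k
    rw [playCost_pull] at h ⊢
    rw [abs_of_pos (by linarith)] at this
    linarith
  · linarith

/-- At a round whose confidence intervals are right, the action taken by the load balancer when
the consumption is at most its target consumes more than the budget rate. -/
theorem IsUCBSimplex.lt_playCost_act {mΩ : MeasurableSpace Ω} {ℱ : Filtration ℕ mΩ}
    (hA : IsUCBSimplex ℱ X lam b sel act) (hI : IsNondegenerate r c b κ σ ε) (ht : K < t)
    (hc : Concentrated X act r c t ω) (hD : imbalance X act sel b (sel t ω) t ω ≤ 0) :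
    b < playCost c (act t ω) := by
  obtain ⟨p, q, -, -, h2, -, hp, -⟩ := hA.exists_order hI.b_pos hI.b_lt_one ht ω
  rw [hp hD]
  exact lt_of_le_of_ne (h2.trans (hc.lowerCost_le p)) (playCost_ne hI p).symm

/-- At a round whose confidence intervals are right, the action taken by the load balancer when
the consumption exceeds its target consumes less than the budget rate, if this is possible. -/
theorem IsUCBSimplex.playCost_act_lt {mΩ : MeasurableSpace Ω} {ℱ : Filtration ℕ mΩ}
    (hA : IsUCBSimplex ℱ X lam b sel act) (hI : IsNondegenerate r c b κ σ ε) (ht : K < t)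
    (hc : Concentrated X act r c t ω) (hs : Straddles c b (sel t ω))
    (hD : 0 < imbalance X act sel b (sel t ω) t ω) : playCost c (act t ω) < b := by
  obtain ⟨p, q, hpq, -, h2, -, -, hq⟩ := hA.exists_order hI.b_pos hI.b_lt_one ht ω
  rw [hq hD]
  obtain ⟨⟨a, ha, hlt⟩, -⟩ := hs
  rw [hpq] at ha
  -- If the cheap action is `p`, its lower bound, at least `b`, exceeds its mean consumption,
  -- against concentration.
  rcases ha with rfl | rfl
  · linarith [hc.lowerCost_le a]
  · exact hlt

theorem imbalance_zero : imbalance X act sel b x 0 ω = 0 := by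
  simp [imbalance, selCost, selCount, selTimes_of_le]

theorem noise_zero : noise X act sel c x 0 ω = 0 := by
  simp [noise, selTimes_of_le]

theorem pureCount_zero : pureCount act sel x 0 ω = 0 := by
  simp [pureCount, selTimes_of_le]

open Classical in
theorem imbalance_succ : imbalance X act sel b x (t + 1) ω = imbalance X act sel b x t ω +
    if K < t ∧ sel t ω = x then cost X t ω (act t ω) - b else 0 := by
  simp only [imbalance, selCost, selCount_eq_sum, sum_selTimes_succ]
  split_ifs <;> ring

open Classical in
theorem noise_succ : noise X act sel c x (t + 1) ω = noise X act sel c x t ω +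
    if K < t ∧ sel t ω = x then cost X t ω (act t ω) - playCost c (act t ω) else 0 := by
  simp only [noise, sum_selTimes_succ]

open Classical in
theorem pureCount_succ : (pureCount act sel x (t + 1) ω : ℝ) = pureCount act sel x t ω +
    if K < t ∧ sel t ω = x then (if ∃ k, act t ω = .pull k then 1 else 0) else 0 := by
  simp only [pureCount_eq_sum, sum_selTimes_succ]

/-- The load of a basis with actions on both sides of the budget rate is balanced. -/
theorem IsUCBSimplex.abs_imbalance_le {mΩ : MeasurableSpace Ω} {ℱ : Filtration ℕ mΩ}
    (hA : IsUCBSimplex ℱ X lam b sel act) (hI : IsNondegenerate r c b κ σ ε)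
    (hs : Straddles c b x) {W : ℝ} {T : ℕ} (hG : SmallNoise X act sel c ε W T ω)
    (ht : t ≤ T + 1) :
    |imbalance X act sel b x t ω| ≤ 1 + 2 * badCount X act r c t ω + W := by
  classical
  have hbad : ∀ t, (badCount X act r c t ω : ℝ) ≤ badCount X act r c (t + 1) ω := fun t =>
    Nat.cast_le.2 (badCount_mono (t.le_add_right 1))
  have hb := hI.b_pos
  have hb1 := hI.b_lt_one
  have hpure : ∀ t, ε * (if ∃ k, act t ω = .pull k then (1 : ℝ) else 0) ≤ 1 := fun t => by
    split_ifs <;> linarith [hI.ε_le_one]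
  -- At a round with right intervals the imbalance moves by the noise minus a drift of at least `ε`
  -- per plain pull. At a bad round the mean motion is at most 1 and the drift term at most 1,
  -- whence the coefficient 2 of `badCount`.
  have hup := exists_le_add_sub (D := fun t => imbalance X act sel b x t ω)
    (Φ := fun t => 2 * badCount X act r c t ω + noise X act sel c x t ω
      - ε * pureCount act sel x t ω) (by simp [imbalance_zero])
    (fun t hD => by
      simp only [imbalance_succ, noise_succ, pureCount_succ]
      by_cases h : K < t ∧ sel t ω = x
      · simp only [if_pos h, badCount_succ h.1]
        obtain ⟨h1, rfl⟩ := h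
        have h2 := hpure t
        by_cases hc : Concentrated X act r c t ω
        · have := hI.playCost_sub_le (hA.playCost_act_lt hI h1 hc hs hD)
          rw [if_pos hc]
          linarith
        · have := playCost_le_one hI.cost_le_one (act t ω)
          rw [if_neg hc]
          linarith
      · simp only [if_neg h]
        linarith [hbad t])
    (fun t hD => by
      simp only [imbalance_succ]
      have := cost_le_one (X := X) t ω (act t ω)
      split_ifs <;> linarith) t
  have hlow := exists_le_add_sub (D := fun t => -imbalance X act sel b x t ω)
    (Φ := fun t => 2 * badCount X act r c t ω - noise X act sel c x t ω
      - ε * pureCount act sel x t ω) (by simp [imbalance_zero])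
    (fun t hD => by
      simp only [imbalance_succ, noise_succ, pureCount_succ]
      by_cases h : K < t ∧ sel t ω = x
      · simp only [if_pos h, badCount_succ h.1]
        obtain ⟨h1, rfl⟩ := h
        have h2 := hpure t
        by_cases hc : Concentrated X act r c t ω
        · have := hI.le_playCost_sub (hA.lt_playCost_act hI h1 hc (by linarith))
          rw [if_pos hc]
          linarith
        · have := playCost_nonneg hI.cost_nonneg (act t ω)
          rw [if_neg hc]
          linarith
      · simp only [if_neg h]
        linarith [hbad t])
    (fun t hD => by
      simp only [imbalance_succ]
      have := cost_nonneg (X := X) t ω (act t ω)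
      split_ifs <;> linarith) t
  -- Over the range from `u` to `t`, the drift `ε` per plain pull absorbs the noise allowance `ε /
  -- 2`; only `W` remains.
  have key : ∀ u ≤ t, ε * (pureCount act sel x u ω : ℝ) ≤ ε * pureCount act sel x t ω :=
    fun u hu => mul_le_mul_of_nonneg_left (Nat.cast_le.2 (pureCount_mono hu)) hI.ε_pos.le
  rw [abs_le]
  constructor
  · obtain ⟨u, hu, h⟩ := hlow
    have h1 := (abs_le.1 (hG x u t hu ht)).1
    have h2 := key u hu
    linarith
  · obtain ⟨u, hu, h⟩ := hup
    have h1 := (abs_le.1 (hG x u t hu ht)).2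
    have h2 := key u hu
    linarith

end Trajectory

/-! ### Numbers of selections of non-straddling and of suboptimal bases -/

section Trajectory

variable {K : ℕ} {Ω : Type*} {X : ℕ → Fin K → Ω → unitInterval × unitInterval}
  {act : ℕ → Ω → Play K} {sel : ℕ → Ω → PseudoBasis K} {ω : Ω} {x : PseudoBasis K}
  {r c : Fin K → ℝ} {b κ σ ε lam : ℝ} {t : ℕ}

theorem sum_playCost_add_noise : ∑ s ∈ selTimes sel x t ω, playCost c (act s ω)
    + noise X act sel c x t ω = selCost X act sel x t ω := by
  rw [noise, ← Finset.sum_add_distrib, selCost]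
  exact Finset.sum_congr rfl fun s _ => by ring

theorem imbalance_sub_noise : imbalance X act sel b x t ω - noise X act sel c x t ω =
    ∑ s ∈ selTimes sel x t ω, (playCost c (act s ω) - b) := by
  rw [imbalance, ← sum_playCost_add_noise (c := c), Finset.sum_sub_distrib, selCount,
    Finset.sum_const, nsmul_eq_mul]
  ring

theorem mem_arms_of_pull_mem {k : Fin K} (h : Play.pull k ∈ playsOf x) : k ∈ arms x := by
  rcases x.cases with ⟨l, ha, hr⟩ | ⟨l, ha, hr⟩ | ⟨l, m, -, ha, hr⟩
  · rw [playsOf_resource ha hr] at h; simpa [ha] using h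
  · rw [playsOf_time ha hr] at h; simpa [ha] using h
  · rw [playsOf_pair ha hr] at h; simpa [ha] using h

theorem arms_eq_of_burn_mem {k : Fin K} (h : Play.burn k ∈ playsOf x) : arms x = {k} := by
  rcases x.cases with ⟨l, ha, hr⟩ | ⟨l, ha, hr⟩ | ⟨l, m, -, ha, hr⟩
  · rw [playsOf_resource ha hr] at h; simp at h
  · rw [playsOf_time ha hr] at h; simp at h; rw [ha, h]
  · rw [playsOf_pair ha hr] at h; simp at h

theorem card_arms_le : (arms x).card ≤ 2 := by
  rw [x.2.2]
  simpa using Finset.card_le_univ (resources x)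

theorem noise_abs_le {W : ℝ} {T : ℕ} (hG : SmallNoise X act sel c ε W T ω) (ht : t ≤ T + 1) :
    |noise X act sel c x t ω| ≤ ε / 2 * pureCount act sel x t ω + W := by
  simpa [noise_zero, pureCount_zero] using hG x 0 t (Nat.zero_le t) ht

/-- A basis whose actions do not surround the budget rate is rarely selected. -/
theorem IsUCBSimplex.selCount_le {mΩ : MeasurableSpace Ω} {ℱ : Filtration ℕ mΩ}
    (hA : IsUCBSimplex ℱ X lam b sel act) (hI : IsNondegenerate r c b κ σ ε)
    (hs : ¬ Straddles c b x) {W L : ℝ} {T : ℕ} (hG : SmallNoise X act sel c ε W T ω) (hW : 0 ≤ W)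
    (ht : t ≤ T + 1) (hL : Real.log T ≤ L) :
    (selCount sel x t ω : ℝ) ≤ badCount X act r c t ω + 16 * L / ε ^ 2 + 2 * W / ε + 3 := by
  classical
  have hε := hI.ε_pos
  have hL0 : 0 ≤ L := (Real.log_natCast_nonneg T).trans hL
  set P : Fin K → Finset ℕ := fun k => (Finset.Ico 1 t).filter fun s => (act s ω).Pulls k with hP
  set R := (selTimes sel x t ω).filter fun s => ∃ k, act s ω = .pull k with hR
  set A : Fin K → Finset ℕ := fun k =>
    (P k).filter fun s => (((P k).filter (· < s)).card : ℝ) ≤ 8 * L / ε ^ 2 with hAdef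
  set B := R.filter fun s => ((R.filter (· < s)).card : ℝ) ≤ 2 * W / ε with hB
  set E := (Finset.Ico (K + 1) t).filter fun s => ¬ Concentrated X act r c s ω with hE
  -- A selection of `x` is at a bad round (`E`), or pulls an arm of `x` that has been pulled rarely
  -- (`A`), or is one of the few early plain pulls made for `x` (`B`).
  have hsub : selTimes sel x t ω ⊆ E ∪ (arms x).biUnion A ∪ B := by
    intro s hsm
    have hsm' := mem_selTimes.1 hsm
    obtain ⟨⟨hKs, hst⟩, hsel⟩ := hsm'
    by_cases hc : Concentrated X act r c s ω
    swap
    · refine Finset.mem_union_left _ (Finset.mem_union_left _ ?_)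
      simp only [hE, Finset.mem_filter, Finset.mem_Ico]
      exact ⟨⟨hKs, hst⟩, hc⟩
    obtain ⟨p, q, hpq, hqb, hbp, -, hp, hq⟩ := hA.exists_order hI.b_pos hI.b_lt_one hKs ω
    rw [hsel] at hpq hp hq
    have hpb : b < playCost c p :=
      lt_of_le_of_ne (hbp.trans (hc.lowerCost_le p)) (playCost_ne hI p).symm
    -- The action `p` with the larger lower bound truly consumes more than `b`; as `x` does not
    -- straddle, every action does.
    have hall : ∀ a ∈ playsOf x, b < playCost c a := by
      intro a ha
      by_contra! hle
      exact hs ⟨⟨a, ha, lt_of_le_of_ne hle (playCost_ne hI a)⟩, p, by simp [hpq], hpb⟩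
    have hpm : p ∈ playsOf x := by simp [hpq]
    have hqm : q ∈ playsOf x := by simp [hpq]
    -- Skipping consumes less than `b`, and a burn has a lower bound 1 above `b`.
    obtain ⟨k, rfl⟩ : ∃ k, q = .pull k := by
      cases q with
      | skip => have := hall _ hqm; simp at this; linarith [hI.b_pos]
      | pull k => exact ⟨k, rfl⟩
      | burn k => simp [lowerCost] at hqb; linarith [hI.b_lt_one]
    have hn : (pullCount act k s ω : ℝ) ≤ 8 * L / ε ^ 2 := by
      have h1 := hall _ hqm
      have h2 := hI.margin_le k
      rw [playCost_pull] at h1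
      rw [abs_of_pos (by linarith)] at h2
      have h3 := (abs_le.1 (hc k).2).1
      simp only [lowerCost] at hqb
      -- The mean consumption of arm `k` is at least `b + ε`, but its lower bound, within twice the
      -- radius of the mean, is at most `b`.
      have h4 : ε / 2 ≤ radius act k s ω := by linarith
      have h5 : Real.log s ≤ L := le_trans (Real.log_le_log (by
        have : 0 < s := by omega
        exact_mod_cast this) (by
        have : s ≤ T := by omega
        exact_mod_cast this)) hL
      have h6 := radius_sq_mul_le (act := act) (ω := ω) k h5
      have h7 : (ε / 2) ^ 2 * (pullCount act k s ω : ℝ) ≤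
          radius act k s ω ^ 2 * pullCount act k s ω :=
        mul_le_mul_of_nonneg_right (pow_le_pow_left₀ (by positivity) h4 2) (Nat.cast_nonneg _)
      rw [le_div_iff₀ (by positivity)]
      linarith
    have hmemA : (act s ω).Pulls k → s ∈ E ∪ (arms x).biUnion A ∪ B := by
      intro hpull
      refine Finset.mem_union_left _ (Finset.mem_union_right _ ?_)
      refine Finset.mem_biUnion.2 ⟨k, mem_arms_of_pull_mem hqm, ?_⟩
      simp only [hAdef, hP, Finset.mem_filter, Finset.mem_Ico]
      refine ⟨⟨⟨by omega, hst⟩, hpull⟩, le_trans (Nat.cast_le.2 (Finset.card_le_card ?_)) hn⟩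
      intro u hu
      simp only [Finset.mem_filter, Finset.mem_Ico] at hu
      simp only [pullTimes, Finset.mem_filter, Finset.mem_Ico]
      exact ⟨⟨hu.1.1.1, hu.2⟩, hu.1.2⟩
    rcases le_or_gt (imbalance X act sel b x s ω) 0 with hD | hD
    swap
    · exact hmemA (by simp [hq hD, Play.Pulls])
    cases p with
    | skip => simp at hpb; linarith [hI.b_pos]
    | burn j =>
      have h1 := arms_eq_of_burn_mem hpm
      have h2 := mem_arms_of_pull_mem hqm
      rw [h1, Finset.mem_singleton] at h2
      exact hmemA (by simp [hp hD, Play.Pulls, h2])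
    -- Here the imbalance is nonpositive although each earlier plain pull for `x` added at least `ε`
    -- on average. So ε times their number is at most minus the noise, hence at most half of itself
    -- plus `W`.
    | pull j =>
      refine Finset.mem_union_right _ ?_
      simp only [hB, hR, Finset.mem_filter]
      refine ⟨⟨hsm, j, hp hD⟩, ?_⟩
      have h1 : R.filter (· < s) ⊆ (selTimes sel x s ω).filter fun s => ∃ k, act s ω = .pull k := by
        intro u hu
        simp only [hR, Finset.mem_filter, mem_selTimes] at hu ⊢
        exact ⟨⟨⟨hu.1.1.1.1, hu.2⟩, hu.1.1.2⟩, hu.1.2⟩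
      have h2 : ((R.filter (· < s)).card : ℝ) ≤ pureCount act sel x s ω :=
        Nat.cast_le.2 (Finset.card_le_card h1)
      refine h2.trans ?_
      have h3 : ε * pureCount act sel x s ω ≤
          ∑ u ∈ selTimes sel x s ω, (playCost c (act u ω) - b) := by
        rw [pureCount_eq_sum, Finset.mul_sum]
        refine Finset.sum_le_sum fun u hu => hI.le_playCost_sub (hall _ ?_)
        obtain ⟨⟨hu1, -⟩, hu2⟩ := mem_selTimes.1 hu
        rw [← hu2]
        exact hA.act_mem hI.b_pos hI.b_lt_one hu1 ω
      rw [← imbalance_sub_noise (X := X)] at h3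
      have h4 := (abs_le.1 (noise_abs_le (x := x) hG (by omega : s ≤ T + 1))).1
      rw [le_div_iff₀ hε]
      linarith
  have hcard := Finset.card_le_card hsub
  have h1 : (selTimes sel x t ω).card ≤ E.card + ∑ k ∈ arms x, (A k).card + B.card := by
    refine hcard.trans ((Finset.card_union_le _ _).trans ?_)
    refine add_le_add ((Finset.card_union_le _ _).trans ?_) le_rfl
    exact add_le_add le_rfl Finset.card_biUnion_le
  have h2 : ((selTimes sel x t ω).card : ℝ) ≤ E.card + ∑ k ∈ arms x, ((A k).card : ℝ) + B.card := by
    exact_mod_cast h1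
  have h3 : ∑ k ∈ arms x, ((A k).card : ℝ) ≤ 2 * (8 * L / ε ^ 2 + 1) := by
    calc ∑ k ∈ arms x, ((A k).card : ℝ) ≤ ∑ k ∈ arms x, (8 * L / ε ^ 2 + 1) :=
          Finset.sum_le_sum fun k _ => card_filter_card_lt_le (P k) (by positivity)
      _ = (arms x).card * (8 * L / ε ^ 2 + 1) := by rw [Finset.sum_const, nsmul_eq_mul]
      _ ≤ 2 * (8 * L / ε ^ 2 + 1) := by
          refine mul_le_mul_of_nonneg_right ?_ (by positivity)
          exact_mod_cast card_arms_le
  have h4 : (B.card : ℝ) ≤ 2 * W / ε + 1 := card_filter_card_lt_le R (by positivity)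
  have h5 : (selCount sel x t ω : ℝ) = (selTimes sel x t ω).card := rfl
  have h6 : (badCount X act r c t ω : ℝ) = E.card := by rw [badCount]
  rw [h5, h6]
  linarith [show 2 * (8 * L / ε ^ 2) = 16 * L / ε ^ 2 by ring]

/-- A suboptimal basis is rarely selected. -/
theorem IsUCBSimplex.gap_mul_selCount_le {mΩ : MeasurableSpace Ω} {ℱ : Filtration ℕ mΩ}
    (hA : IsUCBSimplex ℱ X (1 + 2 * κ) b sel act) (hI : IsNondegenerate r c b κ σ ε)
    (hs : Straddles c b x) {W L : ℝ} {T : ℕ} (hG : SmallNoise X act sel c ε W T ω) (hW : 0 ≤ W)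
    (ht : t ≤ T + 1) (hL : Real.log T ≤ L) {Δ : ℝ}
    (hΔ : Δ = lpValue r (consumption c) (rhs b) - objective r (consumption c) (rhs b) x)
    (hΔ0 : 0 < Δ) :
    Δ * selCount sel x t ω ≤ 2 ^ 9 * (1 + 2 * κ) ^ 2 * L / (ε ^ 3 * Δ)
      + σ * (64 * L / ε ^ 2 + 2 / ε * (1 + 2 * badCount X act r c t ω + W + W))
      + Δ * (1 + badCount X act r c t ω) := by
  classical
  have hε := hI.ε_pos
  have hσ := hI.σ_pos
  have hL0 : 0 ≤ L := (Real.log_natCast_nonneg T).trans hL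
  set M := 2 ^ 9 * (1 + 2 * κ) ^ 2 * L / (ε ^ 3 * Δ)
      + σ * (64 * L / ε ^ 2 + 2 / ε * (1 + 2 * badCount X act r c t ω + W + W)) with hM
  set S := selTimes sel x t ω with hS
  set E := (Finset.Ico (K + 1) t).filter fun s => ¬ Concentrated X act r c s ω with hE
  -- At each selection with right intervals, the earlier selections already satisfy the bound `M /
  -- Δ`; counting predecessors then costs one more selection.
  have hsub : S ⊆ E ∪ S.filter fun s => ((S.filter (· < s)).card : ℝ) ≤ M / Δ := by
    intro s hsm
    obtain ⟨⟨hKs, hst⟩, hsel⟩ := mem_selTimes.1 hsm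
    by_cases hc : Concentrated X act r c s ω
    swap
    · refine Finset.mem_union_left _ ?_
      simp only [hE, Finset.mem_filter, Finset.mem_Ico]
      exact ⟨⟨hKs, hst⟩, hc⟩
    refine Finset.mem_union_right _ (Finset.mem_filter.2 ⟨hsm, ?_⟩)
    have h1 : S.filter (· < s) = selTimes sel x s ω := by
      ext u
      simp only [hS, Finset.mem_filter, mem_selTimes]
      constructor
      · rintro ⟨⟨⟨h1, -⟩, h3⟩, h4⟩; exact ⟨⟨h1, h4⟩, h3⟩
      · rintro ⟨⟨h1, h2⟩, h3⟩; exact ⟨⟨⟨h1, by omega⟩, h3⟩, h2⟩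
    rw [h1, le_div_iff₀ hΔ0, mul_comm]
    have h5 : Real.log s ≤ L := le_trans (Real.log_le_log (by
      have : 0 < s := by omega
      exact_mod_cast this) (by
      have : s ≤ T := by omega
      exact_mod_cast this)) hL
    have hopt := hA.stepSimplex s hKs ω
    rw [hsel] at hopt
    have hrad := fun k => radius_nonneg (act := act) (ω := ω) (t := s) k
    have hκ := hI.κ_pos
    refine (hs.gap_mul_card_le hI (e := fun k => radius act k s ω)
      (n := fun k => pullCount act k s ω) (S := selTimes sel x s ω) (act := fun s => act s ω)
      (F := noise X act sel c x s ω) (V := 1 + 2 * badCount X act r c s ω + W) hL0 hopt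
      (fun k => ?_) (fun k => ?_) (fun k => ?_) (fun k => ?_) hrad
      (fun k => radius_sq_mul_le k h5) (fun u hu => ?_) (fun k => ?_) hW ?_ ?_ hΔ hΔ0).trans ?_
    · have h6 := (abs_le.1 (hc k).1).1
      have h7 := hrad k
      have h8 : 0 ≤ κ * radius act k s ω := mul_nonneg hκ.le h7
      linarith
    · have h6 := (abs_le.1 (hc k).1).2
      linarith
    · have h6 := (abs_le.1 (hc k).2).2
      linarith
    · have h6 := (abs_le.1 (hc k).2).1
      linarith
    · obtain ⟨⟨hu1, -⟩, hu2⟩ := mem_selTimes.1 hu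
      rw [← hu2]
      exact hA.act_mem hI.b_pos hI.b_lt_one hu1 ω
    · refine Nat.cast_le.2 (Finset.card_le_card fun u hu => ?_)
      simp only [Finset.mem_filter, mem_selTimes] at hu
      simp only [pullTimes, Finset.mem_filter, Finset.mem_Ico]
      exact ⟨⟨by omega, hu.1.1.2⟩, hu.2⟩
    · have h6 := hA.abs_imbalance_le hI hs hG (by omega : s ≤ T + 1)
      rw [imbalance, ← sum_playCost_add_noise (c := c)] at h6
      exact h6
    · convert noise_abs_le hG (by omega : s ≤ T + 1) using 3
      rw [pureCount]
    · have h6 : (badCount X act r c s ω : ℝ) ≤ badCount X act r c t ω :=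
        Nat.cast_le.2 (badCount_mono hst.le)
      rw [hM]
      gcongr
  have hcard := (Finset.card_le_card hsub).trans (Finset.card_union_le _ _)
  have h1 : (S.card : ℝ) ≤ E.card + (S.filter fun s => ((S.filter (· < s)).card : ℝ) ≤ M / Δ).card := by
    exact_mod_cast hcard
  have h2 := card_filter_card_lt_le S (Q := M / Δ) (by positivity)
  have h5 : (selCount sel x t ω : ℝ) = S.card := rfl
  have h6 : (badCount X act r c t ω : ℝ) = E.card := by rw [badCount]
  rw [h5]
  have h7 : Δ * (S.card : ℝ) ≤ Δ * (E.card + (M / Δ + 1)) :=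
    mul_le_mul_of_nonneg_left (by linarith) hΔ0.le
  have h8 : Δ * (M / Δ) = M := by field_simp
  rw [← h6] at h7
  linarith

end Trajectory

/-! ### Decomposition of the loss of a trajectory over the bases -/

section Trajectory

variable {K : ℕ} {Ω : Type*} {X : ℕ → Fin K → Ω → unitInterval × unitInterval}
  {act : ℕ → Ω → Play K} {sel : ℕ → Ω → PseudoBasis K} {ω : Ω} {x : PseudoBasis K}
  {r c : Fin K → ℝ} {b κ σ ε lam : ℝ} {t : ℕ}

theorem sum_selTimes_sum (f : ℕ → ℝ) :
    ∑ x, ∑ s ∈ selTimes sel x t ω, f s = ∑ s ∈ Finset.Ico (K + 1) t, f s := by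
  classical
  rw [← Finset.sum_fiberwise (Finset.Ico (K + 1) t) (fun s => sel s ω) f]
  exact Finset.sum_congr rfl fun x _ => by rw [selTimes]

open Classical in
/-- Contribution of the selections of `x` to the regret: suboptimality and imbalance. -/
def basisLoss (X : ℕ → Fin K → Ω → unitInterval × unitInterval) (act : ℕ → Ω → Play K)
    (sel : ℕ → Ω → PseudoBasis K) (r c : Fin K → ℝ) (b σ : ℝ) (w : PseudoBasis K → ℝ)
    (x : PseudoBasis K) (t : ℕ) (ω : Ω) : ℝ :=
  if Straddles c b x then
    (lpValue r (consumption c) (rhs b) - objective r (consumption c) (rhs b) x)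
      * selCount sel x t ω + (|w x| + σ) * |imbalance X act sel b x t ω|
  else 2 * σ * selCount sel x t ω

open Classical in
/-- Decomposition of the regret of a trajectory over the selected bases. -/
theorem IsUCBSimplex.mul_lpValue_sub_le {mΩ : MeasurableSpace Ω} {ℱ : Filtration ℕ mΩ}
    (hA : IsUCBSimplex ℱ X lam b sel act) (hI : IsNondegenerate r c b κ σ ε)
    {w : PseudoBasis K → ℝ} (hw : ∀ x, Straddles c b x → ∀ a ∈ playsOf x,
      playReward r a = objective r (consumption c) (rhs b) x + w x * (playCost c a - b))
    {N T : ℕ} (hNT : N ≤ T)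
    (hN : N = T ∨ b * T < ∑ s ∈ Finset.Icc 1 N, cost X s ω (act s ω)) :
    T * lpValue r (consumption c) (rhs b) - ∑ s ∈ Finset.Icc 1 N, playReward r (act s ω)
      - ∑ x with Straddles c b x, w x * noise X act sel c x (N + 1) ω ≤
    2 * σ * K + ∑ x, basisLoss X act sel r c b σ w x (N + 1) ω := by
  have hb := hI.b_pos
  have hσ := hI.σ_pos
  set V := lpValue r (consumption c) (rhs b) with hV
  have hV0 : 0 ≤ V := lpValue_nonneg hI.reward_le_one hb.le
  have hVb : V ≤ σ * b := lpValue_le_mul hb.le hσ.le hI.reward_le_cost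
  have hVσ : V ≤ σ := hVb.trans (mul_le_of_le_one_right hσ.le hI.b_lt_one.le)
  have hsplit : ∀ f : ℕ → ℝ, (∀ s, 0 ≤ f s) →
      ∑ s ∈ Finset.Ico (K + 1) (N + 1), f s ≤ ∑ s ∈ Finset.Icc 1 N, f s := fun f hf => by
    refine Finset.sum_le_sum_of_subset_of_nonneg (fun s hs => ?_) fun s _ _ => hf s
    simp only [Finset.mem_Ico, Finset.mem_Icc] at hs ⊢
    omega
  have hsplit' : ∀ f : ℕ → ℝ, (∀ s, 0 ≤ f s) → (∀ s, f s ≤ 1) →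
      ∑ s ∈ Finset.Icc 1 N, f s ≤ K + ∑ s ∈ Finset.Ico (K + 1) (N + 1), f s := fun f hf hf1 => by
    calc ∑ s ∈ Finset.Icc 1 N, f s ≤ ∑ s ∈ Finset.Icc 1 K ∪ Finset.Ico (K + 1) (N + 1), f s := by
          refine Finset.sum_le_sum_of_subset_of_nonneg (fun s hs => ?_) fun s _ _ => hf s
          simp only [Finset.mem_union, Finset.mem_Ico, Finset.mem_Icc] at hs ⊢
          omega
      _ = ∑ s ∈ Finset.Icc 1 K, f s + ∑ s ∈ Finset.Ico (K + 1) (N + 1), f s := by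
          refine Finset.sum_union (Finset.disjoint_left.2 fun s h1 h2 => ?_)
          simp only [Finset.mem_Ico, Finset.mem_Icc] at h1 h2
          omega
      _ ≤ K + ∑ s ∈ Finset.Ico (K + 1) (N + 1), f s := by
          refine add_le_add ?_ le_rfl
          calc ∑ s ∈ Finset.Icc 1 K, f s ≤ ∑ s ∈ Finset.Icc 1 K, (1 : ℝ) :=
                Finset.sum_le_sum fun s _ => hf1 s
            _ = K := by simp
  -- the number of rounds
  have hcount : (N : ℝ) ≤ K + ∑ x, (selCount sel x (N + 1) ω : ℝ) := by
    have := hsplit' (fun _ => 1) (fun _ => zero_le_one) (fun _ => le_rfl)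
    rw [← sum_selTimes_sum (sel := sel) (ω := ω)] at this
    simpa [selCount] using this
  have hcount' : ∑ x, (selCount sel x (N + 1) ω : ℝ) ≤ N := by
    have := hsplit (fun _ => 1) (fun _ => zero_le_one)
    rw [← sum_selTimes_sum (sel := sel) (ω := ω)] at this
    simpa [selCount] using this
  -- the collected rewards
  have hreward : ∑ x with Straddles c b x, (objective r (consumption c) (rhs b) x *
      selCount sel x (N + 1) ω + w x * (imbalance X act sel b x (N + 1) ω
        - noise X act sel c x (N + 1) ω)) ≤ ∑ s ∈ Finset.Icc 1 N, playReward r (act s ω) := by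
    refine le_trans ?_ (hsplit _ fun s => playReward_nonneg hI.reward_nonneg _)
    rw [← sum_selTimes_sum (sel := sel) (ω := ω)]
    -- The nonnegative rewards earned with non-straddling bases are dropped.
    refine le_trans (le_of_eq ?_) (Finset.sum_le_sum_of_subset_of_nonneg
      (Finset.filter_subset (Straddles c b) _)
      fun x _ _ => Finset.sum_nonneg fun s _ => playReward_nonneg hI.reward_nonneg _)
    refine Finset.sum_congr rfl fun x hx => ?_
    have hx' := (Finset.mem_filter.1 hx).2
    rw [imbalance_sub_noise, Finset.mul_sum, selCount_eq_sum, Finset.mul_sum,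
      ← Finset.sum_add_distrib]
    refine Finset.sum_congr rfl fun s hs => ?_
    obtain ⟨⟨hs1, -⟩, hs2⟩ := mem_selTimes.1 hs
    rw [mul_one, hw x hx' _ (hs2 ▸ hA.act_mem hb hI.b_lt_one hs1 ω)]
  -- the rounds lost at the end
  set Q : PseudoBasis K → ℝ := fun x =>
    if Straddles c b x then |imbalance X act sel b x (N + 1) ω| else selCount sel x (N + 1) ω with hQ
  have hend : b * (T - N) ≤ K + ∑ x, Q x := by
    -- If the horizon is reached, no round is lost. Otherwise the consumption, at most `K` plus the
    -- imbalances plus `b * N`, exceeds `b * T`.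
    rcases hN with rfl | hN
    · rw [sub_self, mul_zero]; positivity
    have h1 := hsplit' (fun s => cost X s ω (act s ω)) (fun s => cost_nonneg s ω _)
      (fun s => cost_le_one s ω _)
    rw [← sum_selTimes_sum (sel := sel) (ω := ω)] at h1
    have h2 : ∑ x, ∑ s ∈ selTimes sel x (N + 1) ω, cost X s ω (act s ω) =
        ∑ x, imbalance X act sel b x (N + 1) ω + (∑ x, (selCount sel x (N + 1) ω : ℝ)) * b := by
      rw [Finset.sum_mul, ← Finset.sum_add_distrib]
      exact Finset.sum_congr rfl fun x _ => by rw [imbalance, selCost]; ring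
    have h3 : ∑ x, imbalance X act sel b x (N + 1) ω ≤ ∑ x, Q x := by
      refine Finset.sum_le_sum fun x _ => ?_
      simp only [hQ]
      split_ifs
      · exact le_abs_self _
      · have h4 : selCost X act sel x (N + 1) ω ≤ selCount sel x (N + 1) ω := by
          rw [selCost, selCount_eq_sum]
          exact Finset.sum_le_sum fun s _ => cost_le_one s ω _
        have h5 : 0 ≤ (selCount sel x (N + 1) ω : ℝ) * b := by positivity
        rw [imbalance]
        linarith
    have h4 := mul_le_mul_of_nonneg_right hcount' hb.le
    linarith
  -- The factor `b` of `V ≤ σ * b` turns the lost rounds into lost budget, without a division by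
  -- `b`.
  have hVend : V * (T - N) ≤ σ * (K + ∑ x, Q x) := by
    have h0 : (0 : ℝ) ≤ T - N := by
      have : (N : ℝ) ≤ T := Nat.cast_le.2 hNT
      linarith
    calc V * (T - N) ≤ σ * b * (T - N) := mul_le_mul_of_nonneg_right hVb h0
      _ = σ * (b * (T - N)) := by ring
      _ ≤ _ := mul_le_mul_of_nonneg_left hend hσ.le
  have hVN : V * N ≤ σ * K + ∑ x, V * selCount sel x (N + 1) ω := by
    have h1 := mul_le_mul_of_nonneg_left hcount hV0
    have h2 : V * K ≤ σ * K := mul_le_mul_of_nonneg_right hVσ (Nat.cast_nonneg _)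
    rw [← Finset.mul_sum]
    linarith
  have hloss : ∑ x, V * selCount sel x (N + 1) ω + σ * ∑ x, Q x
      - ∑ x with Straddles c b x, (objective r (consumption c) (rhs b) x *
      selCount sel x (N + 1) ω + w x * (imbalance X act sel b x (N + 1) ω
        - noise X act sel c x (N + 1) ω))
      - ∑ x with Straddles c b x, w x * noise X act sel c x (N + 1) ω ≤
      ∑ x, basisLoss X act sel r c b σ w x (N + 1) ω := by
    rw [Finset.mul_sum, Finset.sum_filter, Finset.sum_filter, ← Finset.sum_add_distrib,
      ← Finset.sum_sub_distrib, ← Finset.sum_sub_distrib]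
    refine Finset.sum_le_sum fun x _ => ?_
    simp only [hQ, basisLoss]
    split_ifs with hx
    · have h1 : -(w x * imbalance X act sel b x (N + 1) ω) ≤
          |w x| * |imbalance X act sel b x (N + 1) ω| := by
        rw [← abs_mul]
        exact neg_le_abs _
      linarith
    · have h1 : V * selCount sel x (N + 1) ω ≤ σ * selCount sel x (N + 1) ω :=
        mul_le_mul_of_nonneg_right hVσ (Nat.cast_nonneg _)
      linarith
  linarith

open Classical in
theorem IsUCBSimplex.basisLoss_le {mΩ : MeasurableSpace Ω} {ℱ : Filtration ℕ mΩ}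
    (hA : IsUCBSimplex ℱ X (1 + 2 * κ) b sel act) (hI : IsNondegenerate r c b κ σ ε)
    {w : PseudoBasis K → ℝ} (hw : ∀ x, Straddles c b x → |w x| ≤ σ / ε) {T : ℕ}
    (hG : SmallNoise X act sel c ε (3 * Real.log T / (4 * ε)) T ω) (ht : t ≤ T + 1) :
    basisLoss X act sel r c b σ w x t ω ≤
      2 ^ 9 * (1 + 2 * κ) ^ 2 * Real.log T / ε ^ 3 *
        (if IsFeasibleBasis (consumption c) (rhs b) x ∧
          0 < lpValue r (consumption c) (rhs b) - objective r (consumption c) (rhs b) x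
        then 1 / (lpValue r (consumption c) (rhs b) - objective r (consumption c) (rhs b) x) else 0)
      + 69 * σ * Real.log T / ε ^ 2 + 9 * σ / ε * (1 + badCount X act r c t ω) := by
  have hε := hI.ε_pos
  have hε1 := hI.ε_le_one
  have hσ := hI.σ_pos
  have hL0 : 0 ≤ Real.log T := Real.log_natCast_nonneg T
  set L := Real.log T with hLdef
  set Δ := lpValue r (consumption c) (rhs b) - objective r (consumption c) (rhs b) x with hΔ
  have hB0 : (0 : ℝ) ≤ badCount X act r c t ω := Nat.cast_nonneg _
  set B : ℝ := (badCount X act r c t ω : ℝ) with hB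
  have hσε : σ ≤ σ / ε := by rw [le_div_iff₀ hε]; nlinarith
  have e1 : 69 * σ * L / ε ^ 2 = 69 * (σ * (L / ε ^ 2)) := by ring
  have e2 : 9 * σ / ε * (1 + B) = 9 * (σ / ε) + 9 * (σ / ε * B) := by ring
  have hL2 : 0 ≤ σ * (L / ε ^ 2) := by positivity
  have hσB : σ * B ≤ σ / ε * B := mul_le_mul_of_nonneg_right hσε hB0
  have hσεB : 0 ≤ σ / ε * B := by positivity
  by_cases hs : Straddles c b x
  · have hf := hs.isFeasibleBasis hI.b_pos hI.b_lt_one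
    have himb := hA.abs_imbalance_le hI hs hG ht
    have h1 : (|w x| + σ) * |imbalance X act sel b x t ω| ≤
        2 * (σ / ε) * (1 + 2 * B + 3 * L / (4 * ε)) :=
      mul_le_mul (by linarith [hw x hs]) himb (abs_nonneg _) (by positivity)
    have h2 : 2 * (σ / ε) * (1 + 2 * B + 3 * L / (4 * ε)) =
        2 * (σ / ε) + 4 * (σ / ε * B) + 3 / 2 * (σ * (L / ε ^ 2)) := by
      field_simp
      ring
    simp only [basisLoss, if_pos hs, hf, true_and]
    rw [← hΔ, e1, e2]
    split_ifs with hpos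
    · have h3 := hA.gap_mul_selCount_le hI hs hG (by positivity) ht le_rfl hΔ hpos
      rw [← hB, ← hLdef] at h3
      have hΔσ : Δ ≤ σ := by
        have h4 := lpValue_le_mul hI.b_pos.le hσ.le hI.reward_le_cost
        have h5 : σ * b ≤ σ := mul_le_of_le_one_right hσ.le hI.b_lt_one.le
        have h6 : 0 ≤ objective r (consumption c) (rhs b) x :=
          Finset.sum_nonneg fun k _ => mul_nonneg (hI.reward_nonneg k) (hf.2.2 k)
        linarith
      have h4 : Δ * (1 + B) ≤ σ * (1 + B) := mul_le_mul_of_nonneg_right hΔσ (by linarith)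
      have h5 : 2 ^ 9 * (1 + 2 * κ) ^ 2 * L / (ε ^ 3 * Δ) =
          2 ^ 9 * (1 + 2 * κ) ^ 2 * L / ε ^ 3 * (1 / Δ) := by
        field_simp
      -- The two occurrences of `W = 3 * L / (4 * ε)` add 3 to 64. With the 3/2 coming from the
      -- imbalance, the total stays below 69.
      have h6 : σ * (64 * L / ε ^ 2 + 2 / ε * (1 + 2 * B + 3 * L / (4 * ε) + 3 * L / (4 * ε))) =
          67 * (σ * (L / ε ^ 2)) + 2 * (σ / ε) + 4 * (σ / ε * B) := by
        field_simp
        ring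
      linarith
    · have h3 : Δ * selCount sel x t ω ≤ 0 :=
        mul_nonpos_of_nonpos_of_nonneg (by linarith) (Nat.cast_nonneg _)
      linarith
  · have h3 := hA.selCount_le hI hs hG (by positivity) ht le_rfl
    rw [← hB, ← hLdef] at h3
    have h0 : 0 ≤ 2 ^ 9 * (1 + 2 * κ) ^ 2 * L / ε ^ 3 * (if IsFeasibleBasis (consumption c) (rhs b) x ∧
        0 < Δ then 1 / Δ else 0) := by
      split_ifs with hpos
      · have := hpos.2
        positivity
      · simp
    simp only [basisLoss, if_neg hs]
    rw [e1, e2]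
    have h4 := mul_le_mul_of_nonneg_left h3 (by positivity : 0 ≤ 2 * σ)
    have h5 : 2 * σ * (B + 16 * L / ε ^ 2 + 2 * (3 * L / (4 * ε)) / ε + 3) =
        2 * (σ * B) + 35 * (σ * (L / ε ^ 2)) + 6 * σ := by
      field_simp
      ring
    linarith

end Trajectory

/-! ### Measurability -/

section Measurability

variable {K : ℕ} {Ω : Type*}

instance : MeasurableSpace (Play K) := ⊤

instance : DiscreteMeasurableSpace (Play K) := ⟨fun _ => trivial⟩

instance : Finite (Play K) := by
  refine Finite.of_surjective
    (fun o : Option (Fin K ⊕ Fin K) => o.elim Play.skip (Sum.elim Play.pull Play.burn)) ?_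
  rintro (_ | k | k)
  exacts [⟨none, rfl⟩, ⟨some (.inl k), rfl⟩, ⟨some (.inr k), rfl⟩]

theorem measurable_comp_play [MeasurableSpace Ω] {g : Play K → Ω → ℝ} {a : Ω → Play K}
    (hg : ∀ a, Measurable (g a)) (ha : Measurable a) : Measurable fun ω => g (a ω) ω := by
  have : Measurable (fun p : Play K × Ω => g p.1 p.2) := measurable_from_prod_countable_right hg
  exact this.comp (ha.prodMk measurable_id)

variable {X : ℕ → Fin K → Ω → unitInterval × unitInterval} {act : ℕ → Ω → Play K}
  {sel : ℕ → Ω → PseudoBasis K} {t : ℕ}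

theorem measurable_fst_coe [MeasurableSpace Ω] {Y : Ω → unitInterval × unitInterval}
    (h : Measurable Y) : Measurable fun ω => ((Y ω).1 : ℝ) :=
  measurable_subtype_coe.comp (measurable_fst.comp h)

theorem measurable_snd_coe [MeasurableSpace Ω] {Y : Ω → unitInterval × unitInterval}
    (h : Measurable Y) : Measurable fun ω => ((Y ω).2 : ℝ) :=
  measurable_subtype_coe.comp (measurable_snd.comp h)

theorem measurable_cost [MeasurableSpace Ω] (hX : ∀ k, Measurable (X t k))
    (ha : Measurable (act t)) : Measurable fun ω => cost X t ω (act t ω) := by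
  refine measurable_comp_play (g := fun a ω => cost X t ω a) (fun a => ?_) ha
  cases a with
  | pull k => exact measurable_snd_coe (hX k)
  | _ => exact measurable_const

theorem measurable_reward [MeasurableSpace Ω] (hX : ∀ k, Measurable (X t k))
    (ha : Measurable (act t)) : Measurable fun ω => reward X t ω (act t ω) := by
  refine measurable_comp_play (g := fun a ω => reward X t ω a) (fun a => ?_) ha
  cases a with
  | skip => exact measurable_const
  | _ k => exact measurable_fst_coe (hX k)

theorem measurable_play [MeasurableSpace Ω] (f : Play K → ℝ) {a : Ω → Play K} (ha : Measurable a) :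
    Measurable fun ω => f (a ω) :=
  (measurable_of_finite f).comp ha

theorem measurableSet_pulls [MeasurableSpace Ω] (k : Fin K) {a : Ω → Play K} (ha : Measurable a) :
    MeasurableSet {ω | (a ω).Pulls k} :=
  ha (MeasurableSet.of_discrete (s := {a : Play K | a.Pulls k}))

/-- The outcomes, actions and selections of the rounds before `t` are measurable. -/
structure MeasurablePast (m : MeasurableSpace Ω) (X : ℕ → Fin K → Ω → unitInterval × unitInterval)
    (act : ℕ → Ω → Play K) (sel : ℕ → Ω → PseudoBasis K) (t : ℕ) : Prop where
  act : ∀ s, 1 ≤ s → s < t → Measurable (act s)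
  outcome : ∀ s, 1 ≤ s → s < t → ∀ k, Measurable (X s k)
  sel : ∀ s, K + 1 ≤ s → s < t → ∀ x, MeasurableSet {ω | sel s ω = x}

namespace MeasurablePast

variable {m : MeasurableSpace Ω}

theorem sum_pullTimes (h : MeasurablePast m X act sel t) {f : ℕ → Ω → ℝ}
    (k : Fin K) (hf : ∀ s, 1 ≤ s → s < t → Measurable (f s)) :
    Measurable fun ω => ∑ s ∈ pullTimes act k t ω, f s ω := by
  classical
  simp only [pullTimes, Finset.sum_filter]
  refine Finset.measurable_sum _ fun s hs => ?_
  rw [Finset.mem_Ico] at hs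
  exact Measurable.ite (measurableSet_pulls k (h.act s hs.1 hs.2)) (hf s hs.1 hs.2)
    measurable_const

theorem sum_selTimes (h : MeasurablePast m X act sel t) {f : ℕ → Ω → ℝ}
    (x : PseudoBasis K) (hf : ∀ s, K + 1 ≤ s → s < t → Measurable (f s)) :
    Measurable fun ω => ∑ s ∈ selTimes sel x t ω, f s ω := by
  classical
  simp only [selTimes, Finset.sum_filter]
  refine Finset.measurable_sum _ fun s hs => ?_
  rw [Finset.mem_Ico] at hs
  exact Measurable.ite (h.sel s hs.1 hs.2 x) (hf s hs.1 hs.2) measurable_const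

theorem pullCount (h : MeasurablePast m X act sel t) (k : Fin K) :
    Measurable fun ω => (pullCount act k t ω : ℝ) := by
  have := h.sum_pullTimes (f := fun _ _ => 1) k fun _ _ _ => measurable_const
  simpa [KnapsackBandit.pullCount] using this

theorem empCost (h : MeasurablePast m X act sel t) (k : Fin K) :
    Measurable fun ω => empCost X act k t ω :=
  (h.sum_pullTimes k fun s h1 h2 => measurable_snd_coe (h.outcome s h1 h2 k)).div (h.pullCount k)

theorem radius (h : MeasurablePast m X act sel t) (k : Fin K) :
    Measurable fun ω => radius act k t ω :=
  (measurable_const.div (h.pullCount k)).sqrt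

theorem lowerCost (h : MeasurablePast m X act sel t) (a : Play K) :
    Measurable fun ω => lowerCost X act t ω a := by
  cases a with
  | pull k => exact (h.empCost k).sub (h.radius k)
  | _ => exact measurable_const

theorem cost (h : MeasurablePast m X act sel t) {s : ℕ} (h1 : 1 ≤ s) (h2 : s < t) :
    Measurable fun ω => cost X s ω (act s ω) :=
  measurable_cost (h.outcome s h1 h2) (h.act s h1 h2)

theorem imbalance (h : MeasurablePast m X act sel t) (b : ℝ) (x : PseudoBasis K) :
    Measurable fun ω => imbalance X act sel b x t ω := by
  have h1 : Measurable fun ω => (selCount sel x t ω : ℝ) := by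
    have := h.sum_selTimes (f := fun _ _ => 1) x fun _ _ _ => measurable_const
    simpa [selCount] using this
  exact (h.sum_selTimes x fun s h1 h2 => h.cost (by omega) h2).sub (h1.mul_const _)

theorem measurableSet_choice (h : MeasurablePast m X act sel t) (b : ℝ) (x : PseudoBasis K)
    (a : Play K) : MeasurableSet (({ω | KnapsackBandit.imbalance X act sel b x t ω ≤ 0} ∩
      {ω | a ∈ playsOf x ∧ ∀ a', a' ∈ playsOf x →
        KnapsackBandit.lowerCost X act t ω a' ≤ KnapsackBandit.lowerCost X act t ω a}) ∪
      ({ω | 0 < KnapsackBandit.imbalance X act sel b x t ω} ∩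
      {ω | a ∈ playsOf x ∧ ∀ a', a' ∈ playsOf x →
        KnapsackBandit.lowerCost X act t ω a ≤ KnapsackBandit.lowerCost X act t ω a'})) := by
  simp only [Set.ofPred_and, Set.ofPred_forall]
  refine (MeasurableSet.inter ?_ ?_).union (MeasurableSet.inter ?_ ?_)
  · exact measurableSet_le (h.imbalance b x) measurable_const
  · exact (MeasurableSet.const _).inter (MeasurableSet.iInter fun a' => MeasurableSet.iInter
      fun _ => measurableSet_le (h.lowerCost a') (h.lowerCost a))
  · exact measurableSet_lt measurable_const (h.imbalance b x)
  · exact (MeasurableSet.const _).inter (MeasurableSet.iInter fun a' => MeasurableSet.iInter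
      fun _ => measurableSet_le (h.lowerCost a) (h.lowerCost a'))

end MeasurablePast

variable [mΩ : MeasurableSpace Ω] {P : Measure Ω} {ℱ : Filtration ℕ mΩ}
  {ν : Fin K → Measure (unitInterval × unitInterval)} {b lam : ℝ}

theorem measurablePast_of_forall (hO : IsOutcomeProcess P ℱ ν X)
    (hA : IsUCBSimplex ℱ X lam b sel act)
    (hact : ∀ s, s < t → Measurable[ℱ s] (act (s + 1))) :
    MeasurablePast (ℱ t) X act sel (t + 1) := by
  refine ⟨fun s h1 h2 => ?_, fun s h1 h2 k => ?_,
    fun s h1 h2 x => ?_⟩ <;> obtain ⟨s, rfl⟩ := Nat.exists_eq_add_of_le' (by omega : 1 ≤ s)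
  · exact (hact s (by omega)).mono (ℱ.mono (by omega)) le_rfl
  · exact (hO.measurable s k).mono (ℱ.mono (by omega)) le_rfl
  · exact ℱ.mono (by omega) _ (hA.sel_nonAnticipating s (by omega) x)

/-- The two lower bounds differ strictly, as they surround `b`. The chosen action is therefore the
unique maximiser or minimiser of the lower bound, according to the sign of the imbalance, and this
event is expressed by past quantities. -/
theorem IsUCBSimplex.setOf_act_eq (hA : IsUCBSimplex ℱ X lam b sel act) (hb : 0 < b) (hb1 : b < 1)
    (ht : K < t) (a : Play K) : {ω | act t ω = a} = ⋃ x : PseudoBasis K, {ω | sel t ω = x} ∩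
      (({ω | imbalance X act sel b x t ω ≤ 0} ∩
          {ω | a ∈ playsOf x ∧ ∀ a', a' ∈ playsOf x → lowerCost X act t ω a' ≤ lowerCost X act t ω a}) ∪
        ({ω | 0 < imbalance X act sel b x t ω} ∩
          {ω | a ∈ playsOf x ∧
            ∀ a', a' ∈ playsOf x → lowerCost X act t ω a ≤ lowerCost X act t ω a'})) := by
  ext ω
  obtain ⟨p, q, hpq, -, -, hlt, hp, hq⟩ := hA.exists_order hb hb1 ht ω
  simp only [Set.mem_ofPred_eq, Set.mem_iUnion, Set.mem_inter_iff, Set.mem_union,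
    exists_eq_left', hpq, Set.mem_insert_iff, Set.mem_singleton_iff, forall_eq_or_imp, forall_eq]
  rcases le_or_gt (imbalance X act sel b (sel t ω) t ω) 0 with h | h
  · rw [hp h]
    simp only [h, h.not_gt, true_and, false_and, or_false]
    constructor
    · rintro rfl; exact ⟨Or.inl rfl, le_rfl, hlt.le⟩
    · rintro ⟨rfl | rfl, h1, h2⟩
      · rfl
      · exact absurd h1 hlt.not_ge
  · rw [hq h]
    simp only [h, h.not_ge, true_and, false_and, false_or]
    constructor
    · rintro rfl; exact ⟨Or.inr rfl, hlt.le, le_rfl⟩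
    · rintro ⟨rfl | rfl, h1, h2⟩
      · exact absurd h2 hlt.not_ge
      · rfl

/-- The actions of UCB-Simplex depend on the past only. -/
theorem IsUCBSimplex.measurable_act (hO : IsOutcomeProcess P ℱ ν X)
    (hA : IsUCBSimplex ℱ X lam b sel act) (hb : 0 < b) (hb1 : b < 1) (t : ℕ) :
    Measurable[ℱ t] (act (t + 1)) := by
  induction t using Nat.strong_induction_on with
  | _ t ih =>
    rcases lt_or_ge t K with ht | ht
    · have : act (t + 1) = fun _ => .pull ⟨t, ht⟩ := funext fun ω => hA.init ⟨t, ht⟩ ω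
      rw [this]
      exact measurable_const
    have hM := measurablePast_of_forall hO hA ih
    refine @measurable_to_countable' _ _ _ _ (ℱ t) _ fun a => ?_
    change MeasurableSet[ℱ t] {ω | act (t + 1) ω = a}
    rw [hA.setOf_act_eq hb hb1 (Nat.lt_succ_of_le ht) a]
    exact MeasurableSet.iUnion fun x =>
      (hA.sel_nonAnticipating t ht x).inter (hM.measurableSet_choice b x a)

end Measurability

/-! ### Deviation inequalities for predictable sums -/

section Deviation

variable {K : ℕ} {Ω : Type*} {ν : Fin K → Measure (unitInterval × unitInterval)}
  {X : ℕ → Fin K → Ω → unitInterval × unitInterval} {H : ℕ → Ω → Option (Fin K)}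
  {f : unitInterval × unitInterval → ℝ} {θ : ℝ}

/-- Exponent of the Hoeffding supermartingale: at round `s` the arm `H s ω`, if any, is observed. -/
def gain (ν : Fin K → Measure (unitInterval × unitInterval))
    (X : ℕ → Fin K → Ω → unitInterval × unitInterval) (H : ℕ → Ω → Option (Fin K))
    (f : unitInterval × unitInterval → ℝ) (θ : ℝ) (s : ℕ) (ω : Ω) : ℝ :=
  ∑ k, if H s ω = some k then θ * (f (X s k ω) - ∫ p, f p ∂(ν k)) - θ ^ 2 / 8 else 0

/-- At most one arm is observed per round. In this form, linear over the arms, independence is used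
for one arm at a time, so correlations between the arms do not matter. -/
theorem exp_gain (s : ℕ) (ω : Ω) : Real.exp (gain ν X H f θ s ω) = 1 + ∑ k,
    if H s ω = some k then
      Real.exp (θ * (f (X s k ω) - ∫ p, f p ∂(ν k)) - θ ^ 2 / 8) - 1 else 0 := by
  rcases h : H s ω with _ | l <;> simp [gain, h]

/-- Hoeffding's lemma: a centred variable with values in an interval of length 1 has moment
generating function at most exp(θ²/8). -/
theorem integral_exp_sub_one_le {ρ : Measure (unitInterval × unitInterval)}
    [IsProbabilityMeasure ρ] (hf : Measurable f) (hf01 : ∀ p, f p ∈ Set.Icc 0 1) (θ : ℝ) :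
    ∫ p, (Real.exp (θ * (f p - ∫ p, f p ∂ρ) - θ ^ 2 / 8) - 1) ∂ρ ≤ 0 := by
  have h := hasSubgaussianMGF_of_mem_Icc (μ := ρ) (a := 0) (b := 1) hf.aemeasurable
    (Filter.Eventually.of_forall hf01)
  have h1 := h.mgf_le θ
  have h2 := h.integrable_exp_mul θ
  rw [mgf] at h1
  have h3 : ∀ p, Real.exp (θ * (f p - ∫ p, f p ∂ρ) - θ ^ 2 / 8) =
      Real.exp (-(θ ^ 2 / 8)) * Real.exp (θ * (f p - ∫ p, f p ∂ρ)) := fun p => by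
    rw [← Real.exp_add]; ring_nf
  simp only [h3]
  rw [integral_sub (h2.const_mul _) (integrable_const _), integral_const_mul]
  simp only [integral_const, probReal_univ, smul_eq_mul, mul_one, sub_nonpos]
  calc _ ≤ Real.exp (-(θ ^ 2 / 8)) * Real.exp (θ ^ 2 / 8) := by
        refine mul_le_mul_of_nonneg_left (h1.trans (le_of_eq ?_)) (Real.exp_pos _).le
        congr 1
        norm_num
        ring
    _ = 1 := by rw [← Real.exp_add]; simp

theorem abs_gain_le (hf01 : ∀ p, f p ∈ Set.Icc 0 1) [∀ k, IsProbabilityMeasure (ν k)] (s : ℕ)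
    (ω : Ω) : |gain ν X H f θ s ω| ≤ |θ| + θ ^ 2 / 8 := by
  have h0 : 0 ≤ |θ| + θ ^ 2 / 8 := by positivity
  rcases h : H s ω with _ | k
  · simpa [gain, h] using h0
  · simp only [gain, h, Option.some.injEq, Finset.sum_ite_eq, Finset.mem_univ, if_true]
    have h1 : ∫ p, f p ∂(ν k) ∈ Set.Icc (0 : ℝ) 1 := by
      constructor
      · exact integral_nonneg fun p => (hf01 p).1
      · have := integral_mono_of_nonneg (μ := ν k) (Filter.Eventually.of_forall fun p => (hf01 p).1)
          (integrable_const (1 : ℝ)) (Filter.Eventually.of_forall fun p => (hf01 p).2)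
        simpa using this
    have h2 : |f (X s k ω) - ∫ p, f p ∂(ν k)| ≤ 1 := by
      have := hf01 (X s k ω)
      rw [abs_le]
      constructor <;> linarith [h1.1, h1.2, this.1, this.2]
    calc _ ≤ |θ * (f (X s k ω) - ∫ p, f p ∂(ν k))| + |θ ^ 2 / 8| := abs_sub _ _
      _ ≤ |θ| * 1 + θ ^ 2 / 8 := by
          rw [abs_mul, abs_of_nonneg (by positivity : 0 ≤ θ ^ 2 / 8)]
          gcongr
      _ = _ := by ring

variable [mΩ : MeasurableSpace Ω] {P : Measure Ω} {ℱ : Filtration ℕ mΩ}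

/-- The outcome of a round is independent of what is known before. -/
theorem IsOutcomeProcess.integral_mul (hO : IsOutcomeProcess P ℱ ν X) {t : ℕ} {G : Ω → ℝ}
    (hG : Measurable[ℱ t] G) {φ : unitInterval × unitInterval → ℝ} (hφ : Measurable φ)
    (k : Fin K) : ∫ ω, G ω * φ (X (t + 1) k ω) ∂P = (∫ ω, G ω ∂P) * ∫ p, φ p ∂(ν k) := by
  have hX : Measurable (X (t + 1) k) := (hO.measurable t k).mono (ℱ.le _) le_rfl
  have hind : IndepFun G (fun ω => φ (X (t + 1) k ω)) P := by
    rw [IndepFun_iff_Indep]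
    refine indep_of_indep_of_le (hO.indep t k).symm hG.comap_le ?_
    rw [show (fun ω => φ (X (t + 1) k ω)) = φ ∘ X (t + 1) k from rfl, ← MeasurableSpace.comap_comp]
    exact MeasurableSpace.comap_mono hφ.comap_le
  rw [hind.integral_fun_mul_eq_mul_integral (hG.mono (ℱ.le t) le_rfl).aestronglyMeasurable
    (hφ.comp hX).aestronglyMeasurable, ← hO.law t k,
    integral_map hX.aemeasurable hφ.aestronglyMeasurable]

/-- The arm observed at each round is known before the round. -/
def IsPredictable (ℱ : Filtration ℕ mΩ) (H : ℕ → Ω → Option (Fin K)) : Prop :=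
  ∀ t k, MeasurableSet[ℱ t] {ω | H (t + 1) ω = some k}

theorem measurable_sum_gain (hO : IsOutcomeProcess P ℱ ν X) (hH : IsPredictable ℱ H)
    (hf : Measurable f) (t : ℕ) :
    Measurable[ℱ t] fun ω => ∑ s ∈ Finset.Ico 1 (t + 1), gain ν X H f θ s ω := by
  refine Finset.measurable_sum _ fun s hs => Finset.measurable_sum _ fun k _ => ?_
  rw [Finset.mem_Ico] at hs
  obtain ⟨s, rfl⟩ := Nat.exists_eq_add_of_le' hs.1
  refine Measurable.ite (ℱ.mono (by omega) _ (hH s k)) ?_ measurable_const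
  exact (((hf.comp ((hO.measurable s k).mono (ℱ.mono (by omega)) le_rfl)).sub_const _).const_mul
    _).sub_const _

/-- Supermartingale property: the factor of round `t + 1` adds, for each arm, a past nonnegative
variable times an independent one with nonpositive mean. -/
theorem integral_exp_sum_gain_le [IsProbabilityMeasure P] [∀ k, IsProbabilityMeasure (ν k)]
    (hO : IsOutcomeProcess P ℱ ν X) (hH : IsPredictable ℱ H)
    (hf : Measurable f) (hf01 : ∀ p, f p ∈ Set.Icc 0 1) (t : ℕ) :
    Integrable (fun ω => Real.exp (∑ s ∈ Finset.Ico 1 (t + 1), gain ν X H f θ s ω)) P ∧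
      ∫ ω, Real.exp (∑ s ∈ Finset.Ico 1 (t + 1), gain ν X H f θ s ω) ∂P ≤ 1 := by
  have hint : ∀ t, Integrable (fun ω => Real.exp (∑ s ∈ Finset.Ico 1 (t + 1), gain ν X H f θ s ω)) P := by
    intro t
    refine Integrable.of_bound (C := Real.exp (∑ s ∈ Finset.Ico 1 (t + 1), (|θ| + θ ^ 2 / 8)))
      ((measurable_sum_gain hO hH hf t).mono (ℱ.le t) le_rfl).exp.aestronglyMeasurable
      (Filter.Eventually.of_forall fun ω => ?_)
    rw [Real.norm_eq_abs, Real.abs_exp, Real.exp_le_exp]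
    exact Finset.sum_le_sum fun s _ => (le_abs_self _).trans (abs_gain_le hf01 s ω)
  refine ⟨hint t, ?_⟩
  induction t with
  | zero => simp
  | succ t ih =>
    refine le_trans ?_ ih
    set G : Ω → ℝ := fun ω => Real.exp (∑ s ∈ Finset.Ico 1 (t + 1), gain ν X H f θ s ω) with hG
    have hGm : Measurable[ℱ t] G := (measurable_sum_gain hO hH hf t).exp
    set φ : Fin K → unitInterval × unitInterval → ℝ := fun k p =>
      Real.exp (θ * (f p - ∫ p, f p ∂(ν k)) - θ ^ 2 / 8) - 1 with hφ
    have hφm : ∀ k, Measurable (φ k) := fun k => by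
      have : Measurable fun p => θ * (f p - ∫ p, f p ∂(ν k)) - θ ^ 2 / 8 :=
        ((hf.sub_const _).const_mul _).sub_const _
      exact this.exp.sub_const _
    set A : Fin K → Ω → ℝ := fun k => {ω | H (t + 1) ω = some k}.indicator G with hA
    have hAm : ∀ k, Measurable[ℱ t] (A k) := fun k => hGm.indicator (hH t k)
    have hAi : ∀ k, Integrable (A k) P := fun k => (hint t).indicator (ℱ.le t _ (hH t k))
    have hAint : ∀ k, Integrable (fun ω => A k ω * φ k (X (t + 1) k ω)) P := fun k => by
      refine (hAi k).mul_bdd (c := Real.exp (|θ| + θ ^ 2 / 8) + 1) ?_ (Filter.Eventually.of_forall fun ω => ?_)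
      · exact ((hφm k).comp ((hO.measurable t k).mono (ℱ.le _) le_rfl)).aestronglyMeasurable
      -- Observing arm `k` at every round makes the gain equal to the exponent of `φ k`, which is
      -- thereby bounded.
      · have h1 := abs_gain_le (ν := ν) (X := X) (H := fun _ _ => some k) (θ := θ) hf01 (t + 1) ω
        simp only [gain, Option.some.injEq, Finset.sum_ite_eq, Finset.mem_univ, if_true] at h1
        have h2 := (abs_le.1 h1).2
        rw [Real.norm_eq_abs, abs_le]
        constructor
        · simp only [hφ]
          linarith [Real.exp_pos (θ * (f (X (t + 1) k ω) - ∫ p, f p ∂(ν k)) - θ ^ 2 / 8),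
            Real.exp_pos (|θ| + θ ^ 2 / 8)]
        · simp only [hφ]
          linarith [Real.exp_le_exp.2 h2]
    have hexp : ∀ ω, Real.exp (∑ s ∈ Finset.Ico 1 (t + 1 + 1), gain ν X H f θ s ω) =
        G ω + ∑ k, A k ω * φ k (X (t + 1) k ω) := fun ω => by
      rw [Finset.sum_Ico_succ_top (by omega), Real.exp_add, exp_gain, mul_add, mul_one,
        Finset.mul_sum]
      refine congrArg₂ _ rfl (Finset.sum_congr rfl fun k _ => ?_)
      simp only [hA, Set.indicator_apply, Set.mem_ofPred_eq]
      split_ifs <;> simp [hG, hφ]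
    simp only [hexp]
    rw [integral_add (hint t) (integrable_finsetSum _ fun k _ => hAint k),
      integral_finsetSum _ fun k _ => hAint k]
    have : ∀ k, ∫ ω, A k ω * φ k (X (t + 1) k ω) ∂P ≤ 0 := fun k => by
      rw [hO.integral_mul (hAm k) (hφm k)]
      refine mul_nonpos_of_nonneg_of_nonpos (integral_nonneg fun ω => ?_)
        (integral_exp_sub_one_le hf hf01 θ)
      exact Set.indicator_nonneg (fun ω _ => (Real.exp_pos _).le) ω
    linarith [Finset.sum_nonpos fun k (_ : k ∈ Finset.univ) => this k]

/-- Deviation inequality for a predictable sum of outcomes. -/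
theorem measureReal_le_exp_neg [IsProbabilityMeasure P] [∀ k, IsProbabilityMeasure (ν k)]
    (hO : IsOutcomeProcess P ℱ ν X) (hH : IsPredictable ℱ H)
    (hf : Measurable f) (hf01 : ∀ p, f p ∈ Set.Icc 0 1) (t : ℕ) (a : ℝ) :
    P.real {ω | a ≤ ∑ s ∈ Finset.Ico 1 (t + 1), gain ν X H f θ s ω} ≤ Real.exp (-a) := by
  obtain ⟨h1, h2⟩ := integral_exp_sum_gain_le (θ := θ) hO hH hf hf01 t
  -- Markov's inequality for the exponential.
  have h3 := mul_meas_ge_le_integral_of_nonneg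
    (Filter.Eventually.of_forall fun ω => (Real.exp_pos _).le) h1 (Real.exp a)
  simp only [Real.exp_le_exp] at h3
  rw [Real.exp_neg, ← one_div, le_div_iff₀ (Real.exp_pos a), mul_comm]
  exact h3.trans h2

end Deviation

/-! ### Confidence intervals and noise of the consumptions -/

section Concentration

variable {K : ℕ} {Ω : Type*} {ν : Fin K → Measure (unitInterval × unitInterval)}
  {X : ℕ → Fin K → Ω → unitInterval × unitInterval} {act : ℕ → Ω → Play K}
  {sel : ℕ → Ω → PseudoBasis K} {f : unitInterval × unitInterval → ℝ} {b lam θ : ℝ} {t : ℕ}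

open Classical in
/-- The observation of arm `k`. -/
def observe (act : ℕ → Ω → Play K) (k : Fin K) (s : ℕ) (ω : Ω) : Option (Fin K) :=
  if (act s ω).Pulls k then some k else none

theorem sum_gain_observe (k : Fin K) (ω : Ω) :
    ∑ s ∈ Finset.Ico 1 t, gain ν X (observe act k) f θ s ω =
      θ * (∑ s ∈ pullTimes act k t ω, f (X s k ω) - pullCount act k t ω * ∫ p, f p ∂(ν k))
        - pullCount act k t ω * (θ ^ 2 / 8) := by
  classical
  have h1 : ∀ s, gain ν X (observe act k) f θ s ω = if (act s ω).Pulls k then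
      θ * (f (X s k ω) - ∫ p, f p ∂(ν k)) - θ ^ 2 / 8 else 0 := fun s => by
    by_cases h : (act s ω).Pulls k <;> simp [gain, observe, h]
  simp only [h1]
  rw [← Finset.sum_filter, Finset.sum_sub_distrib, ← Finset.mul_sum, Finset.sum_sub_distrib]
  simp [pullCount, pullTimes]

open Classical in
/-- The pulls (without burning) when `x` is selected, from round `u` on. -/
def observeSel (act : ℕ → Ω → Play K) (sel : ℕ → Ω → PseudoBasis K) (x : PseudoBasis K) (u : ℕ)
    (s : ℕ) (ω : Ω) : Option (Fin K) :=
  if u ≤ s ∧ K < s ∧ sel s ω = x then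
    match act s ω with
    | .pull k => some k
    | _ => none
  else none

/-- Skips and burns consume exactly their mean, so all the noise comes from plain pulls. Observing
from round `u` on produces the increments of the noise. -/
theorem sum_gain_observeSel (x : PseudoBasis K) {u : ℕ} (hu : u ≤ t) (ω : Ω) :
    ∑ s ∈ Finset.Ico 1 t, gain ν X (observeSel act sel x u) (fun p => (p.2 : ℝ)) θ s ω =
      θ * (noise X act sel (meanCost ν) x t ω - noise X act sel (meanCost ν) x u ω)
        - (pureCount act sel x t ω - pureCount act sel x u ω) * (θ ^ 2 / 8) := by
  classical
  have h1 : ∀ s, gain ν X (observeSel act sel x u) (fun p => (p.2 : ℝ)) θ s ω =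
      if u ≤ s ∧ K < s ∧ sel s ω = x then
        θ * (cost X s ω (act s ω) - playCost (meanCost ν) (act s ω))
          - (if ∃ k, act s ω = .pull k then 1 else 0) * (θ ^ 2 / 8) else 0 := fun s => by
    by_cases h : u ≤ s ∧ K < s ∧ sel s ω = x
    · rw [if_pos h]
      cases ha : act s ω <;> simp [gain, observeSel, h, ha, cost, meanCost]
    · simp [gain, observeSel, h]
  simp only [h1]
  rw [← Finset.sum_filter]
  have h2 : (Finset.Ico 1 t).filter (fun s => u ≤ s ∧ K < s ∧ sel s ω = x) =
      selTimes sel x t ω \ selTimes sel x u ω := by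
    ext s
    simp only [Finset.mem_filter, Finset.mem_Ico, Finset.mem_sdiff, mem_selTimes]
    constructor
    · rintro ⟨⟨h1, h2⟩, h3, h4, h5⟩
      exact ⟨⟨⟨h4, h2⟩, h5⟩, fun h => absurd h.1.2 (by omega)⟩
    · rintro ⟨⟨⟨h1, h2⟩, h3⟩, h4⟩
      refine ⟨⟨by omega, h2⟩, ?_, h1, h3⟩
      by_contra! h5
      exact h4 ⟨⟨h1, h5⟩, h3⟩
  have h3 := selTimes_mono (sel := sel) (x := x) (ω := ω) hu
  rw [h2, Finset.sum_sub_distrib, ← Finset.mul_sum, ← Finset.sum_mul, noise, noise,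
    pureCount_eq_sum, pureCount_eq_sum, ← Finset.sum_sdiff h3, add_sub_cancel_right,
    ← Finset.sum_sdiff h3 (f := fun s => if ∃ k, act s ω = .pull k then (1 : ℝ) else 0),
    add_sub_cancel_right]

variable [mΩ : MeasurableSpace Ω] {P : Measure Ω} {ℱ : Filtration ℕ mΩ}

theorem isPredictable_observe (hact : ∀ t, Measurable[ℱ t] (act (t + 1))) (k : Fin K) :
    IsPredictable ℱ (observe act k) := by
  classical
  intro t l
  by_cases h : k = l
  · subst h
    convert hact t (MeasurableSet.of_discrete (s := {a : Play K | a.Pulls k})) using 1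
    ext ω
    simp [observe]
  · convert @MeasurableSet.empty _ (ℱ t) using 1
    ext ω
    simp [observe, h]

theorem isPredictable_observeSel (hact : ∀ t, Measurable[ℱ t] (act (t + 1)))
    (hsel : ∀ t, K ≤ t → ∀ x, MeasurableSet[ℱ t] {ω | sel (t + 1) ω = x}) (x : PseudoBasis K)
    (u : ℕ) : IsPredictable ℱ (observeSel act sel x u) := by
  classical
  intro t l
  by_cases h : u ≤ t + 1 ∧ K ≤ t
  · have : {ω | observeSel act sel x u (t + 1) ω = some l} =
        {ω | sel (t + 1) ω = x} ∩ act (t + 1) ⁻¹' {.pull l} := by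
      ext ω
      simp only [observeSel, h.1, Nat.lt_succ_of_le h.2, true_and, Set.mem_ofPred_eq,
        Set.mem_inter_iff, Set.mem_preimage, Set.mem_singleton_iff]
      by_cases hs : sel (t + 1) ω = x
      · cases ha : act (t + 1) ω <;> simp [hs]
      · simp [hs]
    rw [this]
    exact (hsel t h.2 x).inter (hact t (MeasurableSet.singleton _))
  · convert @MeasurableSet.empty _ (ℱ t) using 1
    ext ω
    have : ¬ (u ≤ t + 1 ∧ K < t + 1 ∧ sel (t + 1) ω = x) := fun h' => h ⟨h'.1, by omega⟩
    simp only [observeSel, if_neg this, Set.mem_ofPred_eq, Set.mem_empty_iff_false, reduceCtorEq]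

theorem exp_neg_mul_log {n : ℕ} (ht : 0 < t) : Real.exp (-(n * Real.log t)) = ((t : ℝ) ^ n)⁻¹ := by
  rw [Real.exp_neg, Real.exp_nat_mul, Real.exp_log (by exact_mod_cast ht)]

/-- Hoeffding's inequality for the empirical mean of an arm at a round. -/
theorem measureReal_radius_lt_le [IsProbabilityMeasure P] [∀ k, IsProbabilityMeasure (ν k)]
    (hO : IsOutcomeProcess P ℱ ν X) (hact : ∀ t, Measurable[ℱ t] (act (t + 1)))
    (hf : Measurable f) (hf01 : ∀ p, f p ∈ Set.Icc 0 1) (k : Fin K) (ht : 1 ≤ t) :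
    P.real {ω | 0 < pullCount act k t ω ∧ radius act k t ω <
      |(∑ s ∈ pullTimes act k t ω, f (X s k ω)) / pullCount act k t ω - ∫ p, f p ∂(ν k)|} ≤
    2 / (t : ℝ) ^ 3 := by
  classical
  have hL : 0 ≤ Real.log t := Real.log_natCast_nonneg t
  -- For a deviation ρ of the mean of n outcomes, θ = 4ρ maximises θ n ρ - n θ²/8, with value 2 n ρ²
  -- = 4 ln t when ρ is the radius. The number of pulls is random, so the union runs over all its
  -- values below `t`, with both signs of θ: fewer than 2t events of probability at most t⁻⁴.
  set θ : ℕ → ℝ := fun n => 4 * Real.sqrt (2 * Real.log t / n) with hθ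
  set E : ℝ → Set Ω := fun τ =>
    {ω | 4 * Real.log t ≤ ∑ s ∈ Finset.Ico 1 t, gain ν X (observe act k) f τ s ω} with hE
  have hEle : ∀ τ, P.real (E τ) ≤ ((t : ℝ) ^ 4)⁻¹ := fun τ => by
    obtain ⟨u, rfl⟩ := Nat.exists_eq_add_of_le' ht
    have := measureReal_le_exp_neg (θ := τ) hO (isPredictable_observe hact k) hf hf01 u
      (4 * Real.log ((u + 1 : ℕ) : ℝ))
    rwa [show (4 : ℝ) = ((4 : ℕ) : ℝ) by norm_num, exp_neg_mul_log (by omega)] at this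
  have hsub : {ω | 0 < pullCount act k t ω ∧ radius act k t ω <
      |(∑ s ∈ pullTimes act k t ω, f (X s k ω)) / pullCount act k t ω - ∫ p, f p ∂(ν k)|} ⊆
      ⋃ n ∈ Finset.Ico 1 t, E (θ n) ∪ E (-θ n) := by
    rintro ω ⟨hn, hlt⟩
    have hnt : pullCount act k t ω < t := by
      have : pullCount act k t ω ≤ (Finset.Ico 1 t).card := Finset.card_filter_le _ _
      rw [Nat.card_Ico] at this
      omega
    simp only [Set.mem_iUnion, Finset.mem_Ico]
    refine ⟨pullCount act k t ω, ⟨hn, hnt⟩, ?_⟩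
    have hn' : (0 : ℝ) < pullCount act k t ω := by exact_mod_cast hn
    set n := pullCount act k t ω with hndef
    set S := ∑ s ∈ pullTimes act k t ω, f (X s k ω) with hS
    set μ := ∫ p, f p ∂(ν k) with hμ
    have hrad : radius act k t ω = Real.sqrt (2 * Real.log t / n) := rfl
    set ρ := Real.sqrt (2 * Real.log t / n) with hρ
    have hρ2 : ρ ^ 2 * n = 2 * Real.log t := by
      rw [hρ, Real.sq_sqrt (by positivity), div_mul_cancel₀ _ hn'.ne']
    rw [hrad] at hlt
    have hSn : S - n * μ = n * (S / n - μ) := by field_simp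
    rcases lt_abs.1 hlt with h | h
    · refine Or.inl ?_
      simp only [hE, Set.mem_ofPred_eq, sum_gain_observe]
      rw [← hndef, ← hS, ← hμ, hSn]
      have : 4 * ρ * (n * ρ) ≤ 4 * ρ * (n * (S / n - μ)) := by gcongr
      simp only [hθ]
      rw [← hρ]
      linarith
    · refine Or.inr ?_
      simp only [hE, Set.mem_ofPred_eq, sum_gain_observe]
      rw [← hndef, ← hS, ← hμ, hSn]
      have : 4 * ρ * (n * ρ) ≤ 4 * ρ * (n * -(S / n - μ)) := by gcongr
      simp only [hθ]
      rw [← hρ]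
      linarith
  calc _ ≤ P.real (⋃ n ∈ Finset.Ico 1 t, E (θ n) ∪ E (-θ n)) := measureReal_mono hsub (measure_ne_top P _)
    _ ≤ ∑ n ∈ Finset.Ico 1 t, P.real (E (θ n) ∪ E (-θ n)) := measureReal_biUnion_finset_le _ _
    _ ≤ ∑ n ∈ Finset.Ico 1 t, (((t : ℝ) ^ 4)⁻¹ + ((t : ℝ) ^ 4)⁻¹) :=
        Finset.sum_le_sum fun n _ => (measureReal_union_le _ _).trans
          (add_le_add (hEle _) (hEle _))
    _ = ((t - 1 : ℕ) : ℝ) * (2 * ((t : ℝ) ^ 4)⁻¹) := by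
        rw [Finset.sum_const, Nat.card_Ico, nsmul_eq_mul]; ring
    _ ≤ t * (2 * ((t : ℝ) ^ 4)⁻¹) := by
        gcongr
        omega
    _ = _ := by field_simp

/-- The confidence intervals of a round after the initialization are right with high
probability. -/
theorem IsUCBSimplex.measureReal_not_concentrated_le [IsProbabilityMeasure P]
    [∀ k, IsProbabilityMeasure (ν k)] (hO : IsOutcomeProcess P ℱ ν X)
    (hA : IsUCBSimplex ℱ X lam b sel act) (hb : 0 < b) (hb1 : b < 1) (ht : K < t) :
    P.real {ω | ¬ Concentrated X act (meanReward ν) (meanCost ν) t ω} ≤ 4 * K / (t : ℝ) ^ 3 := by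
  have hact := hA.measurable_act hO hb hb1
  set R : Fin K → Set Ω := fun k => {ω | 0 < pullCount act k t ω ∧ radius act k t ω <
      |(∑ s ∈ pullTimes act k t ω, ((X s k ω).1 : ℝ)) / pullCount act k t ω - ∫ p, (p.1 : ℝ) ∂(ν k)|}
  set C : Fin K → Set Ω := fun k => {ω | 0 < pullCount act k t ω ∧ radius act k t ω <
      |(∑ s ∈ pullTimes act k t ω, ((X s k ω).2 : ℝ)) / pullCount act k t ω - ∫ p, (p.2 : ℝ) ∂(ν k)|}
  have hsub : {ω | ¬ Concentrated X act (meanReward ν) (meanCost ν) t ω} ⊆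
      ⋃ k ∈ Finset.univ, R k ∪ C k := by
    intro ω hω
    simp only [Concentrated, Set.mem_ofPred_eq, not_forall, not_and_or, not_le] at hω
    obtain ⟨k, hk⟩ := hω
    have hn : 0 < pullCount act k t ω := by
      -- Arm `k` is pulled at the initialization round `k + 1`, so its empirical means are genuine
      -- and not divisions by zero.
      refine Finset.card_pos.2 ⟨k + 1, ?_⟩
      simp only [pullTimes, Finset.mem_filter, Finset.mem_Ico]
      exact ⟨⟨by omega, by omega⟩, by simp [hA.init, Play.Pulls]⟩
    simp only [Set.mem_iUnion]
    exact ⟨k, Finset.mem_univ k, hk.imp (fun h => ⟨hn, h⟩) fun h => ⟨hn, h⟩⟩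
  calc _ ≤ P.real (⋃ k ∈ Finset.univ, R k ∪ C k) := measureReal_mono hsub (measure_ne_top P _)
    _ ≤ ∑ k, P.real (R k ∪ C k) := measureReal_biUnion_finset_le _ _
    _ ≤ ∑ k : Fin K, (2 / (t : ℝ) ^ 3 + 2 / (t : ℝ) ^ 3) :=
        Finset.sum_le_sum fun k _ => (measureReal_union_le _ _).trans (add_le_add
          (measureReal_radius_lt_le hO hact (f := fun p => (p.1 : ℝ))
            (measurable_fst_coe measurable_id) (fun p => p.1.2) k (by omega))
          (measureReal_radius_lt_le hO hact (f := fun p => (p.2 : ℝ))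
            (measurable_snd_coe measurable_id) (fun p => p.2.2) k (by omega)))
    _ = _ := by rw [Finset.sum_const, Finset.card_univ, Fintype.card_fin, nsmul_eq_mul]; ring

/-- The consumptions deviate little from their means with high probability. -/
theorem IsUCBSimplex.measureReal_not_smallNoise_le [IsProbabilityMeasure P]
    [∀ k, IsProbabilityMeasure (ν k)] (hO : IsOutcomeProcess P ℱ ν X)
    (hA : IsUCBSimplex ℱ X lam b sel act) (hb : 0 < b) (hb1 : b < 1) {ε : ℝ} (hε : 0 < ε) {T : ℕ}
    (hT : 0 < T) :
    P.real {ω | ¬ SmallNoise X act sel (meanCost ν) ε (3 * Real.log T / (4 * ε)) T ω} ≤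
      18 * Fintype.card (PseudoBasis K) / T := by
  classical
  have hact := hA.measurable_act hO hb hb1
  set E : PseudoBasis K → ℕ → ℕ → ℝ → Set Ω := fun x u t θ => {ω | 3 * Real.log T ≤
    ∑ s ∈ Finset.Ico 1 (t + 1), gain ν X (observeSel act sel x u) (fun p => (p.2 : ℝ)) θ s ω} with hE
  have hEle : ∀ x u t θ, P.real (E x u t θ) ≤ ((T : ℝ) ^ 3)⁻¹ := fun x u t θ => by
    have := measureReal_le_exp_neg (θ := θ) hO
      (isPredictable_observeSel hact hA.sel_nonAnticipating x u) (f := fun p => (p.2 : ℝ))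
      (measurable_snd_coe measurable_id) (fun p => p.2.2) t (3 * Real.log T)
    rwa [show (3 : ℝ) = ((3 : ℕ) : ℝ) by norm_num, exp_neg_mul_log hT] at this
  -- The choice θ = ± 4ε makes θ²/8 = 2ε² equal to 4ε times the allowed noise `ε / 2` per plain
  -- pull. The last index is the end of the range minus one, which leaves aside the empty range
  -- ending at 0.
  have hsub : {ω | ¬ SmallNoise X act sel (meanCost ν) ε (3 * Real.log T / (4 * ε)) T ω} ⊆
      ⋃ i ∈ (Finset.univ : Finset (PseudoBasis K)) ×ˢ
        (Finset.range (T + 2) ×ˢ Finset.range (T + 1)),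
        E i.1 i.2.1 i.2.2 (4 * ε) ∪ E i.1 i.2.1 i.2.2 (-(4 * ε)) := by
    intro ω hω
    simp only [SmallNoise, Set.mem_ofPred_eq, not_forall, not_le] at hω
    obtain ⟨x, u, t, hut, htT, hlt⟩ := hω
    rcases t with _ | t
    · obtain rfl : u = 0 := by omega
      simp only [sub_self, abs_zero, mul_zero, zero_add] at hlt
      have : 0 ≤ 3 * Real.log T / (4 * ε) :=
        div_nonneg (mul_nonneg (by norm_num) (Real.log_natCast_nonneg T)) (by positivity)
      linarith
    simp only [Set.mem_iUnion]
    refine ⟨(x, u, t), by simp; omega, ?_⟩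
    set D := noise X act sel (meanCost ν) x (t + 1) ω - noise X act sel (meanCost ν) x u ω
    set m : ℝ := (pureCount act sel x (t + 1) ω : ℝ) - pureCount act sel x u ω
    have key : ∀ D' : ℝ, ε / 2 * m + 3 * Real.log T / (4 * ε) < D' →
        3 * Real.log T ≤ 4 * ε * D' - m * ((4 * ε) ^ 2 / 8) := fun D' h => by
      have h1 := mul_lt_mul_of_pos_left h (by positivity : 0 < 4 * ε)
      have h2 : 4 * ε * (ε / 2 * m + 3 * Real.log T / (4 * ε)) = 2 * ε ^ 2 * m + 3 * Real.log T := by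
        field_simp
        ring
      nlinarith
    rcases lt_abs.1 hlt with h | h
    · refine Or.inl ?_
      simp only [hE, Set.mem_ofPred_eq]
      rw [sum_gain_observeSel x hut]
      exact key D h
    · refine Or.inr ?_
      simp only [hE, Set.mem_ofPred_eq]
      rw [sum_gain_observeSel x hut]
      have := key (-D) h
      linarith [neg_sq (4 * ε)]
  have hT0 : (0 : ℝ) < T := by exact_mod_cast hT
  have hT1 : (1 : ℝ) ≤ T := by exact_mod_cast hT
  refine (measureReal_mono hsub (measure_ne_top P _)).trans ((measureReal_biUnion_finset_le _ _).trans ?_)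
  calc _ ≤ ∑ i ∈ (Finset.univ : Finset (PseudoBasis K)) ×ˢ
        (Finset.range (T + 2) ×ˢ Finset.range (T + 1)), (((T : ℝ) ^ 3)⁻¹ + ((T : ℝ) ^ 3)⁻¹) :=
        Finset.sum_le_sum fun i _ => (measureReal_union_le _ _).trans
          (add_le_add (hEle _ _ _ _) (hEle _ _ _ _))
    _ = Fintype.card (PseudoBasis K) * ((T + 2) * (T + 1) * (2 / (T : ℝ) ^ 3)) := by
        rw [Finset.sum_const, Finset.card_product, Finset.card_product, Finset.card_range,
          Finset.card_range, Finset.card_univ, nsmul_eq_mul]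
        push_cast
        ring
    _ ≤ Fintype.card (PseudoBasis K) * (18 / T) := by
        refine mul_le_mul_of_nonneg_left ?_ (Nat.cast_nonneg _)
        rw [mul_div_assoc', div_le_div_iff₀ (by positivity) hT0]
        have h1 : ((T : ℝ) + 2) * (T + 1) ≤ 9 * T ^ 2 := by nlinarith
        nlinarith [mul_le_mul_of_nonneg_right h1 hT0.le]
    _ = _ := by ring

end Concentration

/-! ### Payoffs -/

section Payoff

variable {K : ℕ} {Ω : Type*} {ν : Fin K → Measure (unitInterval × unitInterval)}
  {X : ℕ → Fin K → Ω → unitInterval × unitInterval} {act : ℕ → Ω → Play K}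
  {sel : ℕ → Ω → PseudoBasis K} {b lam B : ℝ} {t T : ℕ} {ω : Ω}

/-- Resource consumed in the first `t` rounds. -/
def spent (X : ℕ → Fin K → Ω → unitInterval × unitInterval) (act : ℕ → Ω → Play K) (t : ℕ)
    (ω : Ω) : ℝ :=
  ∑ s ∈ Finset.Icc 1 t, cost X s ω (act s ω)

open Classical in
/-- Indicator that the budget is not exceeded in the first `t` rounds. -/
def alive (X : ℕ → Fin K → Ω → unitInterval × unitInterval) (act : ℕ → Ω → Play K) (B : ℝ) (t : ℕ)
    (ω : Ω) : ℝ :=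
  if spent X act t ω ≤ B then 1 else 0

theorem spent_succ : spent X act (t + 1) ω = spent X act t ω + cost X (t + 1) ω (act (t + 1) ω) :=
  Finset.sum_Icc_succ_top (by omega) _

theorem spent_mono (ω : Ω) : Monotone fun t => spent X act t ω :=
  monotone_nat_of_le_succ fun t => by
    rw [spent_succ]
    exact le_add_of_nonneg_right (cost_nonneg _ _ _)

theorem alive_nonneg : 0 ≤ alive X act B t ω := by
  unfold alive; split_ifs <;> simp

theorem alive_le_one : alive X act B t ω ≤ 1 := by
  unfold alive; split_ifs <;> simp

theorem abs_alive_le : |alive X act B t ω| ≤ 1 := by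
  rw [abs_of_nonneg alive_nonneg]; exact alive_le_one

theorem alive_succ_le : alive X act B (t + 1) ω ≤ alive X act B t ω := by
  have h : spent X act t ω ≤ spent X act (t + 1) ω := spent_mono ω (Nat.le_succ t)
  unfold alive
  split_ifs with h1 h2
  · exact le_rfl
  · exact absurd (h.trans h1) h2
  · exact zero_le_one
  · exact le_rfl

/-- The sum runs through the first round that exceeds the budget, which overshoots by at most 1. -/
theorem sum_alive_mul_cost_le (hB : 0 ≤ B) (n : ℕ) :
    ∑ t ∈ Finset.range n, alive X act B t ω * cost X (t + 1) ω (act (t + 1) ω) ≤ B + 1 := by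
  have h : ∀ n, ∑ t ∈ Finset.range n, alive X act B t ω * cost X (t + 1) ω (act (t + 1) ω) ≤
      min (spent X act n ω) (B + 1) := fun n => by
    induction n with
    | zero => simp [spent]; linarith
    | succ n ih =>
      rw [Finset.sum_range_succ, spent_succ]
      have h0 := cost_nonneg (X := X) (n + 1) ω (act (n + 1) ω)
      have h1 := cost_le_one (X := X) (n + 1) ω (act (n + 1) ω)
      rw [le_min_iff] at ih ⊢
      unfold alive at *
      split_ifs with h
      · exact ⟨by linarith, by linarith⟩
      · exact ⟨by linarith, by linarith⟩
  exact (h n).trans (min_le_right _ _)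

/-- Whether round t + 1 is paid depends on its own consumption, so the weight `alive` at `t + 1` is
not known before that round. The next comparisons pass to the predictable weight at `t`. -/
theorem sum_payoff_eq : ∑ t ∈ Finset.Ico 1 (stopTime X B T act ω), reward X t ω (act t ω) =
    ∑ t ∈ Finset.range T, alive X act B (t + 1) ω * reward X (t + 1) ω (act (t + 1) ω) := by
  classical
  set S := {t : ℕ | B < ∑ s ∈ Finset.Icc 1 t, cost X s ω (act s ω) ∨ T < t} with hS
  have hlt : ∀ t, t < sInf S ↔ t ∉ S := fun t => by
    refine ⟨Nat.notMem_of_lt_sInf, fun h => ?_⟩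
    by_contra! hle
    have hmem : sInf S ∈ S := Nat.sInf_mem ⟨T + 1, Or.inr (Nat.lt_succ_self T)⟩
    refine h ?_
    rcases hmem with h1 | h1
    · exact Or.inl (h1.trans_le (spent_mono (X := X) (act := act) ω hle))
    · exact Or.inr (h1.trans_le hle)
  have h1 : Finset.Ico 1 (stopTime X B T act ω) =
      (Finset.Ico 1 (T + 1)).filter fun t => spent X act t ω ≤ B := by
    ext t
    have h2 : t < stopTime X B T act ω ↔ _ := hlt t
    rw [Finset.mem_filter, Finset.mem_Ico, Finset.mem_Ico, h2, Nat.lt_succ_iff]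
    simp only [hS, Set.mem_ofPred_eq, not_or, not_lt, spent]
    tauto
  rw [h1, Finset.sum_filter, Finset.sum_Ico_eq_sum_range]
  refine Finset.sum_congr (by simp) fun t _ => ?_
  rw [add_comm 1 t, alive]
  split_ifs <;> simp

theorem sum_payoff_le : ∑ t ∈ Finset.Ico 1 (stopTime X B T act ω), reward X t ω (act t ω) ≤
    ∑ t ∈ Finset.range T, alive X act B t ω * reward X (t + 1) ω (act (t + 1) ω) := by
  rw [sum_payoff_eq]
  exact Finset.sum_le_sum fun t _ => mul_le_mul_of_nonneg_right alive_succ_le (reward_nonneg _ _ _)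

/-- The two weights differ only at the round that exceeds the budget: the differences telescope to
at most 1. -/
theorem sum_alive_mul_reward_le :
    ∑ t ∈ Finset.range T, alive X act B t ω * reward X (t + 1) ω (act (t + 1) ω) ≤
    ∑ t ∈ Finset.Ico 1 (stopTime X B T act ω), reward X t ω (act t ω) + 1 := by
  rw [sum_payoff_eq, ← sub_le_iff_le_add', ← Finset.sum_sub_distrib]
  calc _ ≤ ∑ t ∈ Finset.range T, (alive X act B t ω - alive X act B (t + 1) ω) := by
        refine Finset.sum_le_sum fun t _ => ?_
        rw [← sub_mul]
        exact mul_le_of_le_one_right (sub_nonneg.2 alive_succ_le) (reward_le_one _ _ _)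
    _ = alive X act B 0 ω - alive X act B T ω := Finset.sum_range_sub' _ _
    _ ≤ 1 := by linarith [alive_le_one (X := X) (act := act) (B := B) (t := 0) (ω := ω),
        alive_nonneg (X := X) (act := act) (B := B) (t := T) (ω := ω)]

/-- The number of rounds that are played before the budget or the horizon is exceeded. -/
theorem exists_lifetime (X : ℕ → Fin K → Ω → unitInterval × unitInterval) (act : ℕ → Ω → Play K)
    (B : ℝ) (T : ℕ) (ω : Ω) : ∃ N ≤ T, (N = T ∨ B < spent X act N ω) ∧
      ∀ g : ℕ → ℝ, ∑ t ∈ Finset.range T, alive X act B t ω * g (t + 1) =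
        ∑ s ∈ Finset.Icc 1 N, g s := by
  classical
  have hex : ∃ t, B < spent X act t ω ∨ T ≤ t := ⟨T, Or.inr le_rfl⟩
  have hNT : Nat.find hex ≤ T := Nat.find_min' hex (Or.inr le_rfl)
  refine ⟨Nat.find hex, hNT, ?_, fun g => ?_⟩
  · rcases Nat.find_spec hex with h | h
    · exact Or.inr h
    · exact Or.inl (le_antisymm hNT h)
  · have h1 : ∀ t ∈ Finset.range T, alive X act B t ω * g (t + 1) =
        if t < Nat.find hex then g (t + 1) else 0 := fun t ht => by
      rw [Finset.mem_range] at ht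
      unfold alive
      by_cases h : t < Nat.find hex
      · have := Nat.find_min hex h
        rw [if_pos h, if_pos (not_lt.1 fun h' => this (Or.inl h')), one_mul]
      · rw [if_neg h, if_neg, zero_mul]
        have h2 := spent_mono (X := X) (act := act) ω (not_lt.1 h)
        rcases Nat.find_spec hex with h3 | h3
        · exact not_le.2 (h3.trans_le h2)
        · omega
    rw [Finset.sum_congr rfl h1, ← Finset.sum_filter]
    refine Finset.sum_bij (fun t _ => t + 1) (fun t ht => ?_) (fun a _ b _ h => by omega)
      (fun s hs => ?_) fun t _ => rfl
    · simp only [Finset.mem_filter, Finset.mem_range, Finset.mem_Icc] at ht ⊢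
      omega
    · rw [Finset.mem_Icc] at hs
      exact ⟨s - 1, by simp only [Finset.mem_filter, Finset.mem_range]; omega, by omega⟩

theorem sum_ite_pulls (g : Fin K → ℝ) (a : Play K) [∀ k, Decidable (a.Pulls k)] :
    ∑ k, (if a.Pulls k then g k else 0) = playReward g a := by
  cases a with
  | skip => simp [Play.Pulls, playReward]
  | _ k =>
    rw [Finset.sum_eq_single k (fun l _ h => if_neg fun h' => h h'.symm) (by simp)]
    simp [Play.Pulls, playReward]

theorem reward_sub_playReward (s : ℕ) (ω : Ω) (a : Play K) [∀ k, Decidable (a.Pulls k)] :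
    reward X s ω a - playReward (meanReward ν) a =
      ∑ k, if a.Pulls k then ((X s k ω).1 : ℝ) - meanReward ν k else 0 := by
  rw [sum_ite_pulls]
  cases a <;> simp [reward, playReward]

theorem cost_sub_playCost (s : ℕ) (ω : Ω) (a : Play K) [∀ k, Decidable (a = .pull k)] :
    cost X s ω a - playCost (meanCost ν) a =
      ∑ k, if a = .pull k then ((X s k ω).2 : ℝ) - meanCost ν k else 0 := by
  cases a <;> simp [cost]

variable [mΩ : MeasurableSpace Ω] {P : Measure Ω} {ℱ : Filtration ℕ mΩ}

theorem integrable_of_abs_le [IsProbabilityMeasure P] {g : Ω → ℝ} (hg : Measurable g) {C : ℝ}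
    (h : ∀ ω, |g ω| ≤ C) : Integrable g P :=
  Integrable.of_bound hg.aestronglyMeasurable C (Filter.Eventually.of_forall h)

/-- Outcomes may be replaced by their means in expectation. -/
theorem IsOutcomeProcess.integral_sum_eq_zero [IsProbabilityMeasure P]
    [∀ k, IsProbabilityMeasure (ν k)] (hO : IsOutcomeProcess P ℱ ν X)
    {G : Ω → ℝ} (hG : Measurable[ℱ t] G) (hG1 : ∀ ω, |G ω| ≤ 1) {A : Fin K → Set Ω}
    (hA : ∀ k, MeasurableSet[ℱ t] (A k)) {f : unitInterval × unitInterval → ℝ} (hf : Measurable f)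
    (hf01 : ∀ p, f p ∈ Set.Icc 0 1) [∀ k ω, Decidable (ω ∈ A k)] :
    ∫ ω, G ω * ∑ k, (if ω ∈ A k then f (X (t + 1) k ω) - ∫ p, f p ∂(ν k) else 0) ∂P = 0 := by
  have hfi : ∀ k, Integrable f (ν k) := fun k => by
    refine integrable_of_abs_le hf (C := 1) fun p => ?_
    rw [abs_of_nonneg (hf01 p).1]; exact (hf01 p).2
  have hXm : ∀ k, Measurable fun ω => f (X (t + 1) k ω) - ∫ p, f p ∂(ν k) := fun k =>
    (hf.comp ((hO.measurable t k).mono (ℱ.le _) le_rfl)).sub_const _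
  have h1 : ∀ ω, G ω * ∑ k, (if ω ∈ A k then f (X (t + 1) k ω) - ∫ p, f p ∂(ν k) else 0) =
      ∑ k, (A k).indicator G ω * (f (X (t + 1) k ω) - ∫ p, f p ∂(ν k)) := fun ω => by
    rw [Finset.mul_sum]
    refine Finset.sum_congr rfl fun k _ => ?_
    rw [Set.indicator_apply]
    split_ifs <;> simp
  simp only [h1]
  rw [integral_finsetSum]
  · refine Finset.sum_eq_zero fun k _ => ?_
    rw [hO.integral_mul (hG.indicator (hA k)) (φ := fun q => f q - ∫ p, f p ∂(ν k))
      (hf.sub_const _), integral_sub (hfi k) (integrable_const _)]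
    simp
  · intro k _
    have hi : Integrable ((A k).indicator G) P :=
      (integrable_of_abs_le (hG.mono (ℱ.le t) le_rfl) hG1).indicator (ℱ.le t _ (hA k))
    refine hi.mul_bdd (c := 1 + |∫ p, f p ∂(ν k)|) (hXm k).aestronglyMeasurable
      (Filter.Eventually.of_forall fun ω => (norm_sub_le _ _).trans ?_)
    rw [Real.norm_eq_abs, Real.norm_eq_abs, abs_of_nonneg (hf01 _).1]
    linarith [(hf01 (X (t + 1) k ω)).2]

theorem IsOutcomeProcess.integral_mul_reward_sub [IsProbabilityMeasure P]
    [∀ k, IsProbabilityMeasure (ν k)] (hO : IsOutcomeProcess P ℱ ν X)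
    (hact : Measurable[ℱ t] (act (t + 1))) {G : Ω → ℝ} (hG : Measurable[ℱ t] G)
    (hG1 : ∀ ω, |G ω| ≤ 1) : ∫ ω, G ω * (reward X (t + 1) ω (act (t + 1) ω) -
      playReward (meanReward ν) (act (t + 1) ω)) ∂P = 0 := by
  classical
  simp only [reward_sub_playReward]
  exact hO.integral_sum_eq_zero hG hG1 (A := fun k => {ω | (act (t + 1) ω).Pulls k})
    (fun k => hact (MeasurableSet.of_discrete (s := {a : Play K | a.Pulls k})))
    (f := fun p => (p.1 : ℝ)) (measurable_fst_coe measurable_id) (fun p => p.1.2)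

theorem IsOutcomeProcess.integral_mul_cost_sub [IsProbabilityMeasure P]
    [∀ k, IsProbabilityMeasure (ν k)] (hO : IsOutcomeProcess P ℱ ν X)
    (hact : Measurable[ℱ t] (act (t + 1))) {G : Ω → ℝ} (hG : Measurable[ℱ t] G)
    (hG1 : ∀ ω, |G ω| ≤ 1) : ∫ ω, G ω * (cost X (t + 1) ω (act (t + 1) ω) -
      playCost (meanCost ν) (act (t + 1) ω)) ∂P = 0 := by
  classical
  simp only [cost_sub_playCost]
  exact hO.integral_sum_eq_zero hG hG1 (A := fun k => {ω | act (t + 1) ω = .pull k})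
    (fun k => hact (MeasurableSet.of_discrete (s := {a : Play K | a = .pull k})))
    (f := fun p => (p.2 : ℝ)) (measurable_snd_coe measurable_id) (fun p => p.2.2)

theorem measurable_alive (hO : IsOutcomeProcess P ℱ ν X)
    (hact : ∀ t, Measurable[ℱ t] (act (t + 1))) (t : ℕ) :
    Measurable[ℱ t] fun ω => alive X act B t ω := by
  have h : Measurable[ℱ t] fun ω => spent X act t ω := by
    refine Finset.measurable_sum _ fun s hs => ?_
    rw [Finset.mem_Icc] at hs
    obtain ⟨s, rfl⟩ := Nat.exists_eq_add_of_le' hs.1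
    refine @measurable_cost K Ω X act (s + 1) (ℱ t) (fun k => ?_) ?_
    · exact (hO.measurable s k).mono (ℱ.mono hs.2) le_rfl
    · exact (hact s).mono (ℱ.mono (by omega)) le_rfl
  unfold alive
  exact Measurable.ite (h measurableSet_Iic) measurable_const measurable_const

theorem abs_mul_le_one {u v : ℝ} (hu : |u| ≤ 1) (hv : |v| ≤ 1) : |u * v| ≤ 1 := by
  rw [abs_mul]; exact mul_le_one₀ hu (abs_nonneg _) hv

theorem NonAnticipating.measurable (h : NonAnticipating ℱ act) (t : ℕ) :
    Measurable[ℱ t] (act (t + 1)) :=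
  @measurable_to_countable' _ _ _ _ (ℱ t) _ fun a => h t a

theorem integrable_alive_mul [IsProbabilityMeasure P] (hO : IsOutcomeProcess P ℱ ν X)
    (hact : ∀ t, Measurable[ℱ t] (act (t + 1))) {g : Ω → ℝ} (hg : Measurable g)
    (hg0 : ∀ ω, 0 ≤ g ω) (hg1 : ∀ ω, g ω ≤ 1) (t : ℕ) :
    Integrable (fun ω => alive X act B t ω * g ω) P :=
  integrable_of_abs_le (((measurable_alive hO hact t).mono (ℱ.le t) le_rfl).mul hg) fun ω =>
    abs_mul_le_one abs_alive_le (by rw [abs_of_nonneg (hg0 ω)]; exact hg1 ω)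

theorem measurable_act_mΩ (hact : ∀ t, Measurable[ℱ t] (act (t + 1))) (t : ℕ) :
    Measurable (act (t + 1)) :=
  (hact t).mono (ℱ.le t) le_rfl

theorem measurable_reward_act (hO : IsOutcomeProcess P ℱ ν X)
    (hact : ∀ t, Measurable[ℱ t] (act (t + 1))) (t : ℕ) :
    Measurable fun ω => reward X (t + 1) ω (act (t + 1) ω) :=
  measurable_reward (fun k => (hO.measurable t k).mono (ℱ.le _) le_rfl) (measurable_act_mΩ hact t)

theorem measurable_cost_act (hO : IsOutcomeProcess P ℱ ν X)
    (hact : ∀ t, Measurable[ℱ t] (act (t + 1))) (t : ℕ) :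
    Measurable fun ω => cost X (t + 1) ω (act (t + 1) ω) :=
  measurable_cost (fun k => (hO.measurable t k).mono (ℱ.le _) le_rfl) (measurable_act_mΩ hact t)

theorem meanReward_mem [∀ k, IsProbabilityMeasure (ν k)] (k : Fin K) :
    meanReward ν k ∈ Set.Icc (0 : ℝ) 1 := by
  constructor
  · exact integral_nonneg fun p => p.1.2.1
  · have := integral_mono_of_nonneg (μ := ν k) (Filter.Eventually.of_forall
      fun p : unitInterval × unitInterval => p.1.2.1)
      (integrable_const (1 : ℝ)) (Filter.Eventually.of_forall fun p => p.1.2.2)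
    unfold meanReward
    simpa using this

theorem meanCost_mem [∀ k, IsProbabilityMeasure (ν k)] (k : Fin K) :
    meanCost ν k ∈ Set.Icc (0 : ℝ) 1 := by
  constructor
  · exact integral_nonneg fun p => p.2.2.1
  · have := integral_mono_of_nonneg (μ := ν k) (Filter.Eventually.of_forall
      fun p : unitInterval × unitInterval => p.2.2.1)
      (integrable_const (1 : ℝ)) (Filter.Eventually.of_forall fun p => p.2.2.2)
    unfold meanCost
    simpa using this

theorem integral_alive_reward [IsProbabilityMeasure P] [∀ k, IsProbabilityMeasure (ν k)]
    (hO : IsOutcomeProcess P ℱ ν X) (hact : ∀ t, Measurable[ℱ t] (act (t + 1))) :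
    ∫ ω, ∑ t ∈ Finset.range T, alive X act B t ω * reward X (t + 1) ω (act (t + 1) ω) ∂P =
      ∑ t ∈ Finset.range T, ∫ ω, alive X act B t ω *
        playReward (meanReward ν) (act (t + 1) ω) ∂P := by
  have hr := fun t => integrable_alive_mul (B := B) hO hact (measurable_reward_act hO hact t)
    (fun ω => reward_nonneg _ _ _) (fun ω => reward_le_one _ _ _) t
  rw [integral_finsetSum _ fun t _ => hr t]
  refine Finset.sum_congr rfl fun t _ => ?_
  have h := hO.integral_mul_reward_sub (hact t) (measurable_alive (B := B) hO hact t)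
    fun ω => abs_alive_le
  simp only [mul_sub] at h
  rwa [integral_sub (hr t) (integrable_alive_mul hO hact
    (measurable_play _ (measurable_act_mΩ hact t))
    (fun ω => playReward_nonneg (fun k => (meanReward_mem k).1) _)
    (fun ω => playReward_le_one (fun k => (meanReward_mem k).2) _) t), sub_eq_zero] at h

/-- No non-anticipating algorithm collects much more than the value of the linear program. -/
theorem payoff_le [IsProbabilityMeasure P] [∀ k, IsProbabilityMeasure (ν k)]
    (hO : IsOutcomeProcess P ℱ ν X) (hact : ∀ t, Measurable[ℱ t] (act (t + 1))) (hb : 0 < b) :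
    payoff P X (b * T) T act ≤
      (T + 1 / b) * lpValue (meanReward ν) (consumption (meanCost ν)) (rhs b) := by
  classical
  set B := b * T with hB
  have hB0 : 0 ≤ B := by positivity
  set A : ℕ → Fin K → Ω → ℝ := fun t k ω => if (act (t + 1) ω).Pulls k then 1 else 0 with hA
  have hAm : ∀ t k, Measurable (A t k) := fun t k =>
    measurable_play (fun a => if a.Pulls k then 1 else 0) (measurable_act_mΩ hact t)
  have hAi : ∀ t k, Integrable (fun ω => alive X act B t ω * A t k ω) P := fun t k =>
    integrable_alive_mul hO hact (hAm t k) (fun ω => by simp only [hA]; split_ifs <;> simp)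
      (fun ω => by simp only [hA]; split_ifs <;> simp) t
  have hc0 : ∀ k, 0 ≤ meanCost ν k := fun k => (meanCost_mem k).1
  have hc1 : ∀ k, meanCost ν k ≤ 1 := fun k => (meanCost_mem k).2
  have hpm := fun t => measurable_play (playCost (meanCost ν)) (measurable_act_mΩ hact t)
  have hpi : ∀ t, Integrable (fun ω => alive X act B t ω * playCost (meanCost ν) (act (t + 1) ω)) P :=
    fun t => integrable_alive_mul hO hact (hpm t) (fun ω => playCost_nonneg hc0 _)
      (fun ω => playCost_le_one hc1 _) t
  have hci : ∀ t, Integrable (fun ω => alive X act B t ω * cost X (t + 1) ω (act (t + 1) ω)) P :=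
    fun t => integrable_alive_mul hO hact (measurable_cost_act hO hact t)
      (fun ω => cost_nonneg _ _ _) (fun ω => cost_le_one _ _ _) t
  -- `ξ k` is the expected number of pulls of arm `k`, with or without burning, made while the
  -- budget is not yet exceeded.
  set ξ : Fin K → ℝ := fun k => ∑ t ∈ Finset.range T, ∫ ω, alive X act B t ω * A t k ω ∂P with hξ
  have hξ0 : ∀ k, 0 ≤ ξ k := fun k => Finset.sum_nonneg fun t _ => integral_nonneg fun ω =>
    mul_nonneg alive_nonneg (by simp only [hA]; split_ifs <;> simp)
  have hsum : ∀ g : Fin K → ℝ, ∑ k, g k * ξ k =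
      ∑ t ∈ Finset.range T, ∫ ω, alive X act B t ω * ∑ k, g k * A t k ω ∂P := fun g => by
    simp only [hξ, Finset.mul_sum]
    rw [Finset.sum_comm]
    refine Finset.sum_congr rfl fun t _ => ?_
    rw [integral_finsetSum _ fun k _ => by
      simpa only [mul_left_comm] using (hAi t k).const_mul (g k)]
    refine Finset.sum_congr rfl fun k _ => ?_
    rw [← integral_const_mul]
    simp only [mul_left_comm]
  have hgA : ∀ (g : Fin K → ℝ) t ω, ∑ k, g k * A t k ω = playReward g (act (t + 1) ω) :=
    fun g t ω => by
      simp only [hA, mul_ite, mul_one, mul_zero]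
      exact sum_ite_pulls g _
  have hpay : payoff P X B T act ≤ ∑ k, meanReward ν k * ξ k := by
    rw [hsum]
    simp only [hgA]
    rw [← integral_alive_reward hO hact]
    refine integral_mono_of_nonneg (Filter.Eventually.of_forall fun ω =>
      Finset.sum_nonneg fun t _ => reward_nonneg _ _ _) ?_
      (Filter.Eventually.of_forall fun ω => sum_payoff_le)
    exact integrable_finsetSum _ fun t _ => integrable_alive_mul hO hact
      (measurable_reward_act hO hact t) (fun ω => reward_nonneg _ _ _)
      (fun ω => reward_le_one _ _ _) t
  have hcost : ∑ k, meanCost ν k * ξ k ≤ B + 1 := by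
    rw [hsum]
    calc _ ≤ ∑ t ∈ Finset.range T, ∫ ω, alive X act B t ω *
          playCost (meanCost ν) (act (t + 1) ω) ∂P := by
          refine Finset.sum_le_sum fun t _ => integral_mono_of_nonneg
            (Filter.Eventually.of_forall fun ω => mul_nonneg alive_nonneg ?_) (hpi t)
            (Filter.Eventually.of_forall fun ω => mul_le_mul_of_nonneg_left ?_ alive_nonneg)
          · rw [hgA]; exact playReward_nonneg hc0 _
          · rw [hgA]
            -- A burn is charged 1, at least the mean consumption of its arm.
            cases act (t + 1) ω <;> simp [playReward, hc1]
      _ = ∑ t ∈ Finset.range T, ∫ ω, alive X act B t ω * cost X (t + 1) ω (act (t + 1) ω) ∂P := by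
          refine Finset.sum_congr rfl fun t _ => ?_
          have h := hO.integral_mul_cost_sub (hact t) (measurable_alive (B := B) hO hact t)
            fun ω => abs_alive_le
          simp only [mul_sub] at h
          rw [integral_sub (hci t) (hpi t), sub_eq_zero] at h
          exact h.symm
      _ = ∫ ω, ∑ t ∈ Finset.range T, alive X act B t ω * cost X (t + 1) ω (act (t + 1) ω) ∂P :=
          (integral_finsetSum _ fun t _ => hci t).symm
      _ ≤ ∫ ω, B + 1 ∂P := integral_mono (integrable_finsetSum _ fun t _ => hci t)
          (integrable_const _) fun ω => sum_alive_mul_cost_le hB0 T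
      _ = B + 1 := by simp
  have htime : ∑ k, ξ k ≤ T := by
    have h := hsum fun _ => 1
    simp only [hgA] at h
    simp only [one_mul] at h
    rw [h]
    calc _ ≤ ∑ t ∈ Finset.range T, ∫ ω, (1 : ℝ) ∂P := by
          refine Finset.sum_le_sum fun t _ => integral_mono_of_nonneg
            (Filter.Eventually.of_forall fun ω => mul_nonneg alive_nonneg
              (playReward_nonneg (fun _ => zero_le_one) _)) (integrable_const _)
            (Filter.Eventually.of_forall fun ω => ?_)
          exact mul_le_one₀ alive_le_one (playReward_nonneg (fun _ => zero_le_one) _)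
            (playReward_le_one (fun _ => le_rfl) _)
      _ = T := by simp
  -- This divisor satisfies `b * M = B + 1` and `T ≤ M`, so it restores both constraints in spite of
  -- the overshoot.
  set M : ℝ := T + 1 / b with hM
  have hM0 : 0 < M := by positivity
  have hfeas : IsFeasible (consumption (meanCost ν)) (rhs b) fun k => ξ k / M := by
    rw [isFeasible_iff]
    refine ⟨?_, ?_, fun k => div_nonneg (hξ0 k) hM0.le⟩
    · simp only [mul_div_assoc']
      rw [← Finset.sum_div, div_le_iff₀ hM0]
      have : b * M = B + 1 := by rw [hM, hB]; field_simp
      linarith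
    · rw [← Finset.sum_div, div_le_one hM0, hM]
      have : 0 < 1 / b := by positivity
      linarith
  have hval := le_lpValue (fun k => (meanReward_mem (ν := ν) k).2) hfeas
  simp only [mul_div_assoc'] at hval
  rw [← Finset.sum_div, div_le_iff₀ hM0] at hval
  linarith

end Payoff

/-! ### From trajectories to the expected regret -/

section Regret

variable {K : ℕ} {Ω : Type*} {ν : Fin K → Measure (unitInterval × unitInterval)}
  {X : ℕ → Fin K → Ω → unitInterval × unitInterval} {act : ℕ → Ω → Play K}
  {sel : ℕ → Ω → PseudoBasis K} {b lam B κ σ ε : ℝ} {t T : ℕ} {ω : Ω}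

open Classical in
/-- Indicator that round `t + 1` is played with the basis `x`. -/
def aliveSel (X : ℕ → Fin K → Ω → unitInterval × unitInterval) (act : ℕ → Ω → Play K)
    (sel : ℕ → Ω → PseudoBasis K) (B : ℝ) (x : PseudoBasis K) (t : ℕ) (ω : Ω) : ℝ :=
  if K < t + 1 ∧ sel (t + 1) ω = x then alive X act B t ω else 0

theorem abs_aliveSel_le {x : PseudoBasis K} : |aliveSel X act sel B x t ω| ≤ 1 := by
  unfold aliveSel
  split_ifs
  · exact abs_alive_le
  · simp

open Classical in
/-- Mean rewards collected until the end of the game, corrected by multiples `w x` of the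
deviations of the consumptions from their means. -/
def compensatedReward (ν : Fin K → Measure (unitInterval × unitInterval))
    (X : ℕ → Fin K → Ω → unitInterval × unitInterval) (act : ℕ → Ω → Play K)
    (sel : ℕ → Ω → PseudoBasis K) (b B : ℝ) (w : PseudoBasis K → ℝ) (T : ℕ) (ω : Ω) : ℝ :=
  ∑ t ∈ Finset.range T, alive X act B t ω * playReward (meanReward ν) (act (t + 1) ω) +
    ∑ x with Straddles (meanCost ν) b x, w x * ∑ t ∈ Finset.range T, aliveSel X act sel B x t ω *
      (cost X (t + 1) ω (act (t + 1) ω) - playCost (meanCost ν) (act (t + 1) ω))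

-- The predictable weights keep exactly the rounds up to `N`, including the one that exceeds the
-- budget; `noise` at `N + 1` covers the rounds before `N + 1`.
open Classical in
theorem exists_compensatedReward_eq (ν : Fin K → Measure (unitInterval × unitInterval))
    (X : ℕ → Fin K → Ω → unitInterval × unitInterval) (act : ℕ → Ω → Play K)
    (sel : ℕ → Ω → PseudoBasis K) (b B : ℝ) (w : PseudoBasis K → ℝ) (T : ℕ) (ω : Ω) :
    ∃ N ≤ T, (N = T ∨ B < ∑ s ∈ Finset.Icc 1 N, cost X s ω (act s ω)) ∧
      compensatedReward ν X act sel b B w T ω =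
        ∑ s ∈ Finset.Icc 1 N, playReward (meanReward ν) (act s ω) +
        ∑ x with Straddles (meanCost ν) b x, w x * noise X act sel (meanCost ν) x (N + 1) ω := by
  obtain ⟨N, hNT, hN, hg⟩ := exists_lifetime X act B T ω
  refine ⟨N, hNT, hN, ?_⟩
  rw [compensatedReward, hg fun s => playReward (meanReward ν) (act s ω)]
  refine congrArg₂ _ rfl (Finset.sum_congr rfl fun x _ => congrArg₂ _ rfl ?_)
  have h1 : ∀ t, aliveSel X act sel B x t ω *
      (cost X (t + 1) ω (act (t + 1) ω) - playCost (meanCost ν) (act (t + 1) ω)) =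
      alive X act B t ω * (fun s => if K < s ∧ sel s ω = x then
        cost X s ω (act s ω) - playCost (meanCost ν) (act s ω) else 0) (t + 1) := fun t => by
    simp only [aliveSel]
    split_ifs <;> simp
  rw [Finset.sum_congr rfl fun t _ => h1 t]
  refine (hg fun s => if K < s ∧ sel s ω = x then
    cost X s ω (act s ω) - playCost (meanCost ν) (act s ω) else 0).trans ?_
  rw [← Finset.sum_filter, noise]
  refine Finset.sum_congr ?_ fun _ _ => rfl
  ext s
  simp only [Finset.mem_filter, Finset.mem_Icc, mem_selTimes]
  constructor
  · rintro ⟨⟨h1, h2⟩, h3, h4⟩; exact ⟨⟨h3, by omega⟩, h4⟩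
  · rintro ⟨⟨h1, h2⟩, h3⟩; exact ⟨⟨by omega, by omega⟩, h1, h3⟩

theorem abs_cost_sub_playCost_le [∀ k, IsProbabilityMeasure (ν k)] (s : ℕ) (ω : Ω) (a : Play K) :
    |cost X s ω a - playCost (meanCost ν) a| ≤ 1 := by
  have h1 := cost_nonneg (X := X) s ω a
  have h2 := cost_le_one (X := X) s ω a
  have h3 := playCost_nonneg (fun k => (meanCost_mem (ν := ν) k).1) a
  have h4 := playCost_le_one (fun k => (meanCost_mem (ν := ν) k).2) a
  rw [abs_le]
  constructor <;> linarith

-- A crude bound, linear in `T`, for the event of probability O(1/T) on which the noise is not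
-- small.
open Classical in
theorem neg_compensatedReward_le [∀ k, IsProbabilityMeasure (ν k)] {w : PseudoBasis K → ℝ} {M : ℝ}
    (hM : 0 ≤ M) (hw : ∀ x, Straddles (meanCost ν) b x → |w x| ≤ M) :
    -compensatedReward ν X act sel b B w T ω ≤ Fintype.card (PseudoBasis K) * (M * T) := by
  have h1 : 0 ≤ ∑ t ∈ Finset.range T, alive X act B t ω *
      playReward (meanReward ν) (act (t + 1) ω) := Finset.sum_nonneg fun t _ =>
    mul_nonneg alive_nonneg (playReward_nonneg (fun k => (meanReward_mem k).1) _)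
  have h2 : ∀ x, |∑ t ∈ Finset.range T, aliveSel X act sel B x t ω *
      (cost X (t + 1) ω (act (t + 1) ω) - playCost (meanCost ν) (act (t + 1) ω))| ≤ T := fun x => by
    refine (Finset.abs_sum_le_sum_abs _ _).trans ?_
    calc _ ≤ ∑ t ∈ Finset.range T, (1 : ℝ) := Finset.sum_le_sum fun t _ =>
          abs_mul_le_one abs_aliveSel_le (abs_cost_sub_playCost_le _ _ _)
      _ = T := by simp
  have h3 : |∑ x with Straddles (meanCost ν) b x, w x * ∑ t ∈ Finset.range T,
      aliveSel X act sel B x t ω * (cost X (t + 1) ω (act (t + 1) ω) -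
        playCost (meanCost ν) (act (t + 1) ω))| ≤ Fintype.card (PseudoBasis K) * (M * T) := by
    refine (Finset.abs_sum_le_sum_abs _ _).trans ?_
    calc _ ≤ ∑ x with Straddles (meanCost ν) b x, M * T := Finset.sum_le_sum fun x hx => by
          rw [abs_mul]
          exact mul_le_mul (hw x (Finset.mem_filter.1 hx).2) (h2 x) (abs_nonneg _) hM
      _ = (Finset.univ.filter (Straddles (meanCost ν) b)).card * (M * T) := by
          rw [Finset.sum_const, nsmul_eq_mul]
      _ ≤ _ := by
          refine mul_le_mul_of_nonneg_right ?_ (by positivity)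
          exact_mod_cast Finset.card_le_univ _
  rw [compensatedReward]
  linarith [neg_le_abs (∑ x with Straddles (meanCost ν) b x, w x * ∑ t ∈ Finset.range T,
      aliveSel X act sel B x t ω * (cost X (t + 1) ω (act (t + 1) ω) -
        playCost (meanCost ν) (act (t + 1) ω)))]

variable [mΩ : MeasurableSpace Ω] {P : Measure Ω} {ℱ : Filtration ℕ mΩ}

theorem measurable_aliveSel (hO : IsOutcomeProcess P ℱ ν X)
    (hact : ∀ t, Measurable[ℱ t] (act (t + 1)))
    (hsel : ∀ t, K ≤ t → ∀ x, MeasurableSet[ℱ t] {ω | sel (t + 1) ω = x}) (x : PseudoBasis K)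
    (t : ℕ) : Measurable[ℱ t] fun ω => aliveSel X act sel B x t ω := by
  classical
  unfold aliveSel
  by_cases h : K ≤ t
  · simp only [Nat.lt_succ_of_le h, true_and]
    exact Measurable.ite (hsel t h x) (measurable_alive hO hact t) measurable_const
  · have : ¬ K < t + 1 := by omega
    simp only [this, false_and, if_false]
    exact measurable_const

/-- The compensation vanishes on average, and the payoff misses at most one round. -/
theorem integral_compensatedReward_le [IsProbabilityMeasure P] [∀ k, IsProbabilityMeasure (ν k)]
    (hO : IsOutcomeProcess P ℱ ν X) (hact : ∀ t, Measurable[ℱ t] (act (t + 1)))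
    (hsel : ∀ t, K ≤ t → ∀ x, MeasurableSet[ℱ t] {ω | sel (t + 1) ω = x})
    (w : PseudoBasis K → ℝ) : Integrable (compensatedReward ν X act sel b B w T) P ∧
      ∫ ω, compensatedReward ν X act sel b B w T ω ∂P ≤ payoff P X B T act + 1 := by
  classical
  have hci : ∀ x t, Integrable (fun ω => aliveSel X act sel B x t ω *
      (cost X (t + 1) ω (act (t + 1) ω) - playCost (meanCost ν) (act (t + 1) ω))) P := fun x t =>
    integrable_of_abs_le (((measurable_aliveSel hO hact hsel x t).mono (ℱ.le t) le_rfl).mul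
      ((measurable_cost_act hO hact t).sub (measurable_play _ (measurable_act_mΩ hact t))))
      fun ω => abs_mul_le_one abs_aliveSel_le (abs_cost_sub_playCost_le _ _ _)
  have hpi : ∀ t, Integrable (fun ω => alive X act B t ω *
      playReward (meanReward ν) (act (t + 1) ω)) P := fun t =>
    integrable_alive_mul hO hact (measurable_play _ (measurable_act_mΩ hact t))
      (fun ω => playReward_nonneg (fun k => (meanReward_mem k).1) _)
      (fun ω => playReward_le_one (fun k => (meanReward_mem k).2) _) t
  have hri : ∀ t, Integrable (fun ω => alive X act B t ω * reward X (t + 1) ω (act (t + 1) ω)) P :=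
    fun t => integrable_alive_mul hO hact (measurable_reward_act hO hact t)
      (fun ω => reward_nonneg _ _ _) (fun ω => reward_le_one _ _ _) t
  have h1 : Integrable (fun ω => ∑ t ∈ Finset.range T, alive X act B t ω *
      playReward (meanReward ν) (act (t + 1) ω)) P := integrable_finsetSum _ fun t _ => hpi t
  have h2 : ∀ x, Integrable (fun ω => ∑ t ∈ Finset.range T, aliveSel X act sel B x t ω *
      (cost X (t + 1) ω (act (t + 1) ω) - playCost (meanCost ν) (act (t + 1) ω))) P := fun x =>
    integrable_finsetSum _ fun t _ => hci x t
  have h3 : Integrable (fun ω => ∑ x with Straddles (meanCost ν) b x, w x * ∑ t ∈ Finset.range T,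
      aliveSel X act sel B x t ω * (cost X (t + 1) ω (act (t + 1) ω) -
        playCost (meanCost ν) (act (t + 1) ω))) P :=
    integrable_finsetSum _ fun x _ => (h2 x).const_mul (w x)
  refine ⟨h1.add h3, ?_⟩
  simp only [compensatedReward]
  rw [integral_add h1 h3, integral_finsetSum _ fun t _ => hpi t, ← integral_alive_reward hO hact,
    integral_finsetSum _ fun x _ => (h2 x).const_mul (w x), Finset.sum_eq_zero, add_zero]
  · have h4 : Integrable (fun ω => ∑ t ∈ Finset.Ico 1 (stopTime X B T act ω),
        reward X t ω (act t ω)) P := by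
      simp only [sum_payoff_eq]
      refine integrable_finsetSum _ fun t _ => integrable_of_abs_le (C := 1)
        (((measurable_alive hO hact (t + 1)).mono (ℱ.le _) le_rfl).mul
          (measurable_reward_act hO hact t)) fun ω => abs_mul_le_one abs_alive_le ?_
      rw [abs_of_nonneg (reward_nonneg _ _ _)]
      exact reward_le_one _ _ _
    calc _ ≤ ∫ ω, (∑ t ∈ Finset.Ico 1 (stopTime X B T act ω), reward X t ω (act t ω) + 1) ∂P :=
          integral_mono (integrable_finsetSum _ fun t _ => hri t) (h4.add (integrable_const _))
            fun ω => sum_alive_mul_reward_le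
      _ = payoff P X B T act + 1 := by
          rw [integral_add h4 (integrable_const _), payoff]
          simp
  · intro x _
    rw [integral_const_mul, integral_finsetSum _ fun t _ => hci x t, Finset.sum_eq_zero, mul_zero]
    exact fun t _ => hO.integral_mul_cost_sub (hact t) (measurable_aliveSel hO hact hsel x t)
      fun ω => abs_aliveSel_le

theorem optPayoff_le [IsProbabilityMeasure P] [∀ k, IsProbabilityMeasure (ν k)]
    (hO : IsOutcomeProcess P ℱ ν X) (hb : 0 < b) (T : ℕ) : optPayoff P ℱ X (b * T) T ≤
      (T + 1 / b) * lpValue (meanReward ν) (consumption (meanCost ν)) (rhs b) := by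
  -- Always skipping is non-anticipating, so the supremum is over a non-empty set.
  refine csSup_le ⟨_, fun _ _ => Play.skip, fun t a => MeasurableSet.const _, rfl⟩ ?_
  rintro _ ⟨a, ha, rfl⟩
  exact payoff_le hO ha.measurable hb

/-- The expected number of rounds with wrong confidence intervals is bounded. -/
theorem IsUCBSimplex.exists_badCount_le [IsProbabilityMeasure P]
    [∀ k, IsProbabilityMeasure (ν k)] (hO : IsOutcomeProcess P ℱ ν X)
    (hA : IsUCBSimplex ℱ X lam b sel act) (hb : 0 < b) (hb1 : b < 1) (t : ℕ) :
    ∃ g : Ω → ℝ, Integrable g P ∧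
      (∀ ω, badCount X act (meanReward ν) (meanCost ν) t ω ≤ g ω) ∧
      ∫ ω, g ω ∂P ≤ 4 * K * ∑' n : ℕ, 1 / (n : ℝ) ^ 3 := by
  classical
  -- Measurable hulls have the same probability, so the measurability of the events themselves need
  -- not be proved.
  set E : ℕ → Set Ω := fun s =>
    toMeasurable P {ω | ¬ Concentrated X act (meanReward ν) (meanCost ν) s ω} with hE
  have hEm : ∀ s, MeasurableSet (E s) := fun s => measurableSet_toMeasurable _ _
  have hEi : ∀ s, Integrable ((E s).indicator (1 : Ω → ℝ)) P := fun s =>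
    (integrable_const (1 : ℝ)).indicator (hEm s)
  refine ⟨fun ω => ∑ s ∈ Finset.Ico (K + 1) t, (E s).indicator 1 ω,
    integrable_finsetSum _ fun s _ => hEi s, fun ω => ?_, ?_⟩
  · rw [badCount, Finset.card_filter]
    push_cast
    refine Finset.sum_le_sum fun s _ => ?_
    split_ifs with h
    · exact Set.indicator_nonneg (fun _ _ => zero_le_one) _
    · rw [Set.indicator_of_mem (subset_toMeasurable _ _ h)]; simp
  · rw [integral_finsetSum _ fun s _ => hEi s]
    have hs : Summable fun n : ℕ => 1 / (n : ℝ) ^ 3 :=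
      Real.summable_one_div_nat_pow.2 (by norm_num)
    calc _ ≤ ∑ s ∈ Finset.Ico (K + 1) t, 4 * (K : ℝ) * (1 / (s : ℝ) ^ 3) := by
          refine Finset.sum_le_sum fun s hs => ?_
          rw [Finset.mem_Ico] at hs
          rw [integral_indicator_one (hEm s), measureReal_def, measure_toMeasurable,
            ← measureReal_def]
          refine (hA.measureReal_not_concentrated_le hO hb hb1 (by omega)).trans (le_of_eq ?_)
          ring
      _ = 4 * (K : ℝ) * ∑ s ∈ Finset.Ico (K + 1) t, 1 / (s : ℝ) ^ 3 := by rw [Finset.mul_sum]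
      _ ≤ _ := by
          refine mul_le_mul_of_nonneg_left (hs.sum_le_tsum _ fun n _ => by positivity)
            (by positivity)

/-- The part of the regret bound that does not depend on the horizon. -/
def regretConst (K : ℕ) (σ ε : ℝ) : ℝ :=
  σ + 1 + 2 * σ * K + Fintype.card (PseudoBasis K) * (9 * σ / ε) *
    (1 + 4 * K * ∑' n : ℕ, 1 / (n : ℝ) ^ 3) +
    18 * Fintype.card (PseudoBasis K) * (σ + Fintype.card (PseudoBasis K) * (σ / ε))

/-- Regret bound at a fixed horizon. -/
theorem IsUCBSimplex.regret_le [IsProbabilityMeasure P] [∀ k, IsProbabilityMeasure (ν k)]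
    (hO : IsOutcomeProcess P ℱ ν X) (hA : IsUCBSimplex ℱ X (1 + 2 * κ) b sel act)
    (hI : IsNondegenerate (meanReward ν) (meanCost ν) b κ σ ε) (hT : 0 < T) :
    regret P ℱ X (b * T) T act ≤
      2 ^ 9 * (1 + 2 * κ) ^ 2 * Real.log T / ε ^ 3 * sumInvGap ν b +
        Fintype.card (PseudoBasis K) * (69 * σ * Real.log T / ε ^ 2) + regretConst K σ ε := by
  classical
  have hb := hI.b_pos
  have hσ := hI.σ_pos
  have hε := hI.ε_pos
  have hT0 : (0 : ℝ) < T := by exact_mod_cast hT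
  set V := lpValue (meanReward ν) (consumption (meanCost ν)) (rhs b) with hV
  set n : ℝ := (Fintype.card (PseudoBasis K) : ℝ) with hn
  have hVb : V ≤ σ * b := lpValue_le_mul hb.le hσ.le hI.reward_le_cost
  have hVσ : V ≤ σ := hVb.trans (mul_le_of_le_one_right hσ.le hI.b_lt_one.le)
  have hexw : ∀ x, ∃ w : ℝ, Straddles (meanCost ν) b x → |w| ≤ σ / ε ∧ ∀ a ∈ playsOf x,
      playReward (meanReward ν) a = objective (meanReward ν) (consumption (meanCost ν)) (rhs b) x
        + w * (playCost (meanCost ν) a - b) := fun x => by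
    by_cases hx : Straddles (meanCost ν) b x
    · obtain ⟨w, hw⟩ := hx.exists_slope hI
      exact ⟨w, fun _ => hw⟩
    · exact ⟨0, fun h => absurd h hx⟩
  choose w hw using hexw
  have hact := hA.measurable_act hO hb hI.b_lt_one
  obtain ⟨hZi, hZ⟩ := integral_compensatedReward_le (b := b) (B := b * T) (T := T) hO hact
    hA.sel_nonAnticipating w
  set Z := compensatedReward ν X act sel b (b * T) w T with hZdef
  obtain ⟨g, hgi, hbg, hg⟩ := hA.exists_badCount_le hO hb hI.b_lt_one (T + 1)
  set E := toMeasurable P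
    {ω | ¬ SmallNoise X act sel (meanCost ν) ε (3 * Real.log T / (4 * ε)) T ω} with hE
  have hEm : MeasurableSet E := measurableSet_toMeasurable _ _
  have hEP : P.real E ≤ 18 * n / T := by
    rw [hE, measureReal_def, measure_toMeasurable, ← measureReal_def]
    exact hA.measureReal_not_smallNoise_le hO hb hI.b_lt_one hε hT
  set U := 2 ^ 9 * (1 + 2 * κ) ^ 2 * Real.log T / ε ^ 3 * sumInvGap ν b +
    n * (69 * σ * Real.log T / ε ^ 2) + 2 * σ * K + n * (9 * σ / ε) with hU
  have hS0 : 0 ≤ sumInvGap ν b := Finset.sum_nonneg fun x hx => by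
    have := (Finset.mem_filter.1 hx).2.2
    positivity
  have hU0 : 0 ≤ U := by positivity
  set M := σ + n * (σ / ε) with hM
  have hg0 : ∀ ω, 0 ≤ g ω := fun ω => (Nat.cast_nonneg _).trans (hbg ω)
  -- When the noise is small, the decomposition over the bases applies. Otherwise `T * V ≤ σ * T`
  -- and the crude bound on `-Z` give `M * T`, which is multiplied by the indicator of `E`.
  have hpath : ∀ ω, T * V - Z ω ≤ U + n * (9 * σ / ε) * g ω + M * T * E.indicator 1 ω := by
    intro ω
    by_cases hω : SmallNoise X act sel (meanCost ν) ε (3 * Real.log T / (4 * ε)) T ω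
    · obtain ⟨N, hNT, hN, hNZ⟩ := exists_compensatedReward_eq ν X act sel b (b * T) w T ω
      have h1 := hA.mul_lpValue_sub_le hI (fun x hx => (hw x hx).2) hNT hN
      have h2 : ∑ x, basisLoss X act sel (meanReward ν) (meanCost ν) b σ w x (N + 1) ω ≤
          2 ^ 9 * (1 + 2 * κ) ^ 2 * Real.log T / ε ^ 3 * sumInvGap ν b +
          n * (69 * σ * Real.log T / ε ^ 2) + n * (9 * σ / ε * (1 + g ω)) := by
        refine (Finset.sum_le_sum fun x _ =>
          hA.basisLoss_le hI (fun x hx => (hw x hx).1) hω (by omega : N + 1 ≤ T + 1)).trans ?_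
        rw [Finset.sum_add_distrib, Finset.sum_add_distrib, ← Finset.mul_sum, Finset.sum_const,
          Finset.sum_const, nsmul_eq_mul, nsmul_eq_mul, Finset.card_univ, ← hn]
        refine add_le_add (add_le_add (le_of_eq ?_) le_rfl) ?_
        · rw [← Finset.sum_filter]; rfl
        · have h3 : (badCount X act (meanReward ν) (meanCost ν) (N + 1) ω : ℝ) ≤ g ω :=
            (Nat.cast_le.2 (badCount_mono (by omega))).trans (hbg ω)
          gcongr
      have h3 : 0 ≤ M * T * E.indicator 1 ω :=
        mul_nonneg (by positivity) (Set.indicator_nonneg (fun _ _ => zero_le_one) _)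
      rw [hZdef, hNZ]
      rw [hU]
      linarith
    · have h1 : E.indicator (1 : Ω → ℝ) ω = 1 := by
        rw [Set.indicator_of_mem (subset_toMeasurable _ _ hω)]; rfl
      have h2 := neg_compensatedReward_le (X := X) (act := act) (sel := sel) (B := b * T) (T := T)
        (ω := ω) (by positivity : 0 ≤ σ / ε) (fun x hx => (hw x hx).1)
      have h3 : T * V ≤ T * σ := mul_le_mul_of_nonneg_left hVσ hT0.le
      have h4 : 0 ≤ n * (9 * σ / ε) * g ω := mul_nonneg (by positivity) (hg0 ω)
      rw [h1, hM]
      rw [← hZdef, ← hn] at h2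
      linarith
  have hi1 : Integrable (fun ω => U + n * (9 * σ / ε) * g ω) P :=
    (integrable_const U).add (hgi.const_mul _)
  have hi2 : Integrable (fun ω => M * T * E.indicator (1 : Ω → ℝ) ω) P :=
    ((integrable_const (1 : ℝ)).indicator hEm).const_mul (M * T)
  have hint := integral_mono ((integrable_const (T * V)).sub hZi) (hi1.add hi2) hpath
  have hrhs : ∫ ω, (U + n * (9 * σ / ε) * g ω + M * T * E.indicator 1 ω) ∂P =
      U + n * (9 * σ / ε) * ∫ ω, g ω ∂P + M * T * P.real E := by
    rw [integral_add hi1 hi2, integral_add (integrable_const U) (hgi.const_mul _), integral_const_mul, integral_const_mul,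
      integral_indicator_one hEm]
    simp
  have hlhs : ∫ ω, (T * V - Z ω) ∂P = T * V - ∫ ω, Z ω ∂P := by
    rw [integral_sub (integrable_const _) hZi]
    simp
  have hint' : T * V - ∫ ω, Z ω ∂P ≤ U + n * (9 * σ / ε) * ∫ ω, g ω ∂P + M * T * P.real E := by
    rw [← hrhs, ← hlhs]
    exact hint
  have h1 : n * (9 * σ / ε) * ∫ ω, g ω ∂P ≤
      n * (9 * σ / ε) * (4 * K * ∑' n : ℕ, 1 / (n : ℝ) ^ 3) :=
    mul_le_mul_of_nonneg_left hg (by positivity)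
  have h2 : M * T * P.real E ≤ M * (18 * n) := by
    calc M * T * P.real E ≤ M * T * (18 * n / T) := mul_le_mul_of_nonneg_left hEP (by positivity)
      _ = M * (18 * n) := by field_simp
  -- The overshoot term of the benchmark: `V ≤ σ * b` cancels 1/b.
  have h3 : 1 / b * V ≤ σ := by
    rw [one_div, inv_mul_le_iff₀ hb]
    linarith
  have h4 := optPayoff_le hO hb T
  rw [← hV] at h4
  rw [regret, regretConst, ← hn]
  linarith

theorem isNondegenerate_margin [∀ k, IsProbabilityMeasure (ν k)] (hK : 0 < K) (hb : 0 < b)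
    (hb1 : b < 1) (hσ : 0 < σ) (hκ : 0 < κ) (h1 : ∀ k, meanReward ν k ≤ σ * meanCost ν k)
    (h2 : ∀ k l, |meanReward ν k - meanReward ν l| ≤ κ * |meanCost ν k - meanCost ν l|)
    (h3 : ∀ k, 0 < |meanCost ν k - b|) :
    IsNondegenerate (meanReward ν) (meanCost ν) b κ σ (margin ν b) := by
  have : Nonempty (Fin K) := ⟨⟨0, hK⟩⟩
  obtain ⟨k₀, hk₀⟩ := exists_eq_ciInf_of_finite (f := fun k => |meanCost ν k - b|)
  have hm : margin ν b = |meanCost ν k₀ - b| := hk₀.symm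
  refine ⟨hb, hb1, hκ, hσ, hm ▸ h3 k₀, ?_, fun k => (meanReward_mem k).1,
    fun k => (meanReward_mem k).2, fun k => (meanCost_mem k).1, fun k => (meanCost_mem k).2, h1,
    fun k => ciInf_le (Set.finite_range _).bddBelow k, h2⟩
  have h4 := meanCost_mem (ν := ν) k₀
  rw [hm, abs_le]
  constructor <;> linarith [h4.1, h4.2]

theorem sumInvGap_le (hK : 0 < K) {Δ : ℝ} (hΔ : 0 < Δ)
    (h : ∀ x : PseudoBasis K, FeasibleBasis ν b x → 0 < gap ν b x → Δ ≤ gap ν b x) :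
    sumInvGap ν b ≤ 3 * (K : ℝ) ^ 2 / Δ := by
  classical
  calc sumInvGap ν b ≤ ∑ x : PseudoBasis K with FeasibleBasis ν b x ∧ 0 < gap ν b x, 1 / Δ := by
        refine Finset.sum_le_sum fun x hx => ?_
        obtain ⟨-, h1, h2⟩ := Finset.mem_filter.1 hx
        exact one_div_le_one_div_of_le hΔ (h x h1 h2)
    _ = ((Finset.univ.filter fun x => FeasibleBasis ν b x ∧ 0 < gap ν b x).card : ℝ) * (1 / Δ) := by
        rw [Finset.sum_const, nsmul_eq_mul]
    _ ≤ 3 * (K : ℝ) ^ 2 * (1 / Δ) := by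
        refine mul_le_mul_of_nonneg_right (le_trans ?_ (card_pseudoBasis_le hK)) (by positivity)
        exact_mod_cast Finset.card_le_univ _
    _ = _ := by ring

end Regret

end KnapsackBandit

end

/-! ### Absorbing the constants into the logarithm -/

theorem mainTheorem1 :
    -- the constant hidden in the `O` notation is universal
    ∃ C : ℝ, 0 < C ∧
      ∀ (K : ℕ) (_ : 0 < K) (ν : Fin K → Measure (unitInterval × unitInterval))
        (_ : ∀ k, IsProbabilityMeasure (ν k)) (b κ σ : ℝ),
        0 < b → b < 1 → 0 < σ → 0 < κ →
        -- rewards are dominated by costs on average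
        (∀ k, meanReward ν k ≤ σ * meanCost ν k) →
        -- Lipschitz relation between mean rewards and mean costs
        (∀ k l, |meanReward ν k - meanReward ν l| ≤ κ * |meanCost ν k - meanCost ν l|) →
        -- non-degeneracy
        (∀ k, 0 < |meanCost ν k - b|) →
        ∃ T₀ : ℕ, ∀ T : ℕ, T₀ ≤ T →
          ∀ (Ω : Type*) [mΩ : MeasurableSpace Ω] (P : Measure Ω) [IsProbabilityMeasure P]
            (ℱ : Filtration ℕ mΩ) (X : ℕ → Fin K → Ω → unitInterval × unitInterval)
            (sel : ℕ → Ω → PseudoBasis K) (act : ℕ → Ω → Play K),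
            IsOutcomeProcess P ℱ ν X →
            IsUCBSimplex ℱ X (1 + 2 * κ) b sel act →
            (regret P ℱ X (b * T) T act ≤
              2 ^ 9 * (1 + 2 * κ) ^ 2 / margin ν b ^ 3 * sumInvGap ν b * Real.log T
                + C * ((K : ℝ) ^ 2 * σ / margin ν b ^ 3 * Real.log T)) ∧
            -- consequently, with `Δ` (a lower bound on) the smallest positive gap
            ∀ Δ : ℝ, 0 < Δ →
              (∀ x : PseudoBasis K, FeasibleBasis ν b x → 0 < gap ν b x → Δ ≤ gap ν b x) →
              regret P ℱ X (b * T) T act ≤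
                C * ((K : ℝ) ^ 2 * ((1 + 2 * κ) ^ 2 / (margin ν b ^ 3 * Δ) + σ / margin ν b ^ 3)
                  * Real.log T) := by
  -- The proof needs 3 · 69 + 1 = 208 for the term in `σ` and 3 · 2⁹ = 1536 for the term in `Δ`;
  -- both are below 2000.
  refine ⟨2000, by norm_num, ?_⟩
  intro K hK ν hν b κ σ hb hb1 hσ hκ h1 h2 h3
  have := hν
  have hI := isNondegenerate_margin hK hb hb1 hσ hκ h1 h2 h3
  have hε := hI.ε_pos
  set ε := margin ν b
  have hu : 0 < (K : ℝ) ^ 2 * σ / ε ^ 3 := by positivity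
  have hlog : Filter.Tendsto (fun T : ℕ => (K : ℝ) ^ 2 * σ / ε ^ 3 * Real.log T) Filter.atTop
      Filter.atTop :=
    (Real.tendsto_log_atTop.comp tendsto_natCast_atTop_atTop).const_mul_atTop hu
  -- From `T₀` on, the horizon-free part of the bound is at most K² σ ε⁻³ ln T.
  obtain ⟨T₀, hT₀⟩ := Filter.eventually_atTop.1
    ((hlog.eventually_ge_atTop (regretConst K σ ε)).and (Filter.eventually_gt_atTop 0))
  refine ⟨T₀, fun T hT Ω mΩ P hP ℱ X sel act hO hA => ?_⟩
  obtain ⟨hconst, hT0⟩ := hT₀ T hT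
  have hreg := hA.regret_le hO hI hT0
  have hcard : Fintype.card (PseudoBasis K) * (69 * σ * Real.log T / ε ^ 2) ≤
      207 * ((K : ℝ) ^ 2 * σ / ε ^ 3 * Real.log T) := by
    have h4 : 69 * σ * Real.log T / ε ^ 2 ≤ 69 * σ * Real.log T / ε ^ 3 :=
      div_le_div_of_nonneg_left (by positivity) (by positivity)
        (pow_le_pow_of_le_one hε.le hI.ε_le_one (by norm_num))
    calc _ ≤ 3 * (K : ℝ) ^ 2 * (69 * σ * Real.log T / ε ^ 3) :=
          mul_le_mul (card_pseudoBasis_le hK) h4 (by positivity) (by positivity)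
      _ = _ := by ring
  have h0 : 0 ≤ (K : ℝ) ^ 2 * σ / ε ^ 3 * Real.log T := by positivity
  have hmain : 2 ^ 9 * (1 + 2 * κ) ^ 2 * Real.log T / ε ^ 3 * sumInvGap ν b =
      2 ^ 9 * (1 + 2 * κ) ^ 2 / ε ^ 3 * sumInvGap ν b * Real.log T := by ring
  rw [hmain] at hreg
  refine ⟨by linarith, fun Δ hΔ hgap => ?_⟩
  have hsum := sumInvGap_le hK hΔ hgap
  have h5 : 2 ^ 9 * (1 + 2 * κ) ^ 2 / ε ^ 3 * sumInvGap ν b * Real.log T ≤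
      1536 * ((K : ℝ) ^ 2 * ((1 + 2 * κ) ^ 2 / (ε ^ 3 * Δ)) * Real.log T) := by
    calc _ ≤ 2 ^ 9 * (1 + 2 * κ) ^ 2 / ε ^ 3 * (3 * (K : ℝ) ^ 2 / Δ) * Real.log T := by gcongr
      _ = _ := by field_simp; ring
  have h6 : 0 ≤ (K : ℝ) ^ 2 * ((1 + 2 * κ) ^ 2 / (ε ^ 3 * Δ)) * Real.log T := by positivity
  have h7 : 2000 * ((K : ℝ) ^ 2 * ((1 + 2 * κ) ^ 2 / (ε ^ 3 * Δ) + σ / ε ^ 3) * Real.log T) =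
      2000 * ((K : ℝ) ^ 2 * ((1 + 2 * κ) ^ 2 / (ε ^ 3 * Δ)) * Real.log T) +
      2000 * ((K : ℝ) ^ 2 * σ / ε ^ 3 * Real.log T) := by ring
  rw [h7]
  linarith
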